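/- **Model.** Pico base stations (BSs) form a homogeneous Poisson point process $\Phi_2=\{x_j\}$ of density $\lambda_2>0$ on $\mathbb R^2$; the typical user is at the origin. Each BS independently caches the requested ($f$-th) file with probability $p=p_{2,f}\in[0,1]$; $\Phi_{2,f}$ is the set of BSs that cache it. BS $x$ has an independent fading power $|h_x|^2$ with the Gamma law of shape $N\in\mathbb N_{\ge1}$ (the Nakagami parameter $N_2^p$) and mean $1$, and an independent $\omega_x$ uniform on $[-\frac d\lambda,\frac d\lambda]$ ($d,\lambda>0$). The path loss is $L_2(r)=C_2r^{-\alpha}$ for $r\le R_L$ and $0$ for $r>R_L$ ($\alpha\ge2$, $R_L,C_2>0$), and the array gain is $G_2(\omega)=\frac{\sin^2(\pi N_2\omega)}{N_2^2\sin^2(\pi\omega)}$ ($N_2\ge1$ antennas; value $1$ where $\sin\pi\omega=0$). The serving BS $x_0$ is the nearest point of $\Phi_{2,f}$ and has gain $G_0=1$. With transmit power $P_2>0$ and noise power $\sigma_2^2>0$, $$\Upsilon_{2,f}=\frac{P_2L_2(\|x_0\|)G_0N_2|h_{x_0}|^2}{\sigma_2^2+I},\qquad I=\sum_{x\in\Phi_2\setminus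 x_0}P_2L_2(\|x\|)N_2|h_x|^2G_2(\omega_x),$$ and $\dot P_{\Upsilon_{2,f}}(\tau)=\mathbb P[x_0\text{ exists and }\Upsilon_{2,f}>\tau]$, for a threshold $\tau\ge0$. **Expression.** Let $\eta_L=N(N!)^{-1/N}$, $P_{2,f}(r)=2\pi p\lambda_2re^{-\pi p\lambda_2r^2}$, $x^{(u)}_k=\cos\frac{(2k-1)\pi}{2u}$, and $X=sG_2(\omega)\tau/N$. For $\alpha>2$ let $$W_f(\omega,s,\tau)=p\,S(X r^{-\alpha})r^2+(1-p)\Delta(X)-S(XR_L^{-\alpha})R_L^2,$$ with $S(z)={}_2F_1(-\frac2\alpha,N;1-\frac2\alpha;-z)$ and $\Delta(z)=\frac{\Gamma(1-2/\alpha)\Gamma(N+2/\alpha)}{\Gamma(N)}z^{2/\alpha}$. For $\alpha=2$ let $W_f(\omega,s,\tau)=X\big(F_y(X/R_L^2)-pF_y(X/r^2)\big)$, with $$F_y(y)=N\ln(1+\tfrac1y)-\frac1{y(1+y)^{N-1}}-\sum_{m=1}^{N-1}\frac{N}{(1+y)^{N-m}(N-m)},$$ and with the limit value $pr^2-R_L^2$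 at $X=0$. Put $$\mathcal L_2^{(u_1)}(s,\tau)=\exp\Big(-\pi\lambda_2(R_L^2-pr^2)-\frac{\pi^2\lambda_2}{2u_1}\sum_{k=1}^{u_1}W_f\big(x_k^{(u_1)}\tfrac d\lambda,s,\tau\big)\sqrt{1-(x^{(u_1)}_k)^2}\Big),$$ $$\dot F_D(r,\tau)=\mathcal L_2^{(u_1)}\Big(\frac{n\eta_Lr^\alpha}{G_0},\tau\Big)\exp\Big(-\frac{n\eta_Lr^\alpha\tau\sigma_2^2}{P_2C_2N_2G_0}\Big)P_{2,f}(r),$$ $$Q_{u_1,u_2}(\tau)=\frac{\pi R_L}{2u_2}\sum_{n=1}^N(-1)^{n+1}\binom Nn\sum_{k=1}^{u_2}\dot F_D\Big(\frac{(x^{(u_2)}_k+1)R_L}2,\tau\Big)\sqrt{1-(x^{(u_2)}_k)^2}.$$ **Theorem 1.** $\dot P_{\Upsilon_{2,f}}(\tau)\approx Q_{u_1,u_2}(\tau)$ in the following sense. 1. As $u_1,u_2\to\infty$ jointly, $Q_{u_1,u_2}(\tau)$ converges to $$J(\tau)=\sum_{n=1}^N(-1)^{n+1}\binom Nn\int_0^{R_L}\mathcal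 L_2\Big(\frac{n\eta_Lr^\alpha}{G_0},\tau\Big)\exp\Big(-\frac{n\eta_Lr^\alpha\tau\sigma_2^2}{P_2C_2N_2G_0}\Big)P_{2,f}(r)\,dr,$$ where $\mathcal L_2(s,\tau)=\exp\big(-\pi\lambda_2(R_L^2-pr^2)-\frac{\pi\lambda_2\lambda}{2d}\int_{-d/\lambda}^{d/\lambda}W_f(\omega,s,\tau)\,d\omega\big)$. 2. $J(\tau)$ is the coverage probability with the Gamma distribution function $\mathbb P[|h|^2<\gamma]$ replaced by $(1-e^{-\eta_L\gamma})^N$: $$J(\tau)=\mathbb E\Big[\mathbf 1\{x_0\text{ exists},\|x_0\|\le R_L\}\big(1-(1-e^{-\eta_L\gamma_0})^N\big)\Big],\qquad \gamma_0=\frac{\tau(\sigma_2^2+I)}{P_2L_2(\|x_0\|)G_0N_2}.$$ 3. Consequently $$\dot P_{\Upsilon_{2,f}}(\tau)\le J(\tau)\le\dot P_{\Upsilon_{2,f}}(\tau)+\varepsilon_N\big(1-e^{-\pi p\lambda_2R_L^2}\big),\qquad \varepsilon_N=\sup_{\gamma\ge0}\Big|\mathbb P[|h|^2<\gamma]-(1-e^{-\eta_L\gamma})^N\Big|,$$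 and $J(\tau)=\dot P_{\Upsilon_{2,f}}(\tau)$ if $N=1$. -/

import Mathlib

open MeasureTheory ProbabilityTheory Filter
open scoped Topology NNReal

noncomputable section

namespace Pico

/-! ### Deterministic ingredients -/

/-- Parameters of the millimetre-wave pico tier and of the requested file. -/
structure Params where
  /-- density of the pico base stations -/
  dens : ℝ
  /-- probability that a pico base station caches the requested file -/
  p : unitInterval
  /-- radius of the line-of-sight ball -/
  RL : ℝ
  /-- path loss exponent -/
  α : ℝ
  /-- path loss intercept -/
  C : ℝ
  /-- transmit power -/
  Pt : ℝ
  /-- number of antenna elements -/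
  Nant : ℕ
  /-- Nakagami fading parameter -/
  Np : ℕ
  /-- noise power `σ²` -/
  noise : ℝ
  /-- antenna spacing -/
  d : ℝ
  /-- wavelength -/
  wl : ℝ
  dens_pos : 0 < dens
  RL_pos : 0 < RL
  two_le_α : 2 ≤ α
  C_pos : 0 < C
  Pt_pos : 0 < Pt
  Nant_pos : 0 < Nant
  Np_pos : 0 < Np
  noise_pos : 0 < noise
  d_pos : 0 < d
  wl_pos : 0 < wl

/-- Maximal directivity gain, provided by the serving base station. -/
def G0 : ℝ := 1

/-- The unit step function. -/
def unitStep (x : ℝ) : ℝ := if 0 ≤ x then 1 else 0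

/-- Gauss hypergeometric function `₂F₁(a, b; c; x)` for real `x < 1`: the power series for `|x| < 1`,
and for `x ≤ -1` its analytic continuation along the negative axis, given by Pfaff's formula
`₂F₁(a, b; c; x) = (1 - x)^(-b) ₂F₁(c - a, b; c; x / (x - 1))`, where `x / (x - 1) ∈ [1/2, 1)`. -/
def gaussHyp (a b c x : ℝ) : ℝ :=
  if |x| < 1 then ordinaryHypergeometric a b c x
  else (1 - x) ^ (-b) * ordinaryHypergeometric (c - a) b c (x / (x - 1))

/-- The `k`-th of the `u` Gauss–Chebyshev nodes over `[-1, 1]`. -/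
def node (u k : ℕ) : ℝ := Real.cos ((2 * k - 1) / (2 * u) * Real.pi)

namespace Params

variable (T : Params)

/-- Path loss law `L(r) = U(R_L - r) C r^(-α)`. -/
def L (r : ℝ) : ℝ := unitStep (T.RL - r) * (T.C * r ^ (-T.α))

/-- Array gain of the uniform linear array, `sin²(π N ω) / (N² sin²(π ω))`, with its limit value `1`
where `sin (π ω) = 0`. -/
def G (ω : ℝ) : ℝ :=
  if Real.sin (Real.pi * ω) = 0 then 1
  else Real.sin (Real.pi * T.Nant * ω) ^ 2 / (T.Nant ^ 2 * Real.sin (Real.pi * ω) ^ 2)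

/-- `η_L = N_p (N_p!)^(-1/N_p)`. -/
def η : ℝ := T.Np * (T.Np.factorial : ℝ) ^ (-(1 / T.Np : ℝ))

/-- Density of the distance to the nearest base station that caches the file. -/
def distPDF (r : ℝ) : ℝ :=
  2 * Real.pi * T.p * T.dens * r * Real.exp (-(Real.pi * T.p * T.dens * r ^ 2))

/-- `S(z) = ₂F₁(-2/α, N_p; 1 - 2/α; -z)`. -/
def S (z : ℝ) : ℝ := gaussHyp (-(2 / T.α)) T.Np (1 - 2 / T.α) (-z)

/-- `Δ(z) = Γ(1 - 2/α) Γ(N_p + 2/α) Γ(N_p)⁻¹ z^(2/α)`. -/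
def Δ (z : ℝ) : ℝ :=
  Real.Gamma (1 - 2 / T.α) * Real.Gamma (T.Np + 2 / T.α) * (Real.Gamma T.Np)⁻¹ * z ^ (2 / T.α)

/-- `F_y`, used when `α = 2`. -/
def Fy (y : ℝ) : ℝ :=
  T.Np * Real.log (1 + 1 / y) - 1 / (y * (1 + y) ^ (T.Np - 1))
    - ∑ m ∈ Finset.Icc 1 (T.Np - 1), (T.Np : ℝ) / ((1 + y) ^ (T.Np - m) * ((T.Np - m : ℕ) : ℝ))

/-- `W_f(ω, s, τ)` at serving distance `r`. For `α = 2` the formula has a removable singularity at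
`s G(ω) τ = 0`, where the limit value is taken. -/
def W (r ω s τ : ℝ) : ℝ :=
  if T.α = 2 then
    if s * T.G ω * τ = 0 then T.p * r ^ 2 - T.RL ^ 2
    else s * T.G ω * τ / T.Np *
      (T.Fy (s * T.G ω * τ / (T.Np * T.RL ^ 2)) - T.p * T.Fy (s * T.G ω * τ / (T.Np * r ^ 2)))
  else
    T.p * T.S (s * T.G ω * τ / (T.Np * r ^ T.α)) * r ^ 2
      + (1 - T.p) * T.Δ (s * T.G ω * τ / T.Np)
      - T.S (s * T.G ω * τ / (T.Np * T.RL ^ T.α)) * T.RL ^ 2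

/-- Laplace transform of the interference at serving distance `r`, with the average over the
antenna angle discretized by `u₁` Gauss–Chebyshev nodes. -/
def laplaceGC (u₁ : ℕ) (r s τ : ℝ) : ℝ :=
  Real.exp (-(Real.pi * T.dens * (T.RL ^ 2 - T.p * r ^ 2))
    - Real.pi ^ 2 * T.dens / (2 * u₁) *
      ∑ k ∈ Finset.Icc 1 u₁, T.W r (node u₁ k * T.d / T.wl) s τ * √(1 - node u₁ k ^ 2))

/-- Laplace transform of the interference at serving distance `r`, with the exact average over the
antenna angle. -/
def laplace (r s τ : ℝ) : ℝ :=
  Real.exp (-(Real.pi * T.dens * (T.RL ^ 2 - T.p * r ^ 2))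
    - Real.pi * T.dens * T.wl / (2 * T.d) * ∫ ω in (-(T.d / T.wl))..(T.d / T.wl), T.W r ω s τ)

/-- Noise factor times distance density: the part of `F_D` other than the Laplace transform. -/
def noiseDist (n : ℕ) (r τ : ℝ) : ℝ :=
  Real.exp (-(n * T.η * r ^ T.α * τ * T.noise / (T.Pt * T.C * T.Nant * G0))) * T.distPDF r

/-- `F_D(r, τ)` for the `n`-th summand. -/
def FD (u₁ n : ℕ) (r τ : ℝ) : ℝ :=
  T.laplaceGC u₁ r (n * T.η * r ^ T.α / G0) τ * T.noiseDist n r τ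

/-- The Gauss–Chebyshev expression for the coverage probability. -/
def coverageGC (u₁ u₂ : ℕ) (τ : ℝ) : ℝ :=
  Real.pi * T.RL / (2 * u₂) *
    ∑ n ∈ Finset.Icc 1 T.Np, (-1) ^ (n + 1) * (T.Np.choose n : ℝ) *
      ∑ k ∈ Finset.Icc 1 u₂, T.FD u₁ n ((node u₂ k + 1) * T.RL / 2) τ * √(1 - node u₂ k ^ 2)

/-- The integral expression that the Gauss–Chebyshev expression discretizes. -/
def coverageInt (τ : ℝ) : ℝ :=
  ∑ n ∈ Finset.Icc 1 T.Np, (-1) ^ (n + 1) * (T.Np.choose n : ℝ) *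
    ∫ r in (0 : ℝ)..T.RL, T.laplace r (n * T.η * r ^ T.α / G0) τ * T.noiseDist n r τ

/-- Largest deviation between the distribution function `P[|h|² < γ]` of the normalized Gamma law
and its replacement `(1 - exp(-η_L γ))^N_p`. -/
def gammaGap : ℝ :=
  ⨆ γ : ℝ≥0, |(gammaMeasure T.Np T.Np).real (Set.Iio (γ : ℝ))
    - (1 - Real.exp (-(T.η * γ))) ^ T.Np|

end Params

/-! ### The random network -/

/-- The Euclidean plane. -/
abbrev Plane := EuclideanSpace ℝ (Fin 2)

variable {Ω : Type*} [MeasurableSpace Ω]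

/-- Number of points of the enumerated point process `X` in the set `B`. -/
def count (X : ℕ → Ω → Plane) (B : Set Plane) (ω : Ω) : ℕ∞ := {i | X i ω ∈ B}.encard

/-- `X` enumerates a homogeneous Poisson point process of density `dens` on the plane: the numbers
of points in sets of finite area are Poisson with mean `dens` times the area, and those in disjoint
sets are independent. -/
structure IsHPPP (P : Measure Ω) (dens : ℝ) (X : ℕ → Ω → Plane) : Prop where
  measurable : ∀ i, Measurable (X i)
  poisson : ∀ B : Set Plane, MeasurableSet B → volume B ≠ ⊤ →
    HasLaw (count X B)
      ((poissonMeasure (dens * (volume B).toReal).toNNReal).map (fun n : ℕ => (n : ℕ∞))) P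
  indep : ∀ (m : ℕ) (B : Fin m → Set Plane), (∀ k, MeasurableSet (B k)) →
    (∀ k, volume (B k) ≠ ⊤) → Pairwise (fun k l => Disjoint (B k) (B l)) →
    iIndepFun (fun k => count X (B k)) P

/-- The random pico tier: base station `i` is at `X i`, `c i` tells whether it caches the requested
file, `g i` is its fading power `|h|²` and `θ i` the argument of its array gain. The marks
`(c i, g i, θ i)` are i.i.d., independent of the locations, with independent components. -/
structure IsNetwork (T : Params) (P : Measure Ω) (X : ℕ → Ω → Plane) (c : ℕ → Ω → Bool)
    (g θ : ℕ → Ω → ℝ) : Prop where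
  hppp : IsHPPP P T.dens X
  meas_c : ∀ i, Measurable (c i)
  meas_g : ∀ i, Measurable (g i)
  meas_θ : ∀ i, Measurable (θ i)
  law : ∀ i, HasLaw (fun ω => (c i ω, g i ω, θ i ω))
    ((bernoulliMeasure true false T.p).prod ((gammaMeasure T.Np T.Np).prod
      (ProbabilityTheory.cond volume (Set.Icc (-(T.d / T.wl)) (T.d / T.wl))))) P
  marks_indep : iIndepFun (fun i ω => (c i ω, g i ω, θ i ω)) P
  indep : IndepFun (fun ω i => X i ω) (fun ω i => (c i ω, g i ω, θ i ω)) P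

/-- Base station `i` serves the typical user at the origin: it is a nearest one among those that
cache the file. -/
def IsServing (X : ℕ → Ω → Plane) (c : ℕ → Ω → Bool) (i : ℕ) (ω : Ω) : Prop :=
  c i ω = true ∧ ∀ j, c j ω = true → ‖X i ω‖ ≤ ‖X j ω‖

/-- Power received from the interfering base station `j`. -/
def rxPower (T : Params) (X : ℕ → Ω → Plane) (g θ : ℕ → Ω → ℝ) (j : ℕ) (ω : Ω) : ℝ :=
  T.Pt * T.L ‖X j ω‖ * (T.Nant * g j ω * T.G (θ j ω))

/-- Interference from the other base stations that cache the file. -/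
def interfCached (T : Params) (X : ℕ → Ω → Plane) (c : ℕ → Ω → Bool) (g θ : ℕ → Ω → ℝ)
    (i : ℕ) (ω : Ω) : ℝ :=
  ∑' j, if j ≠ i ∧ c j ω = true then rxPower T X g θ j ω else 0

/-- Interference from the base stations that do not cache the file. -/
def interfUncached (T : Params) (X : ℕ → Ω → Plane) (c : ℕ → Ω → Bool) (g θ : ℕ → Ω → ℝ)
    (ω : Ω) : ℝ :=
  ∑' j, if c j ω = false then rxPower T X g θ j ω else 0

/-- Signal-to-interference-plus-noise ratio when base station `i` serves. -/
def sinr (T : Params) (X : ℕ → Ω → Plane) (c : ℕ → Ω → Bool) (g θ : ℕ → Ω → ℝ)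
    (i : ℕ) (ω : Ω) : ℝ :=
  T.Pt * T.L ‖X i ω‖ * G0 * T.Nant * g i ω /
    (T.noise + interfCached T X c g θ i ω + interfUncached T X c g θ ω)

/-- Coverage probability: the serving base station exists and its SINR exceeds `τ`. -/
def coverage (T : Params) (P : Measure Ω) (X : ℕ → Ω → Plane) (c : ℕ → Ω → Bool)
    (g θ : ℕ → Ω → ℝ) (τ : ℝ) : ℝ :=
  P.real {ω | ∃ i, IsServing X c i ω ∧ τ < sinr T X c g θ i ω}

/-- The fading power that the link from a line-of-sight base station `i` has to exceed for its SINR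
to exceed `τ`. -/
def fadingLevel (T : Params) (X : ℕ → Ω → Plane) (c : ℕ → Ω → Bool) (g θ : ℕ → Ω → ℝ)
    (τ : ℝ) (i : ℕ) (ω : Ω) : ℝ :=
  τ * (T.noise + interfCached T X c g θ i ω + interfUncached T X c g θ ω) /
    (T.Pt * T.L ‖X i ω‖ * G0 * T.Nant)

open Classical in
/-- `1 - (1 - exp(-η_L γ))^N_p` at the fading level `γ` of the serving base station if that one is
in the line-of-sight ball, and `0` otherwise (the sum has almost surely at most one nonzero term):
the conditional coverage probability with the Gamma distribution function replaced. -/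
def replacedCoverage (T : Params) (X : ℕ → Ω → Plane) (c : ℕ → Ω → Bool) (g θ : ℕ → Ω → ℝ)
    (τ : ℝ) (ω : Ω) : ℝ :=
  ∑' i, if IsServing X c i ω ∧ ‖X i ω‖ ≤ T.RL then
    1 - (1 - Real.exp (-(T.η * fadingLevel T X c g θ τ i ω))) ^ T.Np else 0

end Pico

end

noncomputable section

namespace Pico

/-! ### Riemann sums -/

/-! Coverage is a sum over base stations: almost surely at most one station of the line-of-sight
ball serves, and beyond the ball the signal is zero, so nothing there can exceed `τ ≥ 0`. Given the
locations and the other marks, the fading power of station `i` is independent of the level it has to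
exceed, so the summand becomes `1 - F(level)` with `F` the Gamma distribution function
(`integral_fading_gt_level`, `hasSum_integral_payoff_coverage`).

Replacing `F` by `(1 - exp(-η γ))^N` and expanding binomially leaves weights `exp(-n η γ)`. The
level is affine in the interference, and the event of being nearest is a product of zero-one
factors, so the weight is a product of functions of single marks (`payoff_exp_eq`). Averaging the
marks gives one factor `ret` per other station, and the Campbell–Mecke formula `integral_pointSum`
averages the locations. That formula is derived from Poisson counts alone: the ball is cut into
annuli of equal area, the counts are independent, and the resulting double Riemann sum converges.

The closed form appears because `W` is minus the integral of `thin * kern` over squared distances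
(`W_eq_integral_thin`). This rests on explicit primitives of `kern`: for `α > 2` a first-order
differential equation for `S` and its growth constant at infinity, for `α = 2` the derivative of
`F_y`. With `integral_laplace_eq` the Campbell–Mecke integral becomes `coverageInt`.

The Gauss–Chebyshev limit holds because `x = cos(π y)` turns the quadrature into a midpoint sum. The
inner integrand moves with `u₁` and with the outer node, so the quadrature theorem is proved for
continuously converging families; this yields the joint limit.

The lower bound `coverage ≤ coverageInt` is Alzer's inequality `replacement_le_fadingCDF`: the
difference of the two distribution functions vanishes at `0` and at infinity, and once it starts to
decrease it never increases again. The upper bound pays `gammaGap` on the event that a caching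
station lies in the ball, whose probability is the case `n = 0` of the same Campbell–Mecke
computation. -/

theorem sum_div_eq_integral_floor {m : ℕ} (hm : 0 < m) (h : ℕ → ℝ) :
    (∑ k ∈ Finset.range m, h k) / m = ∫ t in (0 : ℝ)..1, h ⌊(m : ℝ) * t⌋₊ := by
  have hm' : (0 : ℝ) < m := by exact_mod_cast hm
  have heq : ∀ k : ℕ, Set.EqOn (fun _ : ℝ => h k) (fun t : ℝ => h ⌊(m : ℝ) * t⌋₊)
      (Set.Ioo ((k : ℝ) / m) (((k + 1 : ℕ) : ℝ) / m)) := by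
    intro k t ht
    have h1 := (div_lt_iff₀ hm').1 ht.1
    have h2 := (lt_div_iff₀ hm').1 ht.2
    have : ⌊(m : ℝ) * t⌋₊ = k := by
      rw [Nat.floor_eq_iff (le_trans (Nat.cast_nonneg k) (by linarith))]
      push_cast at h2
      constructor <;> linarith
    simp [this]
  have hle : ∀ k : ℕ, (k : ℝ) / m ≤ ((k + 1 : ℕ) : ℝ) / m := by
    intro k
    gcongr
    simp
  have key := intervalIntegral.sum_integral_adjacent_intervals (μ := volume)
    (f := fun t : ℝ => h ⌊(m : ℝ) * t⌋₊) (a := fun k : ℕ => (k : ℝ) / m) (n := m) (by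
      intro k _
      refine (intervalIntegrable_const (c := h k)).congr_uIoo ?_
      rw [Set.uIoo_of_le (hle k)]
      exact heq k)
  simp only [CharP.cast_eq_zero, zero_div, div_self hm'.ne'] at key
  rw [← key, Finset.sum_div]
  refine Finset.sum_congr rfl fun k _ => ?_
  rw [← intervalIntegral.integral_congr_Ioo_of_le (hle k) (heq k),
    intervalIntegral.integral_const]
  push_cast
  rw [smul_eq_mul]
  field_simp
  ring

/-- Riemann sums of a family of functions that converges continuously converge to the integral
of the limit. -/
theorem tendsto_riemann_sum {ι : Type*} {l : Filter ι} [l.IsCountablyGenerated] {u : ι → ℕ}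
    (hu : Tendsto u l atTop) {θ : ℝ} (hθ : 0 < θ) (hθ1 : θ ≤ 1) {h : ι → ℝ → ℝ} {H : ℝ → ℝ} {C : ℝ}
    (hC : ∀ᶠ a in l, ∀ y ∈ Set.Ioc (0 : ℝ) 1, |h a y| ≤ C)
    (hlim : ∀ᵐ x : ℝ, x ∈ Set.Ioo (0 : ℝ) 1 →
      Tendsto (fun q : ι × ℝ => h q.1 q.2) (l ×ˢ 𝓝 x) (𝓝 (H x))) :
    Tendsto (fun a => (∑ k ∈ Finset.range (u a), h a ((k + θ) / u a)) / u a) l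
      (𝓝 (∫ t in (0 : ℝ)..1, H t)) := by
  have hpos : ∀ᶠ a in l, 0 < u a := hu.eventually (eventually_gt_atTop 0)
  have hcast : Tendsto (fun a => (u a : ℝ)) l atTop := tendsto_natCast_atTop_atTop.comp hu
  have hne1 : ∀ᵐ x : ℝ, x ≠ 1 := volume.ae_ne 1
  -- The sum is exactly the integral of a step function, so dominated convergence applies. The tags
  -- `(⌊u t⌋ + θ) / u` move with `a` towards `t`, which is why convergence along `l ×ˢ 𝓝 x` is
  -- assumed.
  refine Tendsto.congr' (f₁ := fun a => ∫ t in (0 : ℝ)..1, h a ((⌊(u a : ℝ) * t⌋₊ + θ) / u a)) ?_ ?_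
  · filter_upwards [hpos] with a ha
    rw [sum_div_eq_integral_floor ha (fun k => h a ((k + θ) / u a))]
  refine intervalIntegral.tendsto_integral_filter_of_dominated_convergence (fun _ => C) ?_ ?_
    intervalIntegrable_const ?_
  · refine Eventually.of_forall fun a => Measurable.aestronglyMeasurable ?_
    exact (measurable_of_countable fun k : ℕ => h a ((k + θ) / u a)).comp
      (Nat.measurable_floor.comp (measurable_const.mul measurable_id))
  · filter_upwards [hC, hpos] with a ha hpa
    have hpa' : (0 : ℝ) < u a := by exact_mod_cast hpa
    filter_upwards [hne1] with x hx1 hx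
    rw [Set.uIoc_of_le zero_le_one] at hx
    refine ha _ ⟨by positivity, ?_⟩
    rw [div_le_one hpa']
    have : ⌊(u a : ℝ) * x⌋₊ < u a := by
      rw [Nat.floor_lt (mul_nonneg hpa'.le hx.1.le)]
      have : x < 1 := lt_of_le_of_ne hx.2 hx1
      nlinarith
    have : ((⌊(u a : ℝ) * x⌋₊ : ℝ) + 1) ≤ u a := by exact_mod_cast this
    linarith
  · filter_upwards [hlim, hne1] with x hx hx1 hmem
    rw [Set.uIoc_of_le zero_le_one] at hmem
    have hx0 : x ∈ Set.Ioo (0 : ℝ) 1 := ⟨hmem.1, lt_of_le_of_ne hmem.2 hx1⟩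
    have hpt : Tendsto (fun a => ((⌊(u a : ℝ) * x⌋₊ : ℝ) + θ) / u a) l (𝓝 x) := by
      have h1 : Tendsto (fun a => ((⌊x * (u a : ℝ)⌋₊ : ℝ)) / u a) l (𝓝 x) :=
        (tendsto_nat_floor_mul_div_atTop hx0.1.le).comp hcast
      have h2 : Tendsto (fun a => θ / (u a : ℝ)) l (𝓝 0) := hcast.const_div_atTop θ
      have := h1.add h2
      simp only [add_zero] at this
      refine this.congr fun a => ?_
      rw [add_div, mul_comm x]
    exact (hx hx0).comp (tendsto_id.prodMk hpt)

/-! ### Gauss–Chebyshev quadrature -/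

theorem integral_comp_cos (H : ℝ → ℝ) :
    ∫ x in (-1 : ℝ)..1, H x =
      Real.pi * ∫ y in (0 : ℝ)..1, H (Real.cos (Real.pi * y)) * Real.sin (Real.pi * y) := by
  have himg : (fun y : ℝ => Real.cos (Real.pi * y)) '' Set.Ioo 0 1 = Set.Ioo (-1) 1 := by
    ext z
    constructor
    · rintro ⟨y, hy, rfl⟩
      have hy1 : 0 < Real.pi * y := mul_pos Real.pi_pos hy.1
      have hy2 : Real.pi * y < Real.pi := by nlinarith [Real.pi_pos, hy.2]
      constructor
      · rw [← Real.cos_pi]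
        exact Real.cos_lt_cos_of_nonneg_of_le_pi hy1.le le_rfl hy2
      · rw [← Real.cos_zero]
        exact Real.cos_lt_cos_of_nonneg_of_le_pi le_rfl hy2.le hy1
    · intro hz
      refine ⟨Real.arccos z / Real.pi, ⟨?_, ?_⟩, ?_⟩
      · exact div_pos (Real.arccos_pos.2 hz.2) Real.pi_pos
      · rw [div_lt_one Real.pi_pos]
        refine lt_of_le_of_ne (Real.arccos_le_pi z) fun h => ?_
        rw [Real.arccos_eq_pi] at h
        linarith [hz.1]
      · show Real.cos (Real.pi * (Real.arccos z / Real.pi)) = z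
        rw [mul_div_cancel₀ _ Real.pi_ne_zero, Real.cos_arccos hz.1.le hz.2.le]
  have hinj : Set.InjOn (fun y : ℝ => Real.cos (Real.pi * y)) (Set.Ioo 0 1) := by
    intro y hy z hz h
    have := Real.injOn_cos (x₁ := Real.pi * y) (x₂ := Real.pi * z)
      ⟨(mul_pos Real.pi_pos hy.1).le, by nlinarith [Real.pi_pos, hy.2]⟩
      ⟨(mul_pos Real.pi_pos hz.1).le, by nlinarith [Real.pi_pos, hz.2]⟩ h
    exact mul_left_cancel₀ Real.pi_ne_zero this
  have key := integral_image_eq_integral_abs_deriv_smul (s := Set.Ioo (0 : ℝ) 1)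
    (f := fun y : ℝ => Real.cos (Real.pi * y))
    (f' := fun y => -Real.sin (Real.pi * y) * Real.pi) measurableSet_Ioo
    (fun y _ => by
      have h1 : HasDerivAt (fun y : ℝ => Real.pi * y) Real.pi y := by
        simpa using (hasDerivAt_id y).const_mul Real.pi
      exact ((Real.hasDerivAt_cos (Real.pi * y)).comp y h1).hasDerivWithinAt) hinj H
  rw [himg] at key
  rw [intervalIntegral.integral_of_le (by norm_num), integral_Ioc_eq_integral_Ioo, key,
    intervalIntegral.integral_of_le (by norm_num), integral_Ioc_eq_integral_Ioo,
    ← integral_const_mul]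
  refine setIntegral_congr_fun measurableSet_Ioo fun y hy => ?_
  have hs : 0 ≤ Real.sin (Real.pi * y) := Real.sin_nonneg_of_nonneg_of_le_pi
    (mul_pos Real.pi_pos hy.1).le (by nlinarith [Real.pi_pos, hy.2])
  simp only [smul_eq_mul, abs_mul, abs_neg, abs_of_nonneg hs, abs_of_pos Real.pi_pos]
  ring

/-- In the coordinate `x = cos(π y)` the Chebyshev nodes are the midpoints `(k + 1/2) / u`, and the
weight `√(1 - x²)` is the Jacobian factor `sin(π y)`. -/
theorem node_mul_sqrt_sum (u : ℕ) (h : ℝ → ℝ) :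
    ∑ k ∈ Finset.Icc 1 u, h (node u k) * √(1 - node u k ^ 2) =
      ∑ k ∈ Finset.range u, h (Real.cos (Real.pi * ((k + 1 / 2) / u))) *
        Real.sin (Real.pi * ((k + 1 / 2) / u)) := by
  rw [← Finset.Ico_add_one_right_eq_Icc, Finset.sum_Ico_eq_sum_range]
  simp only [Nat.add_sub_cancel]
  refine Finset.sum_congr rfl fun k hk => ?_
  have hku : k < u := Finset.mem_range.1 hk
  have hu : (0 : ℝ) < u := by exact_mod_cast lt_of_le_of_lt (Nat.zero_le k) hku
  have hle : ((k : ℝ) + 1) ≤ u := by exact_mod_cast hku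
  have hn : node u (1 + k) = Real.cos (Real.pi * ((k + 1 / 2) / u)) := by
    unfold node
    congr 1
    push_cast
    field_simp
    ring
  have hx1 : ((k : ℝ) + 1 / 2) / u ≤ 1 := by
    rw [div_le_one hu]; linarith
  rw [hn, ← Real.abs_sin_eq_sqrt_one_sub_cos_sq, abs_of_nonneg]
  refine Real.sin_nonneg_of_nonneg_of_le_pi (by positivity) ?_
  nlinarith [Real.pi_pos]

/-- Convergence of Gauss–Chebyshev quadrature, for a family of integrands that converges
continuously. -/
theorem tendsto_gaussChebyshev {ι : Type*} {l : Filter ι} [l.IsCountablyGenerated] {u : ι → ℕ}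
    (hu : Tendsto u l atTop) {h : ι → ℝ → ℝ} {H : ℝ → ℝ} {C : ℝ}
    (hC : ∀ᶠ a in l, ∀ y ∈ Set.Ioo (-1 : ℝ) 1, |h a y| ≤ C)
    (hlim : ∀ x ∈ Set.Ioo (-1 : ℝ) 1,
      Tendsto (fun q : ι × ℝ => h q.1 q.2) (l ×ˢ 𝓝 x) (𝓝 (H x))) :
    Tendsto (fun a => Real.pi / u a *
      ∑ k ∈ Finset.Icc 1 (u a), h a (node (u a) k) * √(1 - node (u a) k ^ 2)) l
      (𝓝 (∫ x in (-1 : ℝ)..1, H x)) := by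
  have hcos : ∀ y ∈ Set.Ioo (0 : ℝ) 1, Real.cos (Real.pi * y) ∈ Set.Ioo (-1 : ℝ) 1 := by
    intro y hy
    have hy1 : 0 < Real.pi * y := mul_pos Real.pi_pos hy.1
    have hy2 : Real.pi * y < Real.pi := by nlinarith [Real.pi_pos, hy.2]
    constructor
    · rw [← Real.cos_pi]
      exact Real.cos_lt_cos_of_nonneg_of_le_pi hy1.le le_rfl hy2
    · rw [← Real.cos_zero]
      exact Real.cos_lt_cos_of_nonneg_of_le_pi le_rfl hy2.le hy1
  have key := tendsto_riemann_sum (l := l) hu (θ := 1 / 2) (by norm_num) (by norm_num)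
    (h := fun a y => h a (Real.cos (Real.pi * y)) * Real.sin (Real.pi * y))
    (H := fun y => H (Real.cos (Real.pi * y)) * Real.sin (Real.pi * y)) (C := C)
    (by
      filter_upwards [hC] with a ha y hy
      have hC0 : 0 ≤ C := le_trans (abs_nonneg _) (ha 0 (by norm_num))
      rcases eq_or_lt_of_le hy.2 with rfl | hy1
      · simpa using hC0
      · rw [abs_mul]
        calc _ ≤ C * 1 := mul_le_mul (ha _ (hcos y ⟨hy.1, hy1⟩)) (Real.abs_sin_le_one _)
              (abs_nonneg _) hC0
          _ = C := mul_one C)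
    (by
      refine Eventually.of_forall fun x hx => ?_
      have hc : Tendsto (fun y => Real.cos (Real.pi * y)) (𝓝 x) (𝓝 (Real.cos (Real.pi * x))) :=
        (by fun_prop : Continuous fun y => Real.cos (Real.pi * y)).tendsto x
      have hs : Tendsto (fun y => Real.sin (Real.pi * y)) (𝓝 x) (𝓝 (Real.sin (Real.pi * x))) :=
        (by fun_prop : Continuous fun y => Real.sin (Real.pi * y)).tendsto x
      refine Tendsto.mul ?_ (hs.comp tendsto_snd)
      exact (hlim _ (hcos x hx)).comp (tendsto_fst.prodMk (hc.comp tendsto_snd)))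
  rw [integral_comp_cos]
  refine (key.const_mul Real.pi).congr fun a => ?_
  rw [node_mul_sqrt_sum]
  ring

end Pico
end

noncomputable section

namespace Pico

/-! ### The hypergeometric function `S` -/

/-- With `|x| < ρ < σ < 1`, the numbers `n (ρ/σ)^(n-1)` are bounded, so the differentiated series is
dominated on the ball of radius `ρ` by a multiple of `∑ |a n| σ^n`. Writing `x * D` as a series in
the same powers as the function lets differential equations be checked coefficient by coefficient.
-/
theorem hasDerivAt_tsum_mul_pow {a : ℕ → ℝ}
    (ha : ∀ ρ : ℝ, 0 ≤ ρ → ρ < 1 → Summable fun n => |a n| * ρ ^ n) {x : ℝ} (hx : |x| < 1) :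
    ∃ D, HasDerivAt (fun y => ∑' n, a n * y ^ n) D x ∧
      HasSum (fun n : ℕ => n * (a n * x ^ n)) (x * D) := by
  obtain ⟨ρ, hxρ, hρ⟩ := exists_between hx
  obtain ⟨σ, hρσ, hσ⟩ := exists_between hρ
  have hρ0 : 0 < ρ := lt_of_le_of_lt (abs_nonneg x) hxρ
  have hσ0 : 0 < σ := hρ0.trans hρσ
  obtain ⟨C, hC⟩ : ∃ C, ∀ n : ℕ, n * (ρ / σ) ^ (n - 1) ≤ C := by
    have h : Tendsto (fun n : ℕ => n * (ρ / σ) ^ n) atTop (𝓝 0) :=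
      tendsto_self_mul_const_pow_of_lt_one (by positivity) ((div_lt_one hσ0).2 hρσ)
    obtain ⟨C, hC⟩ := h.bddAbove_range
    refine ⟨C * (σ / ρ), fun n => ?_⟩
    rcases Nat.eq_zero_or_pos n with rfl | hn
    · have := hC ⟨0, rfl⟩
      simp only [CharP.cast_eq_zero, zero_mul] at this ⊢
      positivity
    · have h1 := hC ⟨n, rfl⟩
      have h2 : (ρ / σ) ^ n = (ρ / σ) ^ (n - 1) * (ρ / σ) := by
        rw [← pow_succ, Nat.sub_add_cancel hn]
      simp only [h2] at h1
      calc (n : ℝ) * (ρ / σ) ^ (n - 1) = n * ((ρ / σ) ^ (n - 1) * (ρ / σ)) * (σ / ρ) := by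
            field_simp
        _ ≤ C * (σ / ρ) := by gcongr
  have hsum : Summable fun n : ℕ => C / σ * (|a n| * σ ^ n) := (ha σ hσ0.le hσ).mul_left _
  have hu : Summable fun n : ℕ => |a n| * (n * ρ ^ (n - 1)) := by
    refine Summable.of_nonneg_of_le (f := fun n : ℕ => C / σ * (|a n| * σ ^ n))
      (fun n => by positivity) (fun n => ?_) hsum
    rcases Nat.eq_zero_or_pos n with rfl | hn
    · have hC0 : 0 ≤ C := by simpa using hC 0
      simp only [CharP.cast_eq_zero, zero_mul, mul_zero]
      positivity
    · have h2 : σ ^ n = σ ^ (n - 1) * σ := by rw [← pow_succ, Nat.sub_add_cancel hn]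
      have h3 : (n : ℝ) * ρ ^ (n - 1) ≤ C * σ ^ (n - 1) := by
        have := hC n
        rw [div_pow, ← mul_div_assoc, div_le_iff₀ (by positivity)] at this
        exact this
      calc |a n| * (n * ρ ^ (n - 1)) ≤ |a n| * (C * σ ^ (n - 1)) := by gcongr
        _ = _ := by rw [h2]; field_simp
  have hbd : ∀ (n : ℕ) (y : ℝ), y ∈ Metric.ball (0 : ℝ) ρ →
      ‖a n * (n * y ^ (n - 1))‖ ≤ |a n| * (n * ρ ^ (n - 1)) := by
    intro n y hy
    rw [Metric.mem_ball, dist_zero_right, Real.norm_eq_abs] at hy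
    rw [Real.norm_eq_abs, abs_mul, abs_mul, abs_pow, Nat.abs_cast]
    gcongr
  have hxb : x ∈ Metric.ball (0 : ℝ) ρ := by simpa using hxρ
  have hder := hasDerivAt_tsum_of_isPreconnected (g := fun n y => a n * y ^ n)
    (g' := fun n y => a n * (n * y ^ (n - 1))) hu Metric.isOpen_ball
    (convex_ball (0 : ℝ) ρ).isPreconnected (fun n y _ => (hasDerivAt_pow n y).const_mul (a n))
    hbd (Metric.mem_ball_self hρ0) (summable_of_ne_finset_zero (s := {0}) (by
      intro n hn
      simp only [Finset.mem_singleton] at hn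
      simp [hn])) hxb
  refine ⟨_, hder, ?_⟩
  have hs : Summable fun n : ℕ => a n * (n * x ^ (n - 1)) :=
    Summable.of_norm_bounded hu fun n => hbd n x hxb
  have := hs.hasSum.mul_left x
  refine this.congr_fun ?_
  intro n
  rcases Nat.eq_zero_or_pos n with rfl | hn
  · simp
  · have h2 : x ^ n = x ^ (n - 1) * x := by rw [← pow_succ, Nat.sub_add_cancel hn]
    simp only [h2]
    ring

theorem summable_ordinaryHypergeometricCoefficient {a b c : ℝ}
    (habc : ∀ k : ℕ, (k : ℝ) ≠ -a ∧ (k : ℝ) ≠ -b ∧ (k : ℝ) ≠ -c) (ρ : ℝ) (h0 : 0 ≤ ρ) (h1 : ρ < 1) :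
    Summable fun n => |ordinaryHypergeometricCoefficient a b c n| * ρ ^ n := by
  have hr := ordinaryHypergeometricSeries_radius_eq_one ℝ a b c habc
  have := (ordinaryHypergeometricSeries ℝ a b c).summable_norm_mul_pow (r := ⟨ρ, h0⟩) (by
    rw [hr]
    exact ENNReal.coe_lt_one_iff.2 (show (⟨ρ, h0⟩ : ℝ≥0) < 1 from h1))
  refine this.congr fun n => ?_
  rw [ordinaryHypergeometricSeries, FormalMultilinearSeries.ofScalars_norm, Real.norm_eq_abs]
  rfl

theorem ordinaryHypergeometric_hasDerivAt {a b c : ℝ}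
    (habc : ∀ k : ℕ, (k : ℝ) ≠ -a ∧ (k : ℝ) ≠ -b ∧ (k : ℝ) ≠ -c) {x : ℝ} (hx : |x| < 1) :
    ∃ D, HasDerivAt (ordinaryHypergeometric a b c) D x ∧
      HasSum (fun n : ℕ => n * (ordinaryHypergeometricCoefficient a b c n * x ^ n)) (x * D) ∧
      HasSum (fun n : ℕ => ordinaryHypergeometricCoefficient a b c n * x ^ n)
        (ordinaryHypergeometric a b c x) := by
  have hs := summable_ordinaryHypergeometricCoefficient habc
  obtain ⟨D, hD, hD'⟩ := hasDerivAt_tsum_mul_pow hs hx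
  have heq : ∀ y : ℝ, ordinaryHypergeometric a b c y =
      ∑' n, ordinaryHypergeometricCoefficient a b c n * y ^ n := by
    intro y
    rw [ordinaryHypergeometric_eq_tsum]
    simp only [smul_eq_mul]
  refine ⟨D, ?_, hD', ?_⟩
  · rw [funext heq]
    exact hD
  · rw [heq]
    refine (Summable.of_norm ((hs |x| (abs_nonneg x) hx).congr fun n => ?_)).hasSum
    rw [norm_mul, norm_pow, Real.norm_eq_abs, Real.norm_eq_abs]

/-- For `N = k + 1` these are the coefficients of `(1 - x)^(-N)`; this is how the closed right-hand
side enters the differential equation. -/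
theorem ascPochhammer_div_factorial (k n : ℕ) :
    ((n.factorial : ℝ)⁻¹) * (ascPochhammer ℝ n).eval ((k + 1 : ℕ) : ℝ) = ((n + k).choose k : ℝ) := by
  rw [← ascPochhammer_eval_cast, ascPochhammer_nat_eq_ascFactorial,
    Nat.ascFactorial_eq_factorial_mul_choose]
  push_cast
  rw [← mul_assoc, inv_mul_cancel₀ (by positivity), one_mul, add_comm k n,
    Nat.choose_symm_add]

/-- The first-order differential equation of `₂F₁(-β, N; 1 - β; x)`. -/
theorem ordinaryHypergeometric_neg_hasDerivAt {β : ℝ} (hβ : 0 < β) (hβ1 : β < 1) {N : ℕ}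
    (hN : 0 < N) {x : ℝ} (hx : |x| < 1) :
    ∃ D, HasDerivAt (ordinaryHypergeometric (-β) (N : ℝ) (1 - β)) D x ∧
      x * D - β * ordinaryHypergeometric (-β) (N : ℝ) (1 - β) x = -β / (1 - x) ^ N := by
  obtain ⟨k, rfl⟩ : ∃ k, N = k + 1 := ⟨N - 1, by omega⟩
  have hN' : (0 : ℝ) < ((k + 1 : ℕ) : ℝ) := by exact_mod_cast hN
  have habc : ∀ j : ℕ, (j : ℝ) ≠ - -β ∧ (j : ℝ) ≠ -((k + 1 : ℕ) : ℝ) ∧ (j : ℝ) ≠ -(1 - β) := by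
    intro j
    have hj : (0 : ℝ) ≤ j := Nat.cast_nonneg j
    refine ⟨fun h => ?_, by linarith, by linarith⟩
    rw [neg_neg] at h
    rw [← h] at hβ hβ1
    have h1 : 0 < j := by exact_mod_cast hβ
    have h2 : j < 1 := by exact_mod_cast hβ1
    omega
  obtain ⟨D, hD, hs1, hs2⟩ := ordinaryHypergeometric_hasDerivAt habc hx
  refine ⟨D, hD, ?_⟩
  have h3 := hs1.sub (hs2.mul_left β)
  have h4 := (hasSum_choose_mul_geometric_of_norm_lt_one k
    (by simpa using hx : ‖x‖ < 1)).mul_left (-β)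
  have : -β / (1 - x) ^ (k + 1) = -β * (1 / (1 - x) ^ (k + 1)) := by ring
  rw [this]
  refine h3.unique (h4.congr_fun ?_)
  intro n
  rw [← ascPochhammer_div_factorial]
  have hc : (ascPochhammer ℝ n).eval (1 - β) ≠ 0 := by
    refine ((ascPochhammer_eval_eq_zero_iff n _).not).2 ?_
    rintro ⟨j, _, hj⟩
    exact (habc j).2.2 (by simpa using hj)
  -- Both sides are the Pochhammer symbol of `-β` of length `n + 1`. Multiplying the `n`-th
  -- coefficient by `n - β` therefore cancels its denominator.
  have hshift : (ascPochhammer ℝ n).eval (-β) * (n - β) = -β * (ascPochhammer ℝ n).eval (1 - β) := by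
    have e1 := ascPochhammer_succ_eval n (-β)
    have e2 : (ascPochhammer ℝ (n + 1)).eval (-β) = -β * (ascPochhammer ℝ n).eval (1 - β) := by
      rw [ascPochhammer_succ_left]
      simp only [Polynomial.eval_mul, Polynomial.eval_X, Polynomial.eval_comp, Polynomial.eval_add,
        Polynomial.eval_one]
      ring_nf
    rw [e1] at e2
    linear_combination e2
  unfold ordinaryHypergeometricCoefficient
  have : (n : ℝ) - β ≠ 0 := by
    intro h
    exact (habc n).1 (by linarith)
  field_simp
  linear_combination (Polynomial.eval ((k + 1 : ℕ) : ℝ) (ascPochhammer ℝ n)) * x ^ n * hshift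

/-- The first-order differential equation of `₂F₁(1, N; c; w)`. -/
theorem ordinaryHypergeometric_one_hasDerivAt {c : ℝ} (hc : 0 < c) {N : ℕ} (hN : 0 < N) {w : ℝ}
    (hw : |w| < 1) :
    ∃ D, HasDerivAt (ordinaryHypergeometric 1 (N : ℝ) c) D w ∧
      w * (1 - w) * D + (c - 1 - N * w) * ordinaryHypergeometric 1 (N : ℝ) c w = c - 1 := by
  have hN' : (0 : ℝ) < N := by exact_mod_cast hN
  have habc : ∀ j : ℕ, (j : ℝ) ≠ -1 ∧ (j : ℝ) ≠ -(N : ℝ) ∧ (j : ℝ) ≠ -c := by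
    intro j
    have hj : (0 : ℝ) ≤ j := Nat.cast_nonneg j
    exact ⟨by linarith, by linarith, by linarith⟩
  obtain ⟨D, hD, hs1, hs2⟩ := ordinaryHypergeometric_hasDerivAt habc hw
  refine ⟨D, hD, ?_⟩
  have hrec : ∀ n : ℕ, ordinaryHypergeometricCoefficient (1 : ℝ) N c (n + 1) * (n + c) =
      ordinaryHypergeometricCoefficient (1 : ℝ) N c n * (n + N) := by
    intro n
    unfold ordinaryHypergeometricCoefficient
    have hcn : (ascPochhammer ℝ n).eval c ≠ 0 := (ascPochhammer_pos n c hc).ne'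
    have hcn' : c + n ≠ 0 := by positivity
    rw [ascPochhammer_succ_eval, ascPochhammer_succ_eval, ascPochhammer_succ_eval,
      Nat.factorial_succ]
    push_cast
    field_simp
    ring
  -- After the shift the coefficients are `(n + c) a (n + 1)`, which by `hrec` equal `(n + N) a n`,
  -- the coefficients in `hB`. The dropped zeroth term produces the constant `c - 1`.
  have hA := (hasSum_nat_add_iff' 1).2 (hs1.add (hs2.mul_left (c - 1)))
  have hB := (hs1.add (hs2.mul_left (N : ℝ))).mul_left w
  have h := hA.unique (hB.congr_fun (fun n => by
    have := hrec n
    push_cast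
    rw [pow_succ]
    linear_combination w ^ n * w * this))
  simp [ordinaryHypergeometricCoefficient] at h
  linear_combination h

end Pico
end

noncomputable section

namespace Pico

/-! ### Analytic continuation of `S` and its growth at infinity -/

/-- Pfaff's form of `₂F₁(-β, N; 1 - β; -z)`. -/
def pfaff (β : ℝ) (N : ℕ) (z : ℝ) : ℝ :=
  ((1 + z) ^ N)⁻¹ * ordinaryHypergeometric 1 (N : ℝ) (1 - β) (z / (1 + z))

theorem pfaff_zero (β : ℝ) (N : ℕ) : pfaff β N 0 = 1 := by
  simp [pfaff]

/-- The substitution `w = z / (1 + z)` and the prefactor `(1 + z)^(-N)` turn the equation of `₂F₁(1,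
N; 1 - β; w)` into the one satisfied by the power series. The bound `-1/2 < z` is what keeps `|w| <
1`; it leaves room on both sides of `0`, where a derivative is needed. -/
theorem pfaff_hasDerivAt {β : ℝ} (hβ1 : β < 1) {N : ℕ} (hN : 0 < N) {z : ℝ}
    (hz : -(1 / 2) < z) :
    ∃ D, HasDerivAt (pfaff β N) D z ∧ z * D - β * pfaff β N z = -β / (1 + z) ^ N := by
  have h1z : 0 < 1 + z := by linarith
  have hw : |z / (1 + z)| < 1 := by
    rw [abs_lt, lt_div_iff₀ h1z, div_lt_one h1z]
    constructor <;> linarith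
  obtain ⟨D, hD, hode⟩ := ordinaryHypergeometric_one_hasDerivAt (c := 1 - β) (by linarith) hN hw
  have h1 : HasDerivAt (fun y : ℝ => 1 + y) 1 z := (hasDerivAt_id z).const_add 1
  have h2 : HasDerivAt (fun y : ℝ => y / (1 + y)) ((1 * (1 + z) - z * 1) / (1 + z) ^ 2) z :=
    (hasDerivAt_id z).div h1 h1z.ne'
  have h3 := hD.comp z h2
  have h4 : HasDerivAt (fun y : ℝ => ((1 + y) ^ N)⁻¹) _ z := (h1.pow N).inv (pow_ne_zero N h1z.ne')
  refine ⟨_, h4.mul h3, ?_⟩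
  have hpow : (1 + z) ^ N = (1 + z) ^ (N - 1) * (1 + z) := by
    rw [← pow_succ, Nat.sub_add_cancel hN]
  unfold pfaff
  simp only [Pi.pow_apply]
  set F := ordinaryHypergeometric 1 (N : ℝ) (1 - β) (z / (1 + z)) with hF
  clear_value F
  rw [hpow]
  have hp : (1 + z) ^ (N - 1) ≠ 0 := pow_ne_zero _ h1z.ne'
  field_simp at hode ⊢
  linear_combination hode

/-- For `z ≥ 1` this is the second branch of the definition. For `z < 1` both sides solve the same
first-order equation, so their difference `f` satisfies `y f' = β f` and `y^(-β) f` is constant on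
`(0, 1)`. Since `f` is differentiable at `0` with `f 0 = 0` and `β < 1`, that constant is `0`. -/
theorem gaussHyp_eq_pfaff {β : ℝ} (hβ : 0 < β) (hβ1 : β < 1) {N : ℕ} (hN : 0 < N) {z : ℝ}
    (hz : 0 ≤ z) : gaussHyp (-β) N (1 - β) (-z) = pfaff β N z := by
  unfold gaussHyp
  split_ifs with hlt
  swap
  · have h1 : -z / (-z - 1) = z / (1 + z) := by
      rw [← neg_div_neg_eq]
      congr 1 <;> ring
    rw [h1, pfaff, sub_neg_eq_add, sub_neg_eq_add, sub_add_cancel, Real.rpow_neg (by linarith),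
      Real.rpow_natCast]
  rcases eq_or_lt_of_le hz with rfl | hz0
  · simp [pfaff_zero]
  rw [abs_neg, abs_of_nonneg hz] at hlt
  set f : ℝ → ℝ := fun y => ordinaryHypergeometric (-β) (N : ℝ) (1 - β) (-y) - pfaff β N y with hf
  have hfd : ∀ y ∈ Set.Ico (0 : ℝ) 1, ∃ D, HasDerivAt f D y ∧ y * D = β * f y := by
    intro y hy
    obtain ⟨D₁, hD₁, he₁⟩ := ordinaryHypergeometric_neg_hasDerivAt hβ hβ1 hN (x := -y)
      (by rw [abs_neg, abs_of_nonneg hy.1]; exact hy.2)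
    obtain ⟨D₂, hD₂, he₂⟩ := pfaff_hasDerivAt hβ1 hN (z := y) (by linarith [hy.1])
    refine ⟨D₁ * (-1) - D₂, (hD₁.comp y (hasDerivAt_neg y)).sub hD₂, ?_⟩
    rw [sub_neg_eq_add] at he₁
    simp only [hf]
    linear_combination he₁ - he₂
  set g : ℝ → ℝ := fun y => y ^ (-β) * f y with hg
  have hgd : ∀ y ∈ Set.Ioo (0 : ℝ) 1, HasDerivAt g 0 y := by
    intro y hy
    obtain ⟨D, hD, he⟩ := hfd y ⟨hy.1.le, hy.2⟩
    have h1 := (Real.hasDerivAt_rpow_const (p := -β) (Or.inl hy.1.ne')).mul hD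
    refine h1.congr_deriv ?_
    rw [Real.rpow_sub_one hy.1.ne']
    have := hy.1.ne'
    field_simp
    linear_combination (y ^ (-β)) * he
  have hconst : ∀ y ∈ Set.Ioo (0 : ℝ) 1, g y = g z := by
    intro y hy
    refine isOpen_Ioo.is_const_of_deriv_eq_zero isPreconnected_Ioo
      (fun x hx => (hgd x hx).differentiableAt.differentiableWithinAt)
      (fun x hx => (hgd x hx).deriv) hy ⟨hz0, hlt⟩
  have hlim : Tendsto g (𝓝[>] 0) (𝓝 0) := by
    obtain ⟨D, hD, -⟩ := hfd 0 ⟨le_rfl, one_pos⟩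
    have hf0 : f 0 = 0 := by simp [hf, pfaff_zero]
    have h1 : Tendsto (fun y => y⁻¹ * f y) (𝓝[>] 0) (𝓝 D) := by
      have := (hD.tendsto_slope_zero_right)
      simpa [hf0] using this
    have h2 : Tendsto (fun y : ℝ => y ^ (1 - β)) (𝓝[>] 0) (𝓝 0) := by
      have := (Real.continuousAt_rpow_const 0 (1 - β) (Or.inr (by linarith))).tendsto
      rw [Real.zero_rpow (by linarith)] at this
      exact this.mono_left nhdsWithin_le_nhds
    have h3 := h2.mul h1
    rw [zero_mul] at h3
    refine h3.congr' ?_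
    filter_upwards [self_mem_nhdsWithin] with y hy
    have hy : (0 : ℝ) < y := hy
    simp only [hg]
    rw [sub_eq_add_neg, Real.rpow_add hy, Real.rpow_one]
    field_simp
  have hgz : g z = 0 := by
    refine tendsto_nhds_unique (Tendsto.congr' ?_ tendsto_const_nhds) hlim
    filter_upwards [Ioo_mem_nhdsGT (one_pos : (0 : ℝ) < 1)] with y hy
    exact (hconst y hy).symm
  rcases mul_eq_zero.1 hgz with h | h
  · exact absurd h (Real.rpow_pos_of_pos hz0 _).ne'
  · exact sub_eq_zero.1 h

theorem gaussHyp_hasDerivAt {β : ℝ} (hβ : 0 < β) (hβ1 : β < 1) {N : ℕ} (hN : 0 < N) {z : ℝ}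
    (hz : 0 < z) : ∃ D, HasDerivAt (fun y => gaussHyp (-β) N (1 - β) (-y)) D z ∧
      z * D - β * gaussHyp (-β) N (1 - β) (-z) = -β / (1 + z) ^ N := by
  obtain ⟨D, hD, he⟩ := pfaff_hasDerivAt hβ1 hN (z := z) (by linarith)
  refine ⟨D, hD.congr_of_eventuallyEq ?_, ?_⟩
  · filter_upwards [lt_mem_nhds hz] with y hy
    exact gaussHyp_eq_pfaff hβ hβ1 hN (le_of_lt hy)
  · rw [gaussHyp_eq_pfaff hβ hβ1 hN hz.le, he]

/-- The beta integral over the half-line. -/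
theorem integral_Ioi_rpow_mul_one_add_rpow {a b : ℝ} (ha : 0 < a) (hb : 0 < b) :
    IntegrableOn (fun z : ℝ => z ^ (a - 1) * (1 + z) ^ (-(a + b))) (Set.Ioi 0) ∧
    ∫ z in Set.Ioi (0 : ℝ), z ^ (a - 1) * (1 + z) ^ (-(a + b)) =
      Real.Gamma a * Real.Gamma b / Real.Gamma (a + b) := by
  have hbp := beta_pos ha hb
  -- The Beta density on the unit interval: its total mass `1` gives both integrability and the
  -- value after the substitution `x = z / (1 + z)`.
  set h : ℝ → ℝ := fun x => 1 / beta a b * x ^ (a - 1) * (1 - x) ^ (b - 1) with hh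
  have hlin := lintegral_betaPDF_eq_one ha hb
  rw [lintegral_betaPDF] at hlin
  have hnn : 0 ≤ᵐ[volume.restrict (Set.Ioo 0 1)] h := by
    refine ae_restrict_of_forall_mem measurableSet_Ioo fun x hx => ?_
    have : 0 ≤ 1 - x := by linarith [hx.2]
    have := hx.1.le
    simp only [hh, Pi.zero_apply]
    positivity
  have hmeas : AEStronglyMeasurable h (volume.restrict (Set.Ioo 0 1)) :=
    Measurable.aestronglyMeasurable (by fun_prop)
  have hint : IntegrableOn h (Set.Ioo 0 1) := by
    refine ⟨hmeas, ?_⟩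
    rw [hasFiniteIntegral_iff_ofReal hnn, hlin]
    exact ENNReal.one_lt_top
  have hval : ∫ x in Set.Ioo 0 1, h x = 1 := by
    rw [integral_eq_lintegral_of_nonneg_ae hnn hmeas, hlin]
    simp
  have himg : (fun z : ℝ => z / (1 + z)) '' Set.Ioi 0 = Set.Ioo 0 1 := by
    ext w
    constructor
    · rintro ⟨z, hz, rfl⟩
      have hz : (0 : ℝ) < z := hz
      exact ⟨by positivity, by rw [div_lt_one (by positivity)]; linarith⟩
    · intro hw
      have h1 : 0 < 1 - w := by linarith [hw.2]
      refine ⟨w / (1 - w), div_pos hw.1 h1, ?_⟩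
      have : 1 + w / (1 - w) = 1 / (1 - w) := by field_simp; ring
      simp only [this]
      field_simp
  have hinj : Set.InjOn (fun z : ℝ => z / (1 + z)) (Set.Ioi 0) := by
    intro y hy z hz hyz
    have hy : (0 : ℝ) < y := hy
    have hz : (0 : ℝ) < z := hz
    simp only at hyz
    field_simp at hyz
    linarith
  have hder : ∀ z ∈ Set.Ioi (0 : ℝ), HasDerivWithinAt (fun z : ℝ => z / (1 + z))
      ((1 * (1 + z) - z * 1) / (1 + z) ^ 2) (Set.Ioi 0) z := by
    intro z hz
    have hz : (0 : ℝ) < z := hz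
    exact ((hasDerivAt_id z).div ((hasDerivAt_id z).const_add 1)
      (by simp only [id]; positivity)).hasDerivWithinAt
  have hcong : Set.EqOn (fun z : ℝ => |(1 * (1 + z) - z * 1) / (1 + z) ^ 2| • h (z / (1 + z)))
      (fun z => 1 / beta a b * (z ^ (a - 1) * (1 + z) ^ (-(a + b)))) (Set.Ioi 0) := by
    intro z hz
    have hz : (0 : ℝ) < z := hz
    have h1 : (0 : ℝ) < 1 + z := by positivity
    have e1 : (1 * (1 + z) - z * 1) / (1 + z) ^ 2 = (1 + z) ^ (-2 : ℝ) := by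
      rw [Real.rpow_neg h1.le, Real.rpow_two]
      field_simp
      ring
    have e2 : 1 - z / (1 + z) = (1 + z)⁻¹ := by field_simp; ring
    simp only [hh]
    rw [e1, abs_of_pos (Real.rpow_pos_of_pos h1 _), e2, Real.div_rpow hz.le h1.le,
      Real.inv_rpow h1.le, ← Real.rpow_neg h1.le, div_eq_mul_inv (z ^ (a - 1)),
      ← Real.rpow_neg h1.le, smul_eq_mul]
    have : (1 + z) ^ (-(a + b)) = (1 + z) ^ (-2 : ℝ) * (1 + z) ^ (-(a - 1)) * (1 + z) ^ (-(b - 1)) := by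
      rw [← Real.rpow_add h1, ← Real.rpow_add h1]
      congr 1
      ring
    rw [this]
    ring
  have key1 := (integrableOn_image_iff_integrableOn_abs_deriv_smul measurableSet_Ioi hder hinj h)
  have key2 := integral_image_eq_integral_abs_deriv_smul measurableSet_Ioi hder hinj h
  rw [himg] at key1 key2
  rw [setIntegral_congr_fun measurableSet_Ioi hcong, integral_const_mul, hval] at key2
  have key1' := (key1.1 hint).congr_fun hcong measurableSet_Ioi
  constructor
  · have hc : IntegrableOn (fun z => beta a b * (1 / beta a b * (z ^ (a - 1) *
        (1 + z) ^ (-(a + b))))) (Set.Ioi 0) := key1'.const_mul (beta a b)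
    refine hc.congr_fun ?_ measurableSet_Ioi
    intro z _
    simp only
    field_simp
  · rw [← beta]
    field_simp at key2
    exact key2.symm

/-- The derivative of `z^(-β) S(z)` is `-β z^(-β-1) (1 + z)^(-N)`, which is not integrable at `0`.
Subtracting `(1 + z)^(-N)` from `S` repairs this: the corrected function `V` tends to `0` at `0` and
has derivative `N z^(-β) (1 + z)^(-N-1)`, so its limit at infinity is `N` times a beta integral, and
the correction disappears there. -/
theorem tendsto_rpow_mul_gaussHyp {β : ℝ} (hβ : 0 < β) (hβ1 : β < 1) {N : ℕ} (hN : 0 < N) :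
    Tendsto (fun z : ℝ => z ^ (-β) * gaussHyp (-β) N (1 - β) (-z)) atTop
      (𝓝 (Real.Gamma (1 - β) * Real.Gamma (N + β) * (Real.Gamma N)⁻¹)) := by
  have hN' : (0 : ℝ) < N := by exact_mod_cast hN
  set S : ℝ → ℝ := fun z => gaussHyp (-β) N (1 - β) (-z) with hS
  set V : ℝ → ℝ := fun z => z ^ (-β) * (S z - ((1 + z) ^ N)⁻¹) with hV
  obtain ⟨hint, hval⟩ := integral_Ioi_rpow_mul_one_add_rpow (a := 1 - β) (b := N + β)
    (by linarith) (by linarith)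
  have hint' : IntegrableOn (fun z : ℝ => N * (z ^ (1 - β - 1) * (1 + z) ^ (-(1 - β + (N + β)))))
      (Set.Ioi 0) := hint.const_mul (N : ℝ)
  have hVd : ∀ z : ℝ, 0 < z → HasDerivAt V
      (N * (z ^ (1 - β - 1) * (1 + z) ^ (-(1 - β + (N + β))))) z := by
    intro z hz
    have h1z : (0 : ℝ) < 1 + z := by linarith
    obtain ⟨D, hD, he⟩ := gaussHyp_hasDerivAt hβ hβ1 hN hz
    have h1 : HasDerivAt (fun y : ℝ => 1 + y) 1 z := (hasDerivAt_id z).const_add 1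
    have h4 : HasDerivAt (fun y : ℝ => ((1 + y) ^ N)⁻¹) _ z :=
      (h1.pow N).inv (pow_ne_zero N h1z.ne')
    have h5 := (Real.hasDerivAt_rpow_const (p := -β) (Or.inl hz.ne')).mul (hD.sub h4)
    refine h5.congr_deriv ?_
    have hpow : (1 + z) ^ N = (1 + z) ^ (N - 1) * (1 + z) := by
      rw [← pow_succ, Nat.sub_add_cancel hN]
    have e1 : (1 + z) ^ (-(1 - β + (N + β))) = ((1 + z) ^ N * (1 + z))⁻¹ := by
      rw [show -(1 - β + (N + β)) = -((N + 1 : ℕ) : ℝ) by push_cast; ring, Real.rpow_neg h1z.le,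
        Real.rpow_natCast, pow_succ]
    have e2 : (1 : ℝ) - β - 1 = -β := by ring
    simp only [Pi.pow_apply, Pi.sub_apply]
    rw [e1, e2, Real.rpow_sub_one hz.ne']
    simp only [hpow] at he ⊢
    have hp : (1 + z) ^ (N - 1) ≠ 0 := pow_ne_zero _ h1z.ne'
    have hzz := hz.ne'
    set Sz := gaussHyp (-β) N (1 - β) (-z)
    have hDe : D = (β * Sz + -β / ((1 + z) ^ (N - 1) * (1 + z))) / z := by
      rw [eq_div_iff hzz]
      linear_combination he
    rw [hDe]
    field_simp
    ring
  have hV0 : Tendsto V (𝓝[>] 0) (𝓝 0) := by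
    obtain ⟨D, hD, -⟩ := pfaff_hasDerivAt hβ1 hN (z := 0) (by norm_num)
    have h1 : HasDerivAt (fun y : ℝ => 1 + y) 1 0 := (hasDerivAt_id (0 : ℝ)).const_add 1
    have h4 : HasDerivAt (fun y : ℝ => ((1 + y) ^ N)⁻¹) _ 0 :=
      (h1.pow N).inv (pow_ne_zero N (by norm_num))
    have h5 := (hD.sub h4).tendsto_slope_zero_right
    simp only [zero_add, Pi.sub_apply, pfaff_zero, add_zero, one_pow, inv_one, sub_self, sub_zero,
      smul_eq_mul] at h5
    have h2 : Tendsto (fun y : ℝ => y ^ (1 - β)) (𝓝[>] 0) (𝓝 0) := by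
      have := (Real.continuousAt_rpow_const 0 (1 - β) (Or.inr (by linarith))).tendsto
      rw [Real.zero_rpow (by linarith)] at this
      exact this.mono_left nhdsWithin_le_nhds
    have h3 := h2.mul h5
    rw [zero_mul] at h3
    refine h3.congr' ?_
    filter_upwards [self_mem_nhdsWithin] with y hy
    have hy : (0 : ℝ) < y := hy
    simp only [hV, hS]
    rw [gaussHyp_eq_pfaff hβ hβ1 hN hy.le, sub_eq_add_neg (1 : ℝ) β, Real.rpow_add hy,
      Real.rpow_one]
    field_simp
  have hVint : ∀ R : ℝ, 0 < R → ∫ z in (0 : ℝ)..R,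
      N * (z ^ (1 - β - 1) * (1 + z) ^ (-(1 - β + (N + β)))) = V R := by
    intro R hR
    rw [intervalIntegral.integral_eq_sub_of_hasDerivAt_of_tendsto hR (fun x hx => hVd x hx.1)
      ((intervalIntegrable_iff_integrableOn_Ioc_of_le hR.le).2
        (hint'.mono_set Set.Ioc_subset_Ioi_self)) hV0
      ((hVd R hR).continuousAt.tendsto.mono_left nhdsWithin_le_nhds), sub_zero]
  have hlim := intervalIntegral_tendsto_integral_Ioi 0 hint' tendsto_id
  rw [integral_const_mul, hval] at hlim
  have hL : (N : ℝ) * (Real.Gamma (1 - β) * Real.Gamma (N + β) / Real.Gamma (1 - β + (N + β))) =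
      Real.Gamma (1 - β) * Real.Gamma (N + β) * (Real.Gamma N)⁻¹ := by
    rw [show 1 - β + (N + β) = (N : ℝ) + 1 by ring, Real.Gamma_add_one hN'.ne']
    have := (Real.Gamma_pos_of_pos hN').ne'
    field_simp
  rw [hL] at hlim
  have hrest : Tendsto (fun z : ℝ => z ^ (-β) * ((1 + z) ^ N)⁻¹) atTop (𝓝 0) := by
    have h1 := tendsto_rpow_neg_atTop hβ
    refine squeeze_zero' ?_ ?_ h1
    · filter_upwards [eventually_gt_atTop 0] with z hz
      positivity
    · filter_upwards [eventually_gt_atTop 0] with z hz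
      have : ((1 + z) ^ N)⁻¹ ≤ 1 := inv_le_one_of_one_le₀ (one_le_pow₀ (by linarith))
      exact mul_le_of_le_one_right (by positivity) this
  have := hlim.add hrest
  rw [add_zero] at this
  refine this.congr' ?_
  filter_upwards [eventually_gt_atTop 0] with z hz
  simp only [id]
  rw [hVint z hz]
  simp only [hV, hS]
  ring

end Pico
end

noncomputable section

namespace Pico

namespace Params

variable (T : Params)

/-! ### `W` as an integral over the line-of-sight ball -/

/-- Laplace transform of the power `X q^(-α/2)` times a fading power, up to scaling, as a function
of the squared distance `q`. -/
def kern (X q : ℝ) : ℝ := ((1 + X / q ^ (T.α / 2)) ^ T.Np)⁻¹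

theorem α_pos : 0 < T.α := lt_of_lt_of_le two_pos T.two_le_α

theorem Np_pos' : (0 : ℝ) < T.Np := by exact_mod_cast T.Np_pos

theorem one_le_one_add {X q : ℝ} (hX : 0 ≤ X) (hq : 0 ≤ q) : 1 ≤ 1 + X / q ^ (T.α / 2) := by
  have : 0 ≤ X / q ^ (T.α / 2) := by positivity
  linarith

theorem kern_pos {X q : ℝ} (hX : 0 ≤ X) (hq : 0 ≤ q) : 0 < T.kern X q := by
  have := T.one_le_one_add hX hq
  unfold kern
  positivity

theorem kern_le_one {X q : ℝ} (hX : 0 ≤ X) (hq : 0 ≤ q) : T.kern X q ≤ 1 :=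
  inv_le_one_of_one_le₀ (one_le_pow₀ (T.one_le_one_add hX hq))

theorem kern_zero (q : ℝ) : T.kern 0 q = 1 := by simp [kern]

theorem measurable_kern : Measurable fun z : ℝ × ℝ => T.kern z.1 z.2 := by
  unfold kern
  fun_prop

theorem intervalIntegrable_kern {X a b : ℝ} (hX : 0 ≤ X) (ha : 0 ≤ a) (hb : 0 ≤ b) :
    IntervalIntegrable (T.kern X) volume a b := by
  refine (intervalIntegrable_const (c := (1 : ℝ))).mono_fun
    (T.measurable_kern.comp measurable_prodMk_left).aestronglyMeasurable ?_
  refine ae_restrict_of_forall_mem measurableSet_uIoc fun q hq => ?_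
  have hq0 : 0 ≤ q := le_trans (le_min ha hb) (Set.mem_uIoc.1 hq |>.elim
    (fun h => (min_le_left _ _).trans h.1.le) (fun h => (min_le_right _ _).trans h.1.le))
  simp only [Real.norm_eq_abs, abs_of_pos (T.kern_pos hX hq0), abs_one]
  exact T.kern_le_one hX hq0

/-! ### `F_y` and the primitives of `kern` -/

theorem sum_range_one_div_pow (k : ℕ) {y : ℝ} (hy : 0 < y) :
    ∑ i ∈ Finset.range k, 1 / (1 + y) ^ (i + 2) = 1 / ((1 + y) * y) * (1 - 1 / (1 + y) ^ k) := by
  induction k with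
  | zero => simp
  | succ k ih =>
    rw [Finset.sum_range_succ, ih]
    field_simp
    ring

theorem Fy_eq (y : ℝ) : T.Fy y = T.Np * Real.log (1 + 1 / y) - 1 / (y * (1 + y) ^ (T.Np - 1)) -
    ∑ i ∈ Finset.range (T.Np - 1), (T.Np : ℝ) / ((1 + y) ^ (i + 1) * ((i : ℝ) + 1)) := by
  unfold Fy
  congr 1
  have hN := T.Np_pos
  rw [← Finset.sum_range_reflect, ← Finset.Ico_add_one_right_eq_Icc, Finset.sum_Ico_eq_sum_range]
  simp only [Nat.add_sub_cancel]
  refine Finset.sum_congr rfl fun i hi => ?_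
  have hi := Finset.mem_range.1 hi
  have h1 : T.Np - (1 + i) = T.Np - 1 - 1 - i + 1 := by omega
  rw [h1]
  push_cast
  rfl

/-- The derivative of the finite sum is geometric. Its closed form cancels the logarithmic
derivative `-N / (y (1 + y))` up to a term in `(1 + y)^(-N)`, which merges with the derivative of
the middle term. -/
theorem Fy_hasDerivAt {y : ℝ} (hy : 0 < y) :
    HasDerivAt T.Fy (1 / (y ^ 2 * (1 + y) ^ T.Np)) y := by
  have h1y : 0 < 1 + y := by linarith
  have hN := T.Np_pos
  obtain ⟨k, hk⟩ : ∃ k, T.Np = k + 1 := ⟨T.Np - 1, by omega⟩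
  have hadd : HasDerivAt (fun x : ℝ => 1 + x) 1 y := (hasDerivAt_id y).const_add 1
  have hlog : HasDerivAt (fun x : ℝ => (T.Np : ℝ) * Real.log (1 + 1 / x))
      (T.Np * (-(y ^ 2)⁻¹ / (1 + 1 / y))) y := by
    have h1 : HasDerivAt (fun x : ℝ => 1 + 1 / x) (-(y ^ 2)⁻¹) y := by
      simpa only [one_div] using (hasDerivAt_inv hy.ne').const_add 1
    exact (h1.log (by positivity)).const_mul _
  have hmid : HasDerivAt (fun x : ℝ => 1 / (x * (1 + x) ^ k))
      (-(1 * (1 + y) ^ k + y * (k * (1 + y) ^ (k - 1) * 1)) / (y * (1 + y) ^ k) ^ 2) y := by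
    have hne : ((id : ℝ → ℝ) * (fun x : ℝ => 1 + x) ^ k) y ≠ 0 := by
      simp only [Pi.mul_apply, id, Pi.pow_apply]
      positivity
    refine (((hasDerivAt_id y).mul (hadd.pow k)).inv hne).congr_of_eventuallyEq
      (Eventually.of_forall fun x => ?_)
    simp
  have hsum : HasDerivAt (fun x : ℝ => ∑ i ∈ Finset.range k,
      (T.Np : ℝ) / ((1 + x) ^ (i + 1) * ((i : ℝ) + 1)))
      (∑ i ∈ Finset.range k, -(T.Np : ℝ) * (1 / (1 + y) ^ (i + 2))) y := by
    refine HasDerivAt.fun_sum fun i _ => ?_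
    have hne : ((fun x : ℝ => 1 + x) ^ (i + 1)) y * ((i : ℝ) + 1) ≠ 0 := by
      simp only [Pi.pow_apply]
      positivity
    have h := (((hadd.pow (i + 1)).mul_const ((i : ℝ) + 1)).inv hne).const_mul (T.Np : ℝ)
    refine (h.congr_deriv ?_).congr_of_eventuallyEq (Eventually.of_forall fun x => ?_)
    · simp only [Pi.pow_apply, Nat.add_sub_cancel]
      push_cast
      field_simp
      ring
    · simp [div_eq_mul_inv]
  have := (hlog.sub hmid).sub hsum
  refine (this.congr_deriv ?_).congr_of_eventuallyEq (Eventually.of_forall fun x => ?_)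
  · rw [← Finset.mul_sum, sum_range_one_div_pow k hy, hk]
    push_cast
    -- The derivative of `(1 + x)^k` carries the exponent `k - 1` with truncated subtraction, hence
    -- the split at `k = 0`.
    rcases Nat.eq_zero_or_pos k with rfl | hkp
    · field_simp
      ring
    · obtain ⟨j, rfl⟩ : ∃ j, k = j + 1 := ⟨k - 1, by omega⟩
      rw [Nat.add_sub_cancel]
      push_cast
      field_simp
      ring
  · rw [Fy_eq]
    simp only [hk, Nat.add_sub_cancel, Pi.sub_apply]

theorem tendsto_Fy_atTop : Tendsto T.Fy atTop (𝓝 0) := by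
  have h1 : Tendsto (fun y : ℝ => 1 + y) atTop atTop := tendsto_atTop_add_const_left _ _ tendsto_id
  have hlog : Tendsto (fun y : ℝ => (T.Np : ℝ) * Real.log (1 + 1 / y)) atTop (𝓝 0) := by
    have h2 : Tendsto (fun y : ℝ => 1 + 1 / y) atTop (𝓝 1) := by
      simpa using (tendsto_const_nhds (x := (1 : ℝ))).add (tendsto_inv_atTop_zero (𝕜 := ℝ))
    have h3 := ((Real.continuousAt_log one_ne_zero).tendsto.comp h2).const_mul (T.Np : ℝ)
    simpa using h3
  have hmid : Tendsto (fun y : ℝ => 1 / (y * (1 + y) ^ (T.Np - 1))) atTop (𝓝 0) := by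
    refine squeeze_zero' ?_ ?_ (tendsto_inv_atTop_zero (𝕜 := ℝ))
    · filter_upwards [eventually_gt_atTop 0] with y hy
      positivity
    · filter_upwards [eventually_gt_atTop 0] with y hy
      rw [one_div]
      refine inv_anti₀ hy ?_
      exact le_mul_of_one_le_right hy.le (one_le_pow₀ (by linarith))
  have hsum : Tendsto (fun y : ℝ => ∑ i ∈ Finset.range (T.Np - 1),
      (T.Np : ℝ) / ((1 + y) ^ (i + 1) * ((i : ℝ) + 1))) atTop
      (𝓝 (∑ _i ∈ Finset.range (T.Np - 1), (0 : ℝ))) := by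
    refine tendsto_finsetSum _ fun i _ => ?_
    refine Tendsto.const_div_atTop ?_ _
    exact ((tendsto_pow_atTop (Nat.succ_ne_zero i)).comp h1).atTop_mul_const (by positivity)
  have := (hlog.sub hmid).sub hsum
  simp only [Finset.sum_const_zero, sub_zero] at this
  exact this.congr fun y => (T.Fy_eq y).symm

/-- A primitive of `kern X`. -/
def prim (X q : ℝ) : ℝ :=
  if T.α = 2 then -(X * T.Fy (X / q)) else q * T.S (X / q ^ (T.α / 2))

/-- For `α = 2`, the chain-rule factor `X² / q²` cancels the `y²` in the derivative of `F_y` at `y =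
X / q`. For `α > 2`, put `z = X / q^(α/2)`: the derivative of `q S(z)` is `S - (α/2) z S'`, which
the differential equation of `S` identifies with `(1 + z)^(-N)`. -/
theorem prim_hasDerivAt {X q : ℝ} (hX : 0 < X) (hq : 0 < q) :
    HasDerivAt (T.prim X) (T.kern X q) q := by
  by_cases hα : T.α = 2
  · have h1 : HasDerivAt (fun x : ℝ => X / x) (-X / q ^ 2) q := by
      have := (hasDerivAt_inv hq.ne').const_mul X
      refine (this.congr_deriv ?_).congr_of_eventuallyEq (Eventually.of_forall fun x => ?_)
      · field_simp
      · simp [div_eq_mul_inv]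
    have h2 := (((T.Fy_hasDerivAt (div_pos hX hq)).comp q h1).const_mul X).neg
    refine (h2.congr_deriv ?_).congr_of_eventuallyEq (Eventually.of_forall fun x => ?_)
    · simp only [kern, hα]
      norm_num
      field_simp
    · simp [prim, hα]
  · have hα2 : 2 < T.α := lt_of_le_of_ne T.two_le_α (Ne.symm hα)
    have hβ : 0 < 2 / T.α := div_pos two_pos T.α_pos
    have hβ1 : 2 / T.α < 1 := (div_lt_one T.α_pos).2 hα2
    have hz : 0 < X / q ^ (T.α / 2) := by positivity
    obtain ⟨D, hD, he⟩ := gaussHyp_hasDerivAt hβ hβ1 T.Np_pos hz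
    have h1 : HasDerivAt (fun x : ℝ => X / x ^ (T.α / 2))
        (X * (-(T.α / 2 * q ^ (T.α / 2 - 1)) / (q ^ (T.α / 2)) ^ 2)) q := by
      have := ((Real.hasDerivAt_rpow_const (p := T.α / 2) (Or.inl hq.ne')).inv
        (by positivity)).const_mul X
      refine this.congr_of_eventuallyEq (Eventually.of_forall fun x => ?_)
      simp [div_eq_mul_inv]
    have h2 := (hasDerivAt_id q).mul (hD.comp q h1)
    refine (h2.congr_deriv ?_).congr_of_eventuallyEq (Eventually.of_forall fun x => ?_)
    · simp only [id, Function.comp_apply, kern]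
      rw [Real.rpow_sub_one hq.ne']
      set z := X / q ^ (T.α / 2) with hzdef
      have e1 : X * (-(T.α / 2 * (q ^ (T.α / 2) / q)) / (q ^ (T.α / 2)) ^ 2) =
          -(T.α / 2) * z / q := by
        rw [hzdef]
        field_simp
      rw [e1]
      have e2 : gaussHyp (-(2 / T.α)) T.Np (1 - 2 / T.α) (-z) =
          (z * D + 2 / T.α / (1 + z) ^ T.Np) * (T.α / 2) := by
        have hα0 := T.α_pos.ne'
        have : 2 / T.α * (T.α / 2) = 1 := by field_simp
        linear_combination (-(T.α / 2)) * he - gaussHyp (-(2 / T.α)) T.Np (1 - 2 / T.α) (-z) * this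
      rw [e2]
      have hα0 := T.α_pos.ne'
      have hz1 : (1 + z) ^ T.Np ≠ 0 := by positivity
      field_simp
      ring
    · simp only [prim, hα, if_false, S, Pi.mul_apply, id, Function.comp_apply]

/-- The limit of `prim X` at `0`. -/
def primZero (X : ℝ) : ℝ := if T.α = 2 then 0 else T.Δ X

/-- As `q` decreases to `0` the argument `z = X / q^(α/2)` tends to infinity and `q = z^(-2/α)
X^(2/α)`, so the growth constant of `S` becomes `Δ`. For `α = 2` it suffices that `F_y` vanishes at
infinity. -/
theorem tendsto_prim {X : ℝ} (hX : 0 < X) :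
    Tendsto (T.prim X) (𝓝[>] 0) (𝓝 (T.primZero X)) := by
  by_cases hα : T.α = 2
  · have h1 : Tendsto (fun q : ℝ => X / q) (𝓝[>] 0) atTop := by
      simpa only [div_eq_mul_inv] using tendsto_inv_nhdsGT_zero.const_mul_atTop hX
    have h2 := ((T.tendsto_Fy_atTop.comp h1).const_mul X).neg
    simp only [mul_zero, neg_zero] at h2
    simp only [primZero, hα, if_true]
    refine h2.congr fun q => ?_
    simp [prim, hα]
  · have hα2 : 2 < T.α := lt_of_le_of_ne T.two_le_α (Ne.symm hα)
    have hβ : 0 < 2 / T.α := div_pos two_pos T.α_pos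
    have hβ1 : 2 / T.α < 1 := (div_lt_one T.α_pos).2 hα2
    have hα4 : 0 < T.α / 2 := by linarith
    have h0 : Tendsto (fun q : ℝ => q ^ (T.α / 2)) (𝓝[>] 0) (𝓝[>] 0) := by
      refine tendsto_nhdsWithin_iff.2 ⟨?_, ?_⟩
      · have := (Real.continuousAt_rpow_const 0 (T.α / 2) (Or.inr hα4.le)).tendsto
        rw [Real.zero_rpow hα4.ne'] at this
        exact this.mono_left nhdsWithin_le_nhds
      · filter_upwards [self_mem_nhdsWithin] with q hq
        exact Real.rpow_pos_of_pos hq _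
    have h1 : Tendsto (fun q : ℝ => X / q ^ (T.α / 2)) (𝓝[>] 0) atTop := by
      simpa only [div_eq_mul_inv, Function.comp_def] using
        (tendsto_inv_nhdsGT_zero.comp h0).const_mul_atTop hX
    have h2 := ((tendsto_rpow_mul_gaussHyp hβ hβ1 T.Np_pos).comp h1).mul_const (X ^ (2 / T.α))
    simp only [primZero, hα, if_false, Δ]
    refine h2.congr' ?_
    filter_upwards [self_mem_nhdsWithin] with q hq
    have hq : 0 < q := hq
    simp only [prim, hα, if_false, Function.comp_apply, S]
    have e : (X / q ^ (T.α / 2)) ^ (-(2 / T.α)) * X ^ (2 / T.α) = q := by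
      rw [Real.rpow_neg (by positivity), Real.div_rpow hX.le (by positivity),
        ← Real.rpow_mul hq.le]
      have : T.α / 2 * (2 / T.α) = 1 := by
        have := T.α_pos.ne'
        field_simp
      rw [this, Real.rpow_one]
      have : X ^ (2 / T.α) ≠ 0 := by positivity
      field_simp
    linear_combination gaussHyp (-(2 / T.α)) T.Np (1 - 2 / T.α) (-(X / q ^ (T.α / 2))) * e

theorem integral_kern {X a b : ℝ} (hX : 0 < X) (ha : 0 < a) (hab : a ≤ b) :
    ∫ q in a..b, T.kern X q = T.prim X b - T.prim X a :=
  intervalIntegral.integral_eq_sub_of_hasDerivAt (fun q hq => by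
    rw [Set.uIcc_of_le hab] at hq
    exact T.prim_hasDerivAt hX (lt_of_lt_of_le ha hq.1))
    (T.intervalIntegrable_kern hX.le ha.le (ha.le.trans hab))

theorem integral_kern_zero {X b : ℝ} (hX : 0 < X) (hb : 0 < b) :
    ∫ q in (0 : ℝ)..b, T.kern X q = T.prim X b - T.primZero X :=
  intervalIntegral.integral_eq_sub_of_hasDerivAt_of_tendsto hb
    (fun _ hq => T.prim_hasDerivAt hX hq.1) (T.intervalIntegrable_kern hX.le le_rfl hb.le)
    (T.tendsto_prim hX) ((T.prim_hasDerivAt hX hb).continuousAt.tendsto.mono_left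
      nhdsWithin_le_nhds)

theorem rpow_α {r : ℝ} (hr : 0 ≤ r) : (r ^ 2) ^ (T.α / 2) = r ^ T.α := by
  rw [← Real.rpow_natCast, ← Real.rpow_mul hr]
  congr 1
  push_cast
  ring

/-- For positive `X = s G τ / N` the terms of `W` are values of `prim` at `r²` and `R_L²`, together
with its limit at `0`. At `X = 0` the kernel is constantly `1`, and for `α = 2` the separately
defined limit value of `W` is the one needed. -/
theorem W_eq {r ω s τ : ℝ} (hr : 0 < r) (hrR : r ≤ T.RL) (hX : 0 ≤ s * T.G ω * τ / T.Np) :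
    T.W r ω s τ = -(T.p * ∫ q in (r ^ 2)..(T.RL ^ 2), T.kern (s * T.G ω * τ / T.Np) q) -
      (1 - T.p) * ∫ q in (0 : ℝ)..(T.RL ^ 2), T.kern (s * T.G ω * τ / T.Np) q := by
  have hR := T.RL_pos
  have hN := T.Np_pos'
  have hr2 : 0 < r ^ 2 := by positivity
  have hrR2 : r ^ 2 ≤ T.RL ^ 2 := by gcongr
  rcases eq_or_lt_of_le hX with hX0 | hX0
  · have hs : s * T.G ω * τ = 0 := by
      rcases div_eq_zero_iff.1 hX0.symm with h | h
      · exact h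
      · exact absurd h hN.ne'
    rw [← hX0]
    simp only [kern_zero, intervalIntegral.integral_const, smul_eq_mul, mul_one, sub_zero]
    unfold W
    simp only [hs, if_true, zero_div]
    split_ifs with hα
    · ring
    · have hβ : (2 : ℝ) / T.α ≠ 0 := (div_pos two_pos T.α_pos).ne'
      have hS : T.S 0 = 1 := by simp [S, gaussHyp]
      rw [hS, Δ, Real.zero_rpow hβ]
      ring
  · rw [T.integral_kern hX0 hr2 hrR2, T.integral_kern_zero hX0 (by positivity)]
    have hs : s * T.G ω * τ ≠ 0 := by
      intro h
      rw [h, zero_div] at hX0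
      exact lt_irrefl _ hX0
    unfold W prim primZero
    simp only [hs, if_false, T.rpow_α hr.le, T.rpow_α hR.le, div_div]
    split_ifs with hα
    · ring
    · ring

end Params

end Pico
end

noncomputable section

namespace Pico

namespace Params

variable (T : Params)

/-! ### Array gain -/

/-- The array gain is a normalised Fejér kernel. As the squared modulus of a finite exponential sum
it is visibly continuous and nonnegative, also at the removable singularities. -/
theorem G_eq (ω : ℝ) : T.G ω = ‖∑ k ∈ Finset.range T.Nant,
    Complex.exp (Complex.I * ((2 * Real.pi * ω : ℝ) : ℂ)) ^ k‖ ^ 2 / (T.Nant : ℝ) ^ 2 := by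
  have hN : (0 : ℝ) < T.Nant := by exact_mod_cast T.Nant_pos
  set z := Complex.exp (Complex.I * ((2 * Real.pi * ω : ℝ) : ℂ)) with hz
  have h1 : ‖z - 1‖ = |2 * Real.sin (Real.pi * ω)| := by
    rw [hz, Complex.norm_exp_I_mul_ofReal_sub_one, Real.norm_eq_abs]
    congr 3
    ring
  have h2 : ‖z ^ T.Nant - 1‖ = |2 * Real.sin (Real.pi * T.Nant * ω)| := by
    have : z ^ T.Nant = Complex.exp (Complex.I * ((T.Nant * (2 * Real.pi * ω) : ℝ) : ℂ)) := by
      rw [hz, ← Complex.exp_nat_mul]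
      congr 1
      push_cast
      ring
    rw [this, Complex.norm_exp_I_mul_ofReal_sub_one, Real.norm_eq_abs]
    congr 3
    ring
  unfold G
  split_ifs with hs
  · have hz1 : z = 1 := by
      rw [hs, mul_zero, abs_zero, norm_eq_zero] at h1
      exact sub_eq_zero.1 h1
    simp only [hz1, one_pow, Finset.sum_const, Finset.card_range, nsmul_eq_mul, mul_one,
      Complex.norm_natCast]
    rw [div_self (by positivity)]
  · have h3 : ‖∑ k ∈ Finset.range T.Nant, z ^ k‖ * |2 * Real.sin (Real.pi * ω)| =
        |2 * Real.sin (Real.pi * T.Nant * ω)| := by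
      rw [← h1, ← h2, ← norm_mul, geom_sum_mul]
    have h4 := congrArg (· ^ 2) h3
    simp only [mul_pow, sq_abs] at h4
    rw [div_eq_div_iff (by positivity) (by positivity)]
    linear_combination (-(T.Nant : ℝ) ^ 2 / 4) * h4

theorem continuous_G : Continuous T.G := by
  rw [funext T.G_eq]
  fun_prop

theorem G_nonneg (ω : ℝ) : 0 ≤ T.G ω := by
  rw [G_eq]
  positivity

theorem η_pos : 0 < T.η := by
  have := T.Np_pos'
  unfold η
  positivity

/-! ### Continuity and bounds -/

/-- Retention factor at squared distance `q`: the base stations that are closer than the serving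
one do not cache the file. -/
def thin (r q : ℝ) : ℝ := if q ≤ r ^ 2 then 1 - T.p else 1

theorem thin_nonneg (r q : ℝ) : 0 ≤ T.thin r q := by
  unfold thin
  split_ifs
  · linarith [T.p.2.2]
  · exact zero_le_one

theorem thin_le_one (r q : ℝ) : T.thin r q ≤ 1 := by
  unfold thin
  split_ifs
  · linarith [T.p.2.1]
  · exact le_rfl

theorem measurable_thin (r : ℝ) : Measurable (T.thin r) :=
  Measurable.ite measurableSet_Iic measurable_const measurable_const

/-- The scale of the interference, `X = s G τ / N_p` at `s = n η r^α`. -/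
def scale (n : ℕ) (τ r ω : ℝ) : ℝ := n * T.η * r ^ T.α / G0 * T.G ω * τ / T.Np

theorem scale_nonneg (n : ℕ) {τ r : ℝ} (hτ : 0 ≤ τ) (hr : 0 ≤ r) (ω : ℝ) :
    0 ≤ T.scale n τ r ω := by
  have := T.G_nonneg ω
  have := T.η_pos
  unfold scale G0
  positivity

/-- The weight `1 - p` on `(0, R_L²)` and the weight `p` on `(r², R_L²)` add up to `thin`. Both the
quadrature limit and the Campbell–Mecke computation use `W` in this form. -/
theorem W_eq_integral_thin {n : ℕ} {τ r : ℝ} (hτ : 0 ≤ τ) (hr : 0 < r) (hrR : r ≤ T.RL) (ω : ℝ) :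
    T.W r ω (n * T.η * r ^ T.α / G0) τ =
      -∫ q in (0 : ℝ)..(T.RL ^ 2), T.thin r q * T.kern (T.scale n τ r ω) q := by
  have hX := T.scale_nonneg n hτ hr.le ω
  rw [T.W_eq hr hrR hX]
  change -(T.p * ∫ q in (r ^ 2)..(T.RL ^ 2), T.kern (T.scale n τ r ω) q) -
      (1 - T.p) * ∫ q in (0 : ℝ)..(T.RL ^ 2), T.kern (T.scale n τ r ω) q = _
  set X := T.scale n τ r ω
  have hrR2 : r ^ 2 ≤ T.RL ^ 2 := by gcongr
  have hr2 : 0 ≤ r ^ 2 := by positivity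
  have hR2 : 0 ≤ T.RL ^ 2 := by positivity
  have i1 := T.intervalIntegrable_kern hX le_rfl hr2
  have i2 := T.intervalIntegrable_kern hX hr2 hR2
  have e1 : Set.EqOn (fun q => (1 - T.p) * T.kern X q) (fun q => T.thin r q * T.kern X q)
      (Set.uIoc 0 (r ^ 2)) := by
    intro q hq
    rw [Set.uIoc_of_le hr2] at hq
    simp [thin, hq.2]
  have e2 : Set.EqOn (fun q => T.kern X q) (fun q => T.thin r q * T.kern X q)
      (Set.uIoc (r ^ 2) (T.RL ^ 2)) := by
    intro q hq
    rw [Set.uIoc_of_le hrR2] at hq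
    simp [thin, not_le.2 hq.1]
  rw [← intervalIntegral.integral_add_adjacent_intervals
    ((i1.const_mul (1 - (T.p : ℝ))).congr e1) (i2.congr e2),
    ← intervalIntegral.integral_congr_ae (Eventually.of_forall e1),
    ← intervalIntegral.integral_congr_ae (Eventually.of_forall e2),
    ← intervalIntegral.integral_add_adjacent_intervals i1 i2,
    intervalIntegral.integral_const_mul]
  ring

theorem thin_mul_kern_nonneg {r X q : ℝ} (hX : 0 ≤ X) (hq : 0 ≤ q) :
    0 ≤ T.thin r q * T.kern X q :=
  mul_nonneg (T.thin_nonneg r q) (T.kern_pos hX hq).le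

theorem thin_mul_kern_le_one {r X q : ℝ} (hX : 0 ≤ X) (hq : 0 ≤ q) :
    T.thin r q * T.kern X q ≤ 1 :=
  mul_le_one₀ (T.thin_le_one r q) (T.kern_pos hX hq).le (T.kern_le_one hX hq)

theorem abs_W_le {n : ℕ} {τ r : ℝ} (hτ : 0 ≤ τ) (hr : 0 < r) (hrR : r ≤ T.RL) (ω : ℝ) :
    |T.W r ω (n * T.η * r ^ T.α / G0) τ| ≤ T.RL ^ 2 := by
  rw [T.W_eq_integral_thin hτ hr hrR, abs_neg]
  have hX := T.scale_nonneg n hτ hr.le ω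
  have := intervalIntegral.norm_integral_le_of_norm_le_const (a := 0) (b := T.RL ^ 2) (C := 1)
    (f := fun q => T.thin r q * T.kern (T.scale n τ r ω) q) (by
      intro q hq
      rw [Set.uIoc_of_le (by positivity)] at hq
      rw [Real.norm_eq_abs, abs_of_nonneg (T.thin_mul_kern_nonneg hX hq.1.le)]
      exact T.thin_mul_kern_le_one hX hq.1.le)
  rwa [Real.norm_eq_abs, sub_zero, one_mul, abs_of_nonneg (by positivity : 0 ≤ T.RL ^ 2)] at this

theorem tendsto_kern {ι : Type*} {l : Filter ι} {X : ι → ℝ} {Q : ι → ℝ} {X₀ q₀ : ℝ}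
    (hX : Tendsto X l (𝓝 X₀)) (hQ : Tendsto Q l (𝓝 q₀)) (hX₀ : 0 ≤ X₀) (hq₀ : 0 < q₀) :
    Tendsto (fun a => T.kern (X a) (Q a)) l (𝓝 (T.kern X₀ q₀)) := by
  unfold kern
  have h1 : Tendsto (fun a => Q a ^ (T.α / 2)) l (𝓝 (q₀ ^ (T.α / 2))) :=
    hQ.rpow_const (Or.inl hq₀.ne')
  have h2 := T.one_le_one_add hX₀ hq₀.le
  exact (((hX.div h1 (by positivity)).const_add 1).pow T.Np).inv₀ (by positivity)

theorem tendsto_thin {ι : Type*} {l : Filter ι} {r Q : ι → ℝ} {r₀ q₀ : ℝ}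
    (hr : Tendsto r l (𝓝 r₀)) (hQ : Tendsto Q l (𝓝 q₀)) (hne : q₀ ≠ r₀ ^ 2) :
    Tendsto (fun a => T.thin (r a) (Q a)) l (𝓝 (T.thin r₀ q₀)) := by
  refine Tendsto.congr' ?_ tendsto_const_nhds
  rcases lt_or_gt_of_ne hne with h | h
  · filter_upwards [hQ.eventually_lt (hr.pow 2) h] with a ha
    simp [thin, h.le, ha.le]
  · filter_upwards [(hr.pow 2).eventually_lt hQ h] with a ha
    simp [thin, not_le.2 h, not_le.2 ha]

theorem tendsto_scale {ι : Type*} {l : Filter ι} {r ω : ι → ℝ} {r₀ ω₀ : ℝ}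
    (hr : Tendsto r l (𝓝 r₀)) (hω : Tendsto ω l (𝓝 ω₀)) (n : ℕ) (τ : ℝ) (hr₀ : 0 < r₀) :
    Tendsto (fun a => T.scale n τ (r a) (ω a)) l (𝓝 (T.scale n τ r₀ ω₀)) := by
  unfold scale
  have h1 : Tendsto (fun a => r a ^ T.α) l (𝓝 (r₀ ^ T.α)) := hr.rpow_const (Or.inl hr₀.ne')
  have h2 : Tendsto (fun a => T.G (ω a)) l (𝓝 (T.G ω₀)) := (T.continuous_G.tendsto ω₀).comp hω
  exact (((((h1.const_mul _).div_const _).mul h2).mul_const τ).div_const _)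

/-- Continuity is read off the integral rather than the closed formula, which changes shape at `X =
0`. The integrand lies in `[0, 1]`, and the jump of `thin` sits at the single point `q = r₀²`. -/
theorem tendsto_W {ι : Type*} {l : Filter ι} [l.IsCountablyGenerated] {r ω : ι → ℝ} {r₀ ω₀ : ℝ}
    (hr : Tendsto r l (𝓝 r₀)) (hω : Tendsto ω l (𝓝 ω₀)) (n : ℕ) {τ : ℝ} (hτ : 0 ≤ τ)
    (hr₀ : 0 < r₀) (hrR : r₀ < T.RL) :
    Tendsto (fun a => T.W (r a) (ω a) (n * T.η * r a ^ T.α / G0) τ) l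
      (𝓝 (T.W r₀ ω₀ (n * T.η * r₀ ^ T.α / G0) τ)) := by
  have hev : ∀ᶠ a in l, 0 < r a ∧ r a ≤ T.RL := by
    filter_upwards [hr.eventually (lt_mem_nhds hr₀), hr.eventually (gt_mem_nhds hrR)] with a h1 h2
    exact ⟨h1, le_of_lt h2⟩
  rw [T.W_eq_integral_thin hτ hr₀ hrR.le]
  refine Tendsto.congr' (f₁ := fun a =>
    -∫ q in (0 : ℝ)..(T.RL ^ 2), T.thin (r a) q * T.kern (T.scale n τ (r a) (ω a)) q) ?_ ?_
  · filter_upwards [hev] with a ha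
    rw [T.W_eq_integral_thin hτ ha.1 ha.2]
  refine Tendsto.neg (intervalIntegral.tendsto_integral_filter_of_dominated_convergence
    (fun _ => 1) ?_ ?_ intervalIntegrable_const ?_)
  · refine Eventually.of_forall fun a => Measurable.aestronglyMeasurable ?_
    exact (T.measurable_thin (r a)).mul (T.measurable_kern.comp measurable_prodMk_left)
  · filter_upwards [hev] with a ha
    refine Eventually.of_forall fun q hq => ?_
    rw [Set.uIoc_of_le (by positivity)] at hq
    have hX := T.scale_nonneg n hτ ha.1.le (ω a)
    rw [Real.norm_eq_abs, abs_of_nonneg (T.thin_mul_kern_nonneg hX hq.1.le)]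
    exact T.thin_mul_kern_le_one hX hq.1.le
  · filter_upwards [volume.ae_ne (r₀ ^ 2)] with q hne hq
    rw [Set.uIoc_of_le (by positivity)] at hq
    exact (T.tendsto_thin hr tendsto_const_nhds hne).mul
      (T.tendsto_kern (T.tendsto_scale hr hω n τ hr₀) tendsto_const_nhds
        (T.scale_nonneg n hτ hr₀.le ω₀) hq.1)

/-! ### Convergence of the Gauss–Chebyshev expression -/

theorem continuousAt_noiseDist (n : ℕ) (τ : ℝ) {r₀ : ℝ} (hr : 0 < r₀) :
    ContinuousAt (fun r => T.noiseDist n r τ) r₀ := by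
  unfold noiseDist distPDF
  have h1 : ContinuousAt (fun r : ℝ => r ^ T.α) r₀ :=
    Real.continuousAt_rpow_const _ _ (Or.inl hr.ne')
  have h2 : ContinuousAt (fun r : ℝ => Real.exp (-(n * T.η * r ^ T.α * τ * T.noise /
      (T.Pt * T.C * T.Nant * G0)))) r₀ :=
    Real.continuous_exp.continuousAt.comp
      (((((continuousAt_const.mul h1).mul_const _).mul_const _).div_const _).neg)
  exact h2.mul (Continuous.continuousAt (by fun_prop))

theorem noise_arg_nonneg (n : ℕ) {τ r : ℝ} (hτ : 0 ≤ τ) (hr : 0 ≤ r) :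
    0 ≤ n * T.η * r ^ T.α * τ * T.noise / (T.Pt * T.C * T.Nant * G0) := by
  have := T.η_pos
  have := T.noise_pos
  have := T.Pt_pos
  have := T.C_pos
  unfold G0
  positivity

theorem distPDF_nonneg {r : ℝ} (hr : 0 ≤ r) : 0 ≤ T.distPDF r := by
  have := T.p.2.1
  have := T.dens_pos
  unfold distPDF
  positivity

theorem noiseDist_nonneg (n : ℕ) {τ r : ℝ} (hr : 0 ≤ r) : 0 ≤ T.noiseDist n r τ :=
  mul_nonneg (Real.exp_pos _).le (T.distPDF_nonneg hr)

theorem noiseDist_le (n : ℕ) {τ r : ℝ} (hτ : 0 ≤ τ) (hr : 0 ≤ r) (hrR : r ≤ T.RL) :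
    T.noiseDist n r τ ≤ 2 * Real.pi * T.p * T.dens * T.RL := by
  have h1 : T.noiseDist n r τ ≤ 1 * T.distPDF r := by
    refine mul_le_mul_of_nonneg_right ?_ (T.distPDF_nonneg hr)
    exact Real.exp_le_one_iff.2 (neg_nonpos.2 (T.noise_arg_nonneg n hτ hr))
  refine h1.trans ?_
  have hp := T.p.2.1
  have hd := T.dens_pos
  have := T.RL_pos
  unfold distPDF
  rw [one_mul]
  have h2 : Real.exp (-(Real.pi * T.p * T.dens * r ^ 2)) ≤ 1 :=
    Real.exp_le_one_iff.2 (neg_nonpos.2 (by positivity))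
  calc _ ≤ 2 * Real.pi * T.p * T.dens * r * 1 := by gcongr
    _ ≤ _ := by rw [mul_one]; gcongr

theorem laplaceGC_nonneg (u : ℕ) (r s τ : ℝ) : 0 ≤ T.laplaceGC u r s τ := (Real.exp_pos _).le

/-- The first exponent term is nonpositive and each summand of the quadrature is at most `R_L²` in
absolute value, so the bound does not depend on `u`. This uniformity provides the dominating
constant for the outer quadrature. -/
theorem laplaceGC_le (u n : ℕ) {τ r : ℝ} (hτ : 0 ≤ τ) (hr : 0 < r) (hrR : r ≤ T.RL) :
    T.laplaceGC u r (n * T.η * r ^ T.α / G0) τ ≤ Real.exp (Real.pi ^ 2 * T.dens / 2 * T.RL ^ 2) := by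
  unfold laplaceGC
  refine Real.exp_le_exp.2 ?_
  have hd := T.dens_pos
  have h1 : 0 ≤ Real.pi * T.dens * (T.RL ^ 2 - T.p * r ^ 2) := by
    have : T.p * r ^ 2 ≤ 1 * T.RL ^ 2 :=
      mul_le_mul T.p.2.2 (by gcongr) (by positivity) zero_le_one
    have : 0 ≤ T.RL ^ 2 - T.p * r ^ 2 := by linarith
    positivity
  have h2 : |∑ k ∈ Finset.Icc 1 u, T.W r (node u k * T.d / T.wl) (n * T.η * r ^ T.α / G0) τ *
      √(1 - node u k ^ 2)| ≤ u * T.RL ^ 2 := by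
    refine (Finset.abs_sum_le_sum_abs _ _).trans ?_
    refine (Finset.sum_le_card_nsmul _ _ (T.RL ^ 2) fun k _ => ?_).trans (by simp)
    rw [abs_mul, abs_of_nonneg (Real.sqrt_nonneg _)]
    calc _ ≤ T.RL ^ 2 * 1 := by
          refine mul_le_mul (T.abs_W_le hτ hr hrR _) ?_ (Real.sqrt_nonneg _) (by positivity)
          rw [Real.sqrt_le_one]
          linarith [sq_nonneg (node u k)]
      _ = _ := mul_one _
  have h3 := (abs_le.1 h2).1
  have h4 : -(Real.pi ^ 2 * T.dens / 2 * T.RL ^ 2) ≤ Real.pi ^ 2 * T.dens / (2 * u) *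
      ∑ k ∈ Finset.Icc 1 u, T.W r (node u k * T.d / T.wl) (n * T.η * r ^ T.α / G0) τ *
        √(1 - node u k ^ 2) := by
    -- With no nodes, division by zero makes the quadrature term `0`.
    rcases Nat.eq_zero_or_pos u with rfl | hu
    · simp only [CharP.cast_eq_zero, mul_zero, div_zero, zero_mul]
      have : 0 ≤ Real.pi ^ 2 * T.dens / 2 * T.RL ^ 2 := by positivity
      linarith
    · have hu' : (0 : ℝ) < u := by exact_mod_cast hu
      have h5 : 0 ≤ Real.pi ^ 2 * T.dens / (2 * u) := by positivity
      calc -(Real.pi ^ 2 * T.dens / 2 * T.RL ^ 2) =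
            Real.pi ^ 2 * T.dens / (2 * u) * -(u * T.RL ^ 2) := by field_simp
        _ ≤ _ := mul_le_mul_of_nonneg_left h3 h5
  linarith

theorem integral_comp_mul_d_div_wl (f : ℝ → ℝ) :
    ∫ x in (-1 : ℝ)..1, f (x * T.d / T.wl) =
      T.wl / T.d * ∫ ω in (-(T.d / T.wl))..(T.d / T.wl), f ω := by
  have hd := T.d_pos
  have hwl := T.wl_pos
  have hne : T.d / T.wl ≠ 0 := by positivity
  simp only [mul_div_assoc]
  rw [intervalIntegral.integral_comp_mul_right f hne]
  simp

/-- The serving distance varies together with the number of nodes, because the outer quadrature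
samples at moving points; convergence at each fixed `r` would not be enough. -/
theorem tendsto_laplaceGC {ι : Type*} {l : Filter ι} [l.IsCountablyGenerated] {u : ι → ℕ}
    (hu : Tendsto u l atTop) {r : ι → ℝ} {r₀ : ℝ} (hr : Tendsto r l (𝓝 r₀)) (hr₀ : 0 < r₀)
    (hr₀R : r₀ < T.RL) (n : ℕ) {τ : ℝ} (hτ : 0 ≤ τ) :
    Tendsto (fun a => T.laplaceGC (u a) (r a) (n * T.η * r a ^ T.α / G0) τ) l
      (𝓝 (T.laplace r₀ (n * T.η * r₀ ^ T.α / G0) τ)) := by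
  have hd := T.d_pos
  have hwl := T.wl_pos
  have key := tendsto_gaussChebyshev (l := l) hu
    (h := fun a y => T.W (r a) (y * T.d / T.wl) (n * T.η * r a ^ T.α / G0) τ)
    (H := fun y => T.W r₀ (y * T.d / T.wl) (n * T.η * r₀ ^ T.α / G0) τ) (C := T.RL ^ 2)
    (by
      filter_upwards [hr.eventually (lt_mem_nhds hr₀), hr.eventually (gt_mem_nhds hr₀R)]
        with a h1 h2 y _
      exact T.abs_W_le hτ h1 (le_of_lt h2) _)
    (by
      intro x _
      exact T.tendsto_W (r := fun q : ι × ℝ => r q.1) (ω := fun q : ι × ℝ => q.2 * T.d / T.wl)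
        (hr.comp tendsto_fst) ((tendsto_snd.mul_const _).div_const _) n hτ hr₀ hr₀R)
  have hint := T.integral_comp_mul_d_div_wl fun ω => T.W r₀ ω (n * T.η * r₀ ^ T.α / G0) τ
  rw [hint] at key
  have h1 : Tendsto (fun a => -(Real.pi * T.dens * (T.RL ^ 2 - T.p * r a ^ 2))) l
      (𝓝 (-(Real.pi * T.dens * (T.RL ^ 2 - T.p * r₀ ^ 2)))) :=
    ((((hr.pow 2).const_mul _).const_sub _).const_mul _).neg
  have h2 := (h1.sub (key.const_mul (Real.pi * T.dens / 2))).rexp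
  have e : ∀ I : ℝ, Real.pi * T.dens / 2 * (T.wl / T.d * I) =
      Real.pi * T.dens * T.wl / (2 * T.d) * I := fun I => by field_simp
  rw [e] at h2
  refine h2.congr fun a => ?_
  have e' : ∀ I : ℝ, Real.pi * T.dens / 2 * (Real.pi / u a * I) =
      Real.pi ^ 2 * T.dens / (2 * u a) * I := fun I => by ring
  rw [e']
  rfl

/-- The outer quadrature is applied to an integrand that itself depends on `u₁`. Its continuous
convergence and a bound uniform in `u₁` give the joint limit, with no prescribed relation between
the two node counts. -/
theorem tendsto_coverageGC {τ : ℝ} (hτ : 0 ≤ τ) :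
    Tendsto (fun u : ℕ × ℕ => T.coverageGC u.1 u.2 τ) (atTop ×ˢ atTop) (𝓝 (T.coverageInt τ)) := by
  have hR := T.RL_pos
  have hmem : ∀ x ∈ Set.Ioo (-1 : ℝ) 1, 0 < (x + 1) * T.RL / 2 ∧ (x + 1) * T.RL / 2 < T.RL := by
    intro x hx
    have h1 : 0 < x + 1 := by linarith [hx.1]
    refine ⟨by positivity, ?_⟩
    nlinarith [hx.2]
  have key : ∀ n : ℕ, Tendsto (fun u : ℕ × ℕ => Real.pi / u.2 * ∑ k ∈ Finset.Icc 1 u.2,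
      T.FD u.1 n ((node u.2 k + 1) * T.RL / 2) τ * √(1 - node u.2 k ^ 2)) (atTop ×ˢ atTop)
      (𝓝 (∫ x in (-1 : ℝ)..1, T.laplace ((x + 1) * T.RL / 2)
        (n * T.η * ((x + 1) * T.RL / 2) ^ T.α / G0) τ * T.noiseDist n ((x + 1) * T.RL / 2) τ)) := by
    intro n
    refine tendsto_gaussChebyshev (l := atTop ×ˢ atTop) (u := fun a : ℕ × ℕ => a.2) tendsto_snd
      (h := fun a y => T.FD a.1 n ((y + 1) * T.RL / 2) τ)
      (H := fun x => T.laplace ((x + 1) * T.RL / 2)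
        (n * T.η * ((x + 1) * T.RL / 2) ^ T.α / G0) τ * T.noiseDist n ((x + 1) * T.RL / 2) τ)
      (C := Real.exp (Real.pi ^ 2 * T.dens / 2 * T.RL ^ 2) *
        (2 * Real.pi * T.p * T.dens * T.RL)) ?_ ?_
    · refine Eventually.of_forall fun a y hy => ?_
      obtain ⟨h1, h2⟩ := hmem y hy
      have hn := T.noiseDist_nonneg n (τ := τ) h1.le
      unfold FD
      rw [abs_of_nonneg (mul_nonneg (T.laplaceGC_nonneg _ _ _ _) hn)]
      exact mul_le_mul (T.laplaceGC_le _ n hτ h1 h2.le) (T.noiseDist_le n hτ h1.le h2.le) hn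
        (Real.exp_pos _).le
    · intro x hx
      obtain ⟨h1, h2⟩ := hmem x hx
      have hr : Tendsto (fun q : (ℕ × ℕ) × ℝ => (q.2 + 1) * T.RL / 2)
          ((atTop ×ˢ atTop) ×ˢ 𝓝 x) (𝓝 ((x + 1) * T.RL / 2)) :=
        (((tendsto_snd).add_const 1).mul_const _).div_const _
      exact (T.tendsto_laplaceGC (u := fun q : (ℕ × ℕ) × ℝ => q.1.1)
        (tendsto_fst.comp tendsto_fst) hr h1 h2 n hτ).mul
        ((T.continuousAt_noiseDist n τ h1).tendsto.comp hr)
  unfold coverageInt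
  have hsum := tendsto_finsetSum (Finset.Icc 1 T.Np) fun n _ =>
    ((key n).const_mul (T.RL / 2)).const_mul ((-1) ^ (n + 1) * (T.Np.choose n : ℝ))
  have hlim : ∀ n : ℕ, T.RL / 2 * (∫ x in (-1 : ℝ)..1, T.laplace ((x + 1) * T.RL / 2)
        (n * T.η * ((x + 1) * T.RL / 2) ^ T.α / G0) τ * T.noiseDist n ((x + 1) * T.RL / 2) τ) =
      ∫ r in (0 : ℝ)..T.RL, T.laplace r (n * T.η * r ^ T.α / G0) τ * T.noiseDist n r τ := by
    intro n
    have hne : T.RL / 2 ≠ 0 := by positivity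
    have := intervalIntegral.integral_comp_mul_add (a := -1) (b := 1)
      (fun r => T.laplace r (n * T.η * r ^ T.α / G0) τ * T.noiseDist n r τ) hne (T.RL / 2)
    have e1 : T.RL / 2 * (-1) + T.RL / 2 = 0 := by ring
    have e2 : T.RL / 2 * 1 + T.RL / 2 = T.RL := by ring
    rw [e1, e2, smul_eq_mul] at this
    have e3 : ∀ x : ℝ, T.RL / 2 * x + T.RL / 2 = (x + 1) * T.RL / 2 := fun x => by ring
    simp only [e3] at this
    rw [this, mul_inv_cancel_left₀ hne]
  simp only [hlim] at hsum
  refine hsum.congr fun u => ?_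
  unfold coverageGC
  rw [Finset.mul_sum]
  refine Finset.sum_congr rfl fun n _ => ?_
  ring

end Params

end Pico
end

noncomputable section

namespace Pico

/-! ### The Gamma distribution function and its replacement -/

theorem one_sub_exp_neg_div {a : ℝ} (ha : 0 < a) :
    ∫ t in (0 : ℝ)..1, Real.exp (-(a * t)) = (1 - Real.exp (-a)) / a := by
  have := intervalIntegral.integral_comp_mul_left (a := 0) (b := 1) Real.exp (c := -a) (by linarith)
  simp only [neg_mul, mul_zero, mul_one, integral_exp, Real.exp_zero, smul_eq_mul] at this
  rw [this, div_eq_inv_mul, inv_neg]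
  ring

/-- The power mean `((1 - exp(-u)) / u)^(1/u)` is nondecreasing in `u`. -/
theorem one_sub_exp_neg_div_rpow_le {a b : ℝ} (ha : 0 < a) (hab : a ≤ b) :
    ((1 - Real.exp (-a)) / a) ^ (b / a) ≤ (1 - Real.exp (-b)) / b := by
  have hb : 0 < b := lt_of_lt_of_le ha hab
  rw [← one_sub_exp_neg_div ha, ← one_sub_exp_neg_div hb,
    intervalIntegral.integral_of_le zero_le_one, intervalIntegral.integral_of_le zero_le_one]
  have : IsProbabilityMeasure (volume.restrict (Set.Ioc (0 : ℝ) 1)) := ⟨by simp⟩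
  have hcont : ∀ c : ℝ, IntegrableOn (fun t : ℝ => Real.exp (-(c * t))) (Set.Ioc 0 1) := fun c =>
    ((by fun_prop : Continuous fun t : ℝ => Real.exp (-(c * t))).continuousOn.integrableOn_Icc).mono_set
      Set.Ioc_subset_Icc_self
  have hcomp : ∀ t : ℝ, Real.exp (-(a * t)) ^ (b / a) = Real.exp (-(b * t)) := by
    intro t
    rw [← Real.exp_mul]
    congr 1
    field_simp
  -- Jensen's inequality for the convex power `b / a ≥ 1` and the function `exp(-a t)` under the
  -- uniform law on the unit interval.
  have := (convexOn_rpow (p := b / a) ((one_le_div ha).2 hab)).map_integral_le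
    (μ := volume.restrict (Set.Ioc (0 : ℝ) 1)) (f := fun t => Real.exp (-(a * t)))
    (continuousOn_id.rpow_const fun _ _ => Or.inr (by positivity)) isClosed_Ici
    (Eventually.of_forall fun t => (Real.exp_pos _).le) (hcont a) (by
      simp only [Function.comp_def, hcomp]
      exact hcont b)
  simpa only [hcomp] using this

namespace Params

variable (T : Params)

/-- Distribution function of the fading power. -/
def fadingCDF (γ : ℝ) : ℝ := (gammaMeasure T.Np T.Np).real (Set.Iio γ)

theorem isProbabilityMeasure_fading : IsProbabilityMeasure (gammaMeasure T.Np T.Np) :=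
  isProbabilityMeasure_gammaMeasure T.Np_pos' T.Np_pos'

theorem fadingCDF_nonneg (γ : ℝ) : 0 ≤ T.fadingCDF γ := measureReal_nonneg

theorem fadingCDF_le_one (γ : ℝ) : T.fadingCDF γ ≤ 1 := by
  have := T.isProbabilityMeasure_fading
  exact measureReal_le_one

theorem monotone_fadingCDF : Monotone T.fadingCDF := by
  have := T.isProbabilityMeasure_fading
  exact fun _ _ h => measureReal_mono (Set.Iio_subset_Iio h)

theorem fading_singleton (γ : ℝ) : gammaMeasure T.Np T.Np {γ} = 0 :=
  (withDensity_absolutelyContinuous volume (gammaPDF T.Np T.Np)) Real.volume_singleton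

theorem fadingCDF_eq_cdf (γ : ℝ) : T.fadingCDF γ = cdf (gammaMeasure T.Np T.Np) γ := by
  have := T.isProbabilityMeasure_fading
  rw [cdf_eq_real, fadingCDF]
  refine measureReal_congr ?_
  refine Iio_ae_eq_Iic' (T.fading_singleton γ)

theorem η_pow : T.η ^ T.Np = (T.Np : ℝ) ^ T.Np / T.Np.factorial := by
  have hN := T.Np_pos'
  unfold η
  rw [mul_pow, ← Real.rpow_natCast (_ ^ (-(1 / (T.Np : ℝ)))), ← Real.rpow_mul (by positivity)]
  have : -(1 / (T.Np : ℝ)) * T.Np = -1 := by field_simp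
  rw [this, Real.rpow_neg_one]
  rfl

theorem fadingCDF_eq_integral {γ : ℝ} (hγ : 0 ≤ γ) : T.fadingCDF γ =
    ∫ x in (0 : ℝ)..γ, T.Np * T.η ^ T.Np * (x ^ (T.Np - 1) * Real.exp (-(T.Np * x))) := by
  have hN := T.Np_pos'
  rw [fadingCDF_eq_cdf, cdf_gammaMeasure_eq_integral hN hN,
    intervalIntegral.integral_of_le hγ,
    ← integral_indicator measurableSet_Iic, ← integral_indicator measurableSet_Ioc]
  refine integral_congr_ae ?_
  filter_upwards [volume.ae_ne (0 : ℝ)] with x hx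
  obtain ⟨k, hk⟩ : ∃ k, T.Np = k + 1 := ⟨T.Np - 1, by have := T.Np_pos; omega⟩
  by_cases h1 : x ≤ γ
  · rw [Set.indicator_of_mem (show x ∈ Set.Iic γ from h1)]
    rcases lt_or_gt_of_ne hx with h0 | h0
    · rw [Set.indicator_of_notMem (by simp [h0.le]), gammaPDFReal, if_neg (not_le.2 h0)]
    · rw [Set.indicator_of_mem (show x ∈ Set.Ioc 0 γ from ⟨h0, h1⟩), gammaPDFReal, if_pos h0.le,
        T.η_pow, hk]
      have hΓ : Real.Gamma ((k + 1 : ℕ) : ℝ) = k.factorial := by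
        push_cast
        exact Real.Gamma_nat_eq_factorial k
      rw [hΓ, Real.rpow_natCast, Nat.factorial_succ]
      have : x ^ (((k + 1 : ℕ) : ℝ) - 1) = x ^ k := by
        rw [← Real.rpow_natCast]
        congr 1
        push_cast
        ring
      rw [this, Nat.add_sub_cancel]
      push_cast
      field_simp
  · rw [Set.indicator_of_notMem (by simpa using h1), Set.indicator_of_notMem]
    intro h
    exact h1 h.2

/-- By the choice of `η` the Gamma density is `N η^N γ^(N-1) exp(-N γ)`. The positive factor `N η
exp(-η γ)`, common to both derivatives, is pulled out so that the bracket alone decides the sign. -/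
theorem fadingCDF_sub_hasDerivAt {γ : ℝ} (hγ : 0 < γ) :
    HasDerivAt (fun x => T.fadingCDF x - (1 - Real.exp (-(T.η * x))) ^ T.Np)
      (T.Np * T.η * Real.exp (-(T.η * γ)) * ((T.η * γ) ^ (T.Np - 1) *
        Real.exp (-((T.Np - T.η) * γ)) - (1 - Real.exp (-(T.η * γ))) ^ (T.Np - 1))) γ := by
  have hcont : Continuous fun x : ℝ =>
      T.Np * T.η ^ T.Np * (x ^ (T.Np - 1) * Real.exp (-(T.Np * x))) := by fun_prop
  have h1 : HasDerivAt T.fadingCDF _ γ :=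
    ((hcont.integral_hasStrictDerivAt 0 γ).hasDerivAt).congr_of_eventuallyEq (by
      filter_upwards [lt_mem_nhds hγ] with x hx
      exact T.fadingCDF_eq_integral (le_of_lt hx))
  have h2 : HasDerivAt (fun x : ℝ => 1 - Real.exp (-(T.η * x)))
      (-(Real.exp (-(T.η * γ)) * -(T.η * 1))) γ :=
    ((((hasDerivAt_id γ).const_mul T.η).neg).exp).const_sub 1
  refine (h1.sub (h2.pow T.Np)).congr_deriv ?_
  obtain ⟨k, hk⟩ : ∃ k, T.Np = k + 1 := ⟨T.Np - 1, by have := T.Np_pos; omega⟩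
  have e : Real.exp (-(T.η * γ)) * Real.exp (-((T.Np - T.η) * γ)) = Real.exp (-(T.Np * γ)) := by
    rw [← Real.exp_add]
    congr 1
    ring
  rw [← e]
  simp only [hk, Nat.add_sub_cancel]
  ring

/-- Alzer's inequality: the replacement of the Gamma distribution function is a lower bound. -/
theorem replacement_le_fadingCDF {γ : ℝ} (hγ : 0 ≤ γ) :
    (1 - Real.exp (-(T.η * γ))) ^ T.Np ≤ T.fadingCDF γ := by
  set f : ℝ → ℝ := fun x => T.fadingCDF x - (1 - Real.exp (-(T.η * x))) ^ T.Np with hf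
  set f' : ℝ → ℝ := fun γ => T.Np * T.η * Real.exp (-(T.η * γ)) * ((T.η * γ) ^ (T.Np - 1) *
        Real.exp (-((T.Np - T.η) * γ)) - (1 - Real.exp (-(T.η * γ))) ^ (T.Np - 1)) with hf'
  have hN := T.Np_pos'
  have hη := T.η_pos
  have hder : ∀ x : ℝ, 0 < x → HasDerivAt f (f' x) x := fun x hx => T.fadingCDF_sub_hasDerivAt hx
  -- Once negative, the derivative never becomes positive again. Divided by `(η x)^(N-1)`, the
  -- bracket compares `exp(-(N - η) x)` with `ψ(x)^(N-1)`, where `ψ(x) = (1 - exp(-η x)) / (η x)`.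
  -- Raising to the power `b / a` carries the exponential exactly from `a` to `b`, while by
  -- `one_sub_exp_neg_div_rpow_le` it sends `ψ(a)` to at most `ψ(b)`.
  have hsign : ∀ a b : ℝ, 0 < a → a ≤ b → f' a < 0 → f' b ≤ 0 := by
    intro a b ha hab hneg
    have hb : 0 < b := lt_of_lt_of_le ha hab
    have hpos : ∀ x : ℝ, 0 < T.Np * T.η * Real.exp (-(T.η * x)) := fun x => by positivity
    have hψ : ∀ x : ℝ, 0 < x → 0 < (1 - Real.exp (-(T.η * x))) / (T.η * x) := by
      intro x hx
      have : Real.exp (-(T.η * x)) < 1 := Real.exp_lt_one_iff.2 (neg_neg_of_pos (by positivity))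
      have : 0 < 1 - Real.exp (-(T.η * x)) := by linarith
      positivity
    have hiff : ∀ x : ℝ, 0 < x → (T.η * x) ^ (T.Np - 1) *
        Real.exp (-((T.Np - T.η) * x)) - (1 - Real.exp (-(T.η * x))) ^ (T.Np - 1) =
        (T.η * x) ^ (T.Np - 1) * (Real.exp (-((T.Np - T.η) * x)) -
          ((1 - Real.exp (-(T.η * x))) / (T.η * x)) ^ (T.Np - 1)) := by
      intro x hx
      have : T.η * x ≠ 0 := by positivity
      rw [div_pow]
      field_simp
    have h1 : Real.exp (-((T.Np - T.η) * a)) <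
        ((1 - Real.exp (-(T.η * a))) / (T.η * a)) ^ (T.Np - 1) := by
      have h := hneg
      simp only [hf'] at h
      rw [hiff a ha] at h
      have h2 : 0 < (T.η * a) ^ (T.Np - 1) := by positivity
      have h3 := neg_of_mul_neg_right h (hpos a).le
      have h4 := neg_of_mul_neg_right h3 h2.le
      linarith
    have h2 : Real.exp (-((T.Np - T.η) * b)) ≤
        ((1 - Real.exp (-(T.η * b))) / (T.η * b)) ^ (T.Np - 1) := by
      have e1 : Real.exp (-((T.Np - T.η) * b)) = Real.exp (-((T.Np - T.η) * a)) ^ (b / a) := by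
        rw [← Real.exp_mul]
        congr 1
        field_simp
      have e2 : b / a = T.η * b / (T.η * a) := by field_simp
      calc Real.exp (-((T.Np - T.η) * b))
          = Real.exp (-((T.Np - T.η) * a)) ^ (b / a) := e1
        _ ≤ (((1 - Real.exp (-(T.η * a))) / (T.η * a)) ^ (T.Np - 1)) ^ (b / a) :=
            Real.rpow_le_rpow (Real.exp_pos _).le h1.le (by positivity)
        _ = (((1 - Real.exp (-(T.η * a))) / (T.η * a)) ^ (b / a)) ^ (T.Np - 1) := by
            rw [← Real.rpow_natCast, ← Real.rpow_natCast, ← Real.rpow_mul (hψ a ha).le,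
              ← Real.rpow_mul (hψ a ha).le, mul_comm (b / a)]
        _ ≤ _ := by
            refine pow_le_pow_left₀ (Real.rpow_nonneg (hψ a ha).le _) ?_ _
            rw [e2]
            exact one_sub_exp_neg_div_rpow_le (by positivity) (by gcongr)
    simp only [hf']
    rw [hiff b hb]
    refine mul_nonpos_of_nonneg_of_nonpos (hpos b).le
      (mul_nonpos_of_nonneg_of_nonpos (by positivity) (by linarith))
  have hf0 : f 0 = 0 := by
    simp only [hf, mul_zero, neg_zero, Real.exp_zero, sub_self]
    rw [T.fadingCDF_eq_integral le_rfl, zero_pow T.Np_pos.ne']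
    simp
  have hlim : Tendsto f atTop (𝓝 0) := by
    have := T.isProbabilityMeasure_fading
    have h1 : Tendsto T.fadingCDF atTop (𝓝 1) := by
      rw [funext T.fadingCDF_eq_cdf]
      exact tendsto_cdf_atTop _
    have h2 : Tendsto (fun x : ℝ => Real.exp (-(T.η * x))) atTop (𝓝 0) :=
      Real.tendsto_exp_neg_atTop_nhds_zero.comp (tendsto_id.const_mul_atTop hη)
    have h3 := h1.sub ((h2.const_sub 1).pow T.Np)
    simpa using h3
  by_contra hcon
  have hneg : f γ < 0 := by
    simp only [hf]
    linarith [not_le.1 hcon]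
  have hγ0 : 0 < γ := by
    rcases eq_or_lt_of_le hγ with h | h
    · rw [← h, hf0] at hneg
      exact absurd hneg (lt_irrefl _)
    · exact h
  have hcont0 : ContinuousOn f (Set.Icc 0 γ) := by
    have hc : Continuous fun y : ℝ => (∫ x in (0 : ℝ)..y,
        T.Np * T.η ^ T.Np * (x ^ (T.Np - 1) * Real.exp (-(T.Np * x)))) -
        (1 - Real.exp (-(T.η * y))) ^ T.Np := by
      refine Continuous.sub ?_ (by fun_prop)
      exact intervalIntegral.continuous_primitive
        (fun a b => Continuous.intervalIntegrable (by fun_prop) a b) 0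
    refine hc.continuousOn.congr fun y hy => ?_
    simp only [hf]
    rw [T.fadingCDF_eq_integral hy.1]
  -- A negative value at `γ` forces a negative slope somewhere before `γ`, hence `f` is
  -- nonincreasing from `γ` on and cannot return to its limit `0`.
  obtain ⟨a, ha, hae⟩ := exists_hasDerivAt_eq_slope f f' hγ0 hcont0 fun x hx => hder x hx.1
  have hfa : f' a < 0 := by
    rw [hae, hf0, sub_zero, sub_zero]
    exact div_neg_of_neg_of_pos hneg hγ0
  have hanti : AntitoneOn f (Set.Ici γ) := by
    refine antitoneOn_of_deriv_nonpos (convex_Ici γ) (fun x hx => ?_) (fun x hx => ?_) fun x hx => ?_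
    · exact (hder x (lt_of_lt_of_le hγ0 hx)).continuousAt.continuousWithinAt
    · rw [interior_Ici] at hx
      exact (hder x (hγ0.trans hx)).differentiableAt.differentiableWithinAt
    · rw [interior_Ici] at hx
      rw [(hder x (hγ0.trans hx)).deriv]
      exact hsign a x ha.1 (ha.2.le.trans (le_of_lt hx)) hfa
  have : (0 : ℝ) ≤ f γ := by
    refine le_of_tendsto hlim ?_
    filter_upwards [eventually_ge_atTop γ] with x hx
    exact hanti (Set.self_mem_Ici) hx hx
  linarith

theorem replacement_mem_Icc {γ : ℝ} (hγ : 0 ≤ γ) :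
    (1 - Real.exp (-(T.η * γ))) ^ T.Np ∈ Set.Icc (0 : ℝ) 1 := by
  have hη := T.η_pos
  have h1 : Real.exp (-(T.η * γ)) ≤ 1 := Real.exp_le_one_iff.2 (neg_nonpos.2 (by positivity))
  have h2 := Real.exp_pos (-(T.η * γ))
  have h3 : 0 ≤ 1 - Real.exp (-(T.η * γ)) := by linarith
  exact ⟨by positivity, pow_le_one₀ h3 (by linarith)⟩

theorem fadingCDF_sub_le_gammaGap {γ : ℝ} (hγ : 0 ≤ γ) :
    T.fadingCDF γ - (1 - Real.exp (-(T.η * γ))) ^ T.Np ≤ T.gammaGap := by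
  refine (le_abs_self _).trans ?_
  refine le_ciSup (f := fun γ : ℝ≥0 => |(gammaMeasure T.Np T.Np).real (Set.Iio (γ : ℝ))
    - (1 - Real.exp (-(T.η * γ))) ^ T.Np|) ⟨1, ?_⟩ ⟨γ, hγ⟩
  rintro _ ⟨x, rfl⟩
  have h1 := T.replacement_mem_Icc (NNReal.coe_nonneg x)
  have h2 := T.fadingCDF_nonneg x
  have h3 := T.fadingCDF_le_one x
  rw [fadingCDF] at h2 h3
  exact abs_le.2 ⟨by linarith [h1.2], by linarith [h1.1]⟩

theorem fadingCDF_of_Np_eq_one (h : T.Np = 1) {γ : ℝ} (hγ : 0 ≤ γ) :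
    T.fadingCDF γ = (1 - Real.exp (-(T.η * γ))) ^ T.Np := by
  have hη : T.η = 1 := by simp [η, h]
  rw [T.fadingCDF_eq_integral hγ, hη, h]
  simp only [Nat.cast_one, one_mul, pow_one, Nat.sub_self, pow_zero]
  rcases eq_or_lt_of_le hγ with h0 | h0
  · simp [← h0]
  · have := intervalIntegral.integral_comp_neg (a := 0) (b := γ) Real.exp
    rw [this, integral_exp, neg_zero, Real.exp_zero]

theorem gammaGap_of_Np_eq_one (h : T.Np = 1) : T.gammaGap = 0 := by
  unfold gammaGap
  have : ∀ γ : ℝ≥0, |(gammaMeasure T.Np T.Np).real (Set.Iio (γ : ℝ))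
    - (1 - Real.exp (-(T.η * γ))) ^ T.Np| = 0 := by
    intro γ
    have := T.fadingCDF_of_Np_eq_one h γ.2
    rw [fadingCDF] at this
    rw [abs_eq_zero]
    exact sub_eq_zero.2 this
  simp [this]

end Params

end Pico
end

noncomputable section

namespace Pico

variable {Ω : Type*} [MeasurableSpace Ω]

/-! ### Poisson counts -/

theorem hasSum_poisson_pow (r : ℝ≥0) (v : ℝ) :
    HasSum (fun n : ℕ => Real.exp (-r) * r ^ n / n.factorial * v ^ n)
      (Real.exp (-(r * (1 - v)))) := by
  have h := (NormedSpace.expSeries_div_hasSum_exp ((r : ℝ) * v)).mul_left (Real.exp (-r))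
  rw [← Real.exp_eq_exp_ℝ, ← Real.exp_add] at h
  rw [show -(r * (1 - v)) = -(r : ℝ) + r * v by ring]
  refine h.congr_fun fun n => ?_
  rw [mul_pow]
  ring

/-- The weight `n v^(n-1)` belongs to the cell of the distinguished point: `n` choices of that
point, and `n - 1` remaining ones. Shifting the index absorbs the factor `n` into the factorial. -/
theorem hasSum_poisson_mul_pow (r : ℝ≥0) (v : ℝ) :
    HasSum (fun n : ℕ => Real.exp (-r) * r ^ n / n.factorial * (n * v ^ (n - 1)))
      (r * Real.exp (-(r * (1 - v)))) := by
  have h := (hasSum_poisson_pow r v).mul_left (r : ℝ)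
  refine (hasSum_nat_add_iff' 1).1 ?_
  simp only [Finset.range_one, Finset.sum_singleton, CharP.cast_eq_zero, zero_mul, mul_zero,
    sub_zero]
  refine h.congr_fun fun n => ?_
  rw [Nat.factorial_succ, Nat.add_sub_cancel]
  push_cast
  field_simp
  ring

theorem integrable_poisson_pow (r : ℝ≥0) (v : ℝ) :
    Integrable (fun n : ℕ => v ^ n) (poissonMeasure r) := by
  rw [integrable_poissonMeasure_iff]
  refine (hasSum_poisson_pow r |v|).summable.congr fun n => ?_
  rw [norm_pow, Real.norm_eq_abs]

theorem integrable_poisson_mul_pow (r : ℝ≥0) (v : ℝ) :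
    Integrable (fun n : ℕ => (n : ℝ) * v ^ (n - 1)) (poissonMeasure r) := by
  rw [integrable_poissonMeasure_iff]
  refine (hasSum_poisson_mul_pow r |v|).summable.congr fun n => ?_
  rw [norm_mul, norm_pow, Real.norm_natCast, Real.norm_eq_abs]

theorem integral_poisson_pow (r : ℝ≥0) (v : ℝ) :
    ∫ n : ℕ, v ^ n ∂poissonMeasure r = Real.exp (-(r * (1 - v))) := by
  rw [integral_poissonMeasure]
  exact (hasSum_poisson_pow r v).tsum_eq

theorem integral_poisson_mul_pow (r : ℝ≥0) (v : ℝ) :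
    ∫ n : ℕ, (n : ℝ) * v ^ (n - 1) ∂poissonMeasure r = r * Real.exp (-(r * (1 - v))) := by
  rw [integral_poissonMeasure]
  exact (hasSum_poisson_mul_pow r v).tsum_eq

/-- The complement has mass `exp(-r) (1 + r)`, which is at least `1 - r²`. The quadratic order makes
collisions negligible when a fixed mean is spread over many cells. -/
theorem poissonMeasure_two_le (r : ℝ≥0) :
    poissonMeasure r {n : ℕ | 2 ≤ n} ≤ ENNReal.ofReal ((r : ℝ) ^ 2) := by
  have hc : {n : ℕ | 2 ≤ n} = ({0, 1} : Set ℕ)ᶜ := by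
    ext n
    simp only [Set.mem_ofPred_eq, Set.mem_compl_iff, Set.mem_insert_iff, Set.mem_singleton_iff]
    omega
  have h01 : (poissonMeasure r).real ({0, 1} : Set ℕ) = Real.exp (-r) * (1 + r) := by
    rw [show ({0, 1} : Set ℕ) = {0} ∪ {1} by rfl, measureReal_union (by simp) (by simp),
      poissonMeasure_real_singleton, poissonMeasure_real_singleton]
    simp
    ring
  rw [hc, ← ofReal_measureReal, probReal_compl_eq_one_sub (by measurability), h01]
  refine ENNReal.ofReal_le_ofReal ?_
  have h1 := Real.add_one_le_exp (-(r : ℝ))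
  have h2 : (0 : ℝ) ≤ r := r.2
  nlinarith

/-- The number of points in `B`, as a natural number. -/
def ncount (X : ℕ → Ω → Plane) (B : Set Plane) (ω : Ω) : ℕ := (count X B ω).toNat

namespace IsHPPP

variable {P : Measure Ω} {dens : ℝ} {X : ℕ → Ω → Plane}

theorem ae_count_ne_top (h : IsHPPP P dens X) {B : Set Plane} (hB : MeasurableSet B)
    (hB' : volume B ≠ ⊤) : ∀ᵐ ω ∂P, count X B ω ≠ ⊤ := by
  refine ((h.poisson B hB hB').ae_iff (p := fun n => n ≠ ⊤) (measurable_of_countable _)).2 ?_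
  rw [ae_map_iff (by fun_prop) (by measurability)]
  exact Eventually.of_forall fun n => ENat.natCast_ne_top n

theorem hasLaw_ncount (h : IsHPPP P dens X) {B : Set Plane} (hB : MeasurableSet B)
    (hB' : volume B ≠ ⊤) :
    HasLaw (ncount X B) (poissonMeasure (dens * (volume B).toReal).toNNReal) P := by
  refine HasLaw.comp (Y := ENat.toNat) ⟨Measurable.aemeasurable (measurable_of_countable _), ?_⟩
    (h.poisson B hB hB')
  rw [Measure.map_map (measurable_of_countable _) (measurable_of_countable _)]
  convert Measure.map_id
  ext n
  simp

theorem iIndepFun_ncount (h : IsHPPP P dens X) {m : ℕ} (B : Fin m → Set Plane)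
    (hB : ∀ k, MeasurableSet (B k)) (hB' : ∀ k, volume (B k) ≠ ⊤)
    (hd : Pairwise (fun k l => Disjoint (B k) (B l))) :
    iIndepFun (fun k => ncount X (B k)) P :=
  (h.indep m B hB hB' hd).comp (fun _ => ENat.toNat) (fun _ => measurable_of_countable _)

theorem integrable_ncount (h : IsHPPP P dens X) {B : Set Plane} (hB : MeasurableSet B)
    (hB' : volume B ≠ ⊤) : Integrable (fun ω => (ncount X B ω : ℝ)) P := by
  have hl := h.hasLaw_ncount hB hB'
  have h1 : Integrable (fun n : ℕ => (n : ℝ)) (P.map (ncount X B)) := by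
    rw [hl.map_eq]
    simpa using integrable_poisson_mul_pow (dens * (volume B).toReal).toNNReal 1
  exact h1.comp_aemeasurable hl.aemeasurable

theorem ae_not_mem_of_volume_eq_zero (h : IsHPPP P dens X) {B : Set Plane} (hB : MeasurableSet B)
    (hB' : volume B = 0) : ∀ᵐ ω ∂P, ∀ i, X i ω ∉ B := by
  have hB2 : volume B ≠ ⊤ := by simp [hB']
  have hl := h.hasLaw_ncount hB hB2
  have h0 : ∀ᵐ ω ∂P, ncount X B ω = 0 := by
    refine (hl.ae_iff (p := fun n => n = 0) (measurable_of_countable _)).2 ?_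
    rw [hB', ENNReal.toReal_zero, mul_zero, Real.toNNReal_zero, ae_iff,
      show {a : ℕ | ¬ a = 0} = ({0} : Set ℕ)ᶜ by rfl, prob_compl_eq_one_sub (by measurability),
      poissonMeasure_singleton]
    simp
  filter_upwards [h0, h.ae_count_ne_top hB hB2] with ω h1 h2 i hi
  have h3 : count X B ω = 0 := by
    rcases (ENat.toNat_eq_zero).1 h1 with h | h
    · exact h
    · exact absurd h h2
  rw [count, Set.encard_eq_zero] at h3
  exact (Set.eq_empty_iff_forall_notMem.1 h3 i) hi

end IsHPPP

/-- The indices of the points in the closed ball of radius `R`, if there are finitely many. -/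
def ballIdx (R : ℝ) (x : ℕ → Plane) : Finset ℕ := by
  classical exact if h : {i | ‖x i‖ ≤ R}.Finite then h.toFinset else ∅

theorem mem_ballIdx {R : ℝ} {x : ℕ → Plane} (h : {i | ‖x i‖ ≤ R}.Finite) {i : ℕ} :
    i ∈ ballIdx R x ↔ ‖x i‖ ≤ R := by
  simp [ballIdx, h]

/-! ### Annuli of equal area -/

/-- Squared distance relative to the squared radius. -/
def relSq (R : ℝ) (y : Plane) : ℝ := ‖y‖ ^ 2 / R ^ 2

/-- The `k`-th of `m` annuli of equal area in the ball of radius `R`. -/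
def annulus (R : ℝ) (m k : ℕ) : Set Plane :=
  {y | (k : ℝ) / m < relSq R y ∧ relSq R y ≤ ((k : ℝ) + 1) / m}

theorem measurable_relSq (R : ℝ) : Measurable (relSq R) := by
  unfold relSq
  fun_prop

theorem measurableSet_annulus (R : ℝ) (m k : ℕ) : MeasurableSet (annulus R m k) :=
  (measurable_relSq R) measurableSet_Ioc

theorem setOf_relSq_le {R : ℝ} (hR : 0 < R) {a : ℝ} (ha : 0 ≤ a) :
    {y : Plane | relSq R y ≤ a} = Metric.closedBall 0 (R * √a) := by
  ext y
  have h : R * √a = √(R ^ 2 * a) := by rw [Real.sqrt_mul (by positivity), Real.sqrt_sq hR.le]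
  rw [Set.mem_ofPred_eq, mem_closedBall_zero_iff, relSq, div_le_iff₀ (by positivity), h,
    Real.le_sqrt (norm_nonneg y) (by positivity), mul_comm]

theorem volume_relSq_le {R : ℝ} (hR : 0 < R) {a : ℝ} (ha : 0 ≤ a) :
    volume {y : Plane | relSq R y ≤ a} = ENNReal.ofReal (Real.pi * R ^ 2 * a) := by
  rw [setOf_relSq_le hR ha, EuclideanSpace.volume_closedBall_fin_two,
    ← ENNReal.ofReal_pow (by positivity), ← ENNReal.ofReal_mul (by positivity), mul_pow,
    Real.sq_sqrt ha]
  congr 1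
  ring

theorem volume_annulus {R : ℝ} (hR : 0 < R) {m : ℕ} (hm : 0 < m) (k : ℕ) :
    volume (annulus R m k) = ENNReal.ofReal (Real.pi * R ^ 2 / m) := by
  have hm' : (0 : ℝ) < m := by exact_mod_cast hm
  have heq : annulus R m k = {y : Plane | relSq R y ≤ ((k : ℝ) + 1) / m} \
      {y : Plane | relSq R y ≤ (k : ℝ) / m} := by
    ext y
    simp only [annulus, Set.mem_ofPred_eq, Set.mem_sdiff, not_le]
    tauto
  have hsub : {y : Plane | relSq R y ≤ (k : ℝ) / m} ⊆ {y : Plane | relSq R y ≤ ((k : ℝ) + 1) / m} := by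
    intro y (hy : relSq R y ≤ (k : ℝ) / m)
    refine le_trans (b := (k : ℝ) / m) hy ?_
    gcongr
    linarith
  rw [heq, measure_sdiff hsub ((measurable_relSq R) measurableSet_Iic).nullMeasurableSet
    (by rw [volume_relSq_le hR (by positivity)]; exact ENNReal.ofReal_ne_top),
    volume_relSq_le hR (by positivity), volume_relSq_le hR (by positivity),
    ← ENNReal.ofReal_sub _ (by positivity)]
  congr 1
  field_simp
  ring

theorem disjoint_annulus {R : ℝ} {m : ℕ} (hm : 0 < m) {k l : ℕ} (hkl : k ≠ l) :
    Disjoint (annulus R m k) (annulus R m l) := by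
  have hm' : (0 : ℝ) < m := by exact_mod_cast hm
  have key : ∀ {k l : ℕ}, k < l → ∀ y, y ∈ annulus R m k → y ∈ annulus R m l → False := by
    intro k l h y hk hl
    have h1 : ((k : ℝ) + 1) / m ≤ (l : ℝ) / m := by
      gcongr
      exact_mod_cast h
    exact absurd (hk.2.trans h1) (not_le.2 hl.1)
  rw [Set.disjoint_left]
  intro y hk hl
  rcases lt_or_gt_of_ne hkl with h | h
  · exact key h y hk hl
  · exact key h y hl hk

/-- The index of the annulus that contains `y`, among `m + 1`. -/
def annulusIdx (R : ℝ) (m : ℕ) (y : Plane) : Fin (m + 1) :=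
  ⟨min (⌈((m + 1 : ℕ) : ℝ) * relSq R y⌉₊ - 1) m, by omega⟩

/-- In the punctured ball neither the truncated subtraction nor the minimum in `annulusIdx` has any
effect, so the outer rim of the annulus is given by the ceiling. -/
theorem annulusIdx_val {R : ℝ} (m : ℕ) {y : Plane} (h0 : 0 < relSq R y) (h1 : relSq R y ≤ 1) :
    ((annulusIdx R m y : ℕ) : ℝ) + 1 = ⌈((m + 1 : ℕ) : ℝ) * relSq R y⌉₊ := by
  have hpos : 0 < ⌈((m + 1 : ℕ) : ℝ) * relSq R y⌉₊ := Nat.ceil_pos.2 (by positivity)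
  have hle : ⌈((m + 1 : ℕ) : ℝ) * relSq R y⌉₊ ≤ m + 1 := by
    rw [Nat.ceil_le]
    exact mul_le_of_le_one_right (by positivity) h1
  simp only [annulusIdx]
  have : min (⌈((m + 1 : ℕ) : ℝ) * relSq R y⌉₊ - 1) m + 1 = ⌈((m + 1 : ℕ) : ℝ) * relSq R y⌉₊ := by
    omega
  exact_mod_cast this

theorem mem_annulus_iff {R : ℝ} (m : ℕ) {y : Plane} (h0 : 0 < relSq R y) (h1 : relSq R y ≤ 1)
    (k : Fin (m + 1)) : y ∈ annulus R (m + 1) k ↔ annulusIdx R m y = k := by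
  have hm' : (0 : ℝ) < (m + 1 : ℕ) := by positivity
  have hv : (annulusIdx R m y : ℕ) + 1 = ⌈((m + 1 : ℕ) : ℝ) * relSq R y⌉₊ := by
    exact_mod_cast annulusIdx_val m h0 h1
  rw [annulus, Set.mem_ofPred_eq, div_lt_iff₀ hm', le_div_iff₀ hm', Fin.ext_iff]
  have : (annulusIdx R m y : ℕ) = k ↔ ⌈((m + 1 : ℕ) : ℝ) * relSq R y⌉₊ = (k : ℕ) + 1 := by
    rw [← hv]
    omega
  rw [this, Nat.ceil_eq_iff (by omega)]
  push_cast
  rw [mul_comm]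

theorem tendsto_annulusIdx {R : ℝ} {y : Plane} (h0 : 0 < relSq R y) (h1 : relSq R y ≤ 1) :
    Tendsto (fun m : ℕ => (((annulusIdx R m y : ℕ) : ℝ) + 1) / ((m + 1 : ℕ) : ℝ)) atTop
      (𝓝 (relSq R y)) := by
  have hc : Tendsto (fun m : ℕ => ((m + 1 : ℕ) : ℝ)) atTop atTop :=
    tendsto_natCast_atTop_atTop.comp (tendsto_add_atTop_nat 1)
  refine ((tendsto_nat_ceil_mul_div_atTop h0.le).comp hc).congr fun m => ?_
  simp only [Function.comp_apply]
  rw [annulusIdx_val m h0 h1, mul_comm]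

theorem annulusIdx_mem_Ioc (m : ℕ) (k : Fin (m + 1)) :
    (((k : ℕ) : ℝ) + 1) / ((m + 1 : ℕ) : ℝ) ∈ Set.Ioc (0 : ℝ) 1 := by
  refine ⟨by positivity, ?_⟩
  rw [div_le_one (by positivity)]
  have := k.2
  exact_mod_cast this

theorem relSq_pos {R : ℝ} (hR : 0 < R) {y : Plane} (hy : y ≠ 0) : 0 < relSq R y := by
  have := norm_pos_iff.2 hy
  unfold relSq
  positivity

theorem relSq_le_one_iff {R : ℝ} (hR : 0 < R) {y : Plane} : relSq R y ≤ 1 ↔ ‖y‖ ≤ R := by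
  unfold relSq
  rw [div_le_one (by positivity), sq_le_sq₀ (norm_nonneg y) hR.le]

end Pico
end

noncomputable section

namespace Pico

/-! ### Sums over the points of a Poisson process -/

/-- Points are grouped by cell. The distinguished point of cell `k` can be chosen in as many ways as
the cell has points, and its own cell then loses one. The outcome is a product over cells of
functions of their counts, to which independence applies. -/
theorem sum_prod_erase_eq {κ : Type*} [Fintype κ] [DecidableEq κ] (A : Finset ℕ) (t : ℕ → κ)
    (f : κ → ℝ) (v : κ → κ → ℝ) :
    ∑ i ∈ A, f (t i) * ∏ j ∈ A.erase i, v (t i) (t j) =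
      ∑ k, f k * ∏ l, if l = k then
        ((A.filter (t · = l)).card : ℝ) * v k l ^ ((A.filter (t · = l)).card - 1)
        else v k l ^ (A.filter (t · = l)).card := by
  rw [← Finset.sum_fiberwise_of_maps_to (s := A) (t := Finset.univ) (g := t)
    (fun _ _ => Finset.mem_univ _)]
  refine Finset.sum_congr rfl fun k _ => ?_
  have hterm : ∀ i ∈ A.filter (t · = k), f (t i) * ∏ j ∈ A.erase i, v (t i) (t j) =
      f k * ∏ l, if l = k then v k l ^ ((A.filter (t · = l)).card - 1)
        else v k l ^ (A.filter (t · = l)).card := by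
    intro i hi
    obtain ⟨hiA, hik⟩ := Finset.mem_filter.1 hi
    rw [hik, ← Finset.prod_fiberwise_of_maps_to (s := A.erase i) (t := Finset.univ) (g := t)
      (fun _ _ => Finset.mem_univ _)]
    congr 1
    refine Finset.prod_congr rfl fun l _ => ?_
    have hconst : ∏ j ∈ (A.erase i).filter (t · = l), v k (t j) =
        v k l ^ ((A.erase i).filter (t · = l)).card := by
      rw [← Finset.prod_const]
      exact Finset.prod_congr rfl fun j hj => by rw [(Finset.mem_filter.1 hj).2]
    rw [hconst, Finset.filter_erase]
    split_ifs with hl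
    · rw [Finset.card_erase_of_mem (by rw [hl]; exact hi)]
    · rw [Finset.erase_eq_of_notMem]
      intro hmem
      exact hl ((Finset.mem_filter.1 hmem).2.symm.trans hik)
  rw [Finset.sum_congr rfl hterm, Finset.sum_const, nsmul_eq_mul]
  have hsplit : ∀ g : κ → ℝ, ∏ l, g l = g k * ∏ l ∈ Finset.univ.erase k, g l := fun g =>
    (Finset.mul_prod_erase Finset.univ g (Finset.mem_univ k)).symm
  rw [hsplit, hsplit]
  simp only [if_true]
  have : ∏ l ∈ Finset.univ.erase k, (if l = k then v k l ^ ((A.filter (t · = l)).card - 1)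
        else v k l ^ (A.filter (t · = l)).card) =
      ∏ l ∈ Finset.univ.erase k, if l = k then
        ((A.filter (t · = l)).card : ℝ) * v k l ^ ((A.filter (t · = l)).card - 1)
        else v k l ^ (A.filter (t · = l)).card := by
    refine Finset.prod_congr rfl fun l hl => ?_
    rw [if_neg (Finset.ne_of_mem_erase hl), if_neg (Finset.ne_of_mem_erase hl)]
  rw [this]
  ring

/-- Configurations with finitely many points in the ball, all at different positive distances. -/
structure Regular (R : ℝ) (x : ℕ → Plane) : Prop where
  finite : {i | ‖x i‖ ≤ R}.Finite
  ne_zero : ∀ i, x i ≠ 0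
  inj : ∀ i j, ‖x i‖ ≤ R → ‖x j‖ ≤ R → ‖x i‖ = ‖x j‖ → i = j

theorem ncount_annulus {Ω : Type*} {X : ℕ → Ω → Plane} {R : ℝ} (hR : 0 < R) {ω : Ω}
    (hfin : {i | ‖X i ω‖ ≤ R}.Finite) (hne : ∀ i, X i ω ≠ 0) (m : ℕ) (k : Fin (m + 1)) :
    ncount X (annulus R (m + 1) k) ω =
      ((ballIdx R fun i => X i ω).filter fun i => annulusIdx R m (X i ω) = k).card := by
  have hset : {i | X i ω ∈ annulus R (m + 1) k} =
      (((ballIdx R fun i => X i ω).filter fun i => annulusIdx R m (X i ω) = k : Finset ℕ) :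
        Set ℕ) := by
    ext i
    rw [Finset.coe_filter, Set.mem_ofPred_eq, Set.mem_ofPred_eq, mem_ballIdx hfin]
    have h0 := relSq_pos hR (hne i)
    constructor
    · intro hi
      have h1 : relSq R (X i ω) ≤ 1 := hi.2.trans (annulusIdx_mem_Ioc m k).2
      exact ⟨(relSq_le_one_iff hR).1 h1, (mem_annulus_iff m h0 h1 k).1 hi⟩
    · rintro ⟨h1, h2⟩
      exact (mem_annulus_iff m h0 ((relSq_le_one_iff hR).2 h1) k).2 h2
  rw [ncount, count, hset, Set.encard_coe_eq_coe_finsetCard, ENat.toNat_natCast]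

variable {Ω : Type*} [MeasurableSpace Ω]

namespace IsHPPP

variable {P : Measure Ω} {dens : ℝ} {X : ℕ → Ω → Plane}

theorem ae_finite (h : IsHPPP P dens X) (R : ℝ) : ∀ᵐ ω ∂P, {i | ‖X i ω‖ ≤ R}.Finite := by
  have hv : volume (Metric.closedBall (0 : Plane) R) ≠ ⊤ := measure_closedBall_lt_top.ne
  filter_upwards [h.ae_count_ne_top Metric.isClosed_closedBall.measurableSet hv] with ω hω
  rw [count, Set.encard_ne_top_iff] at hω
  simpa using hω

theorem ae_ne_zero (h : IsHPPP P dens X) : ∀ᵐ ω ∂P, ∀ i, X i ω ≠ 0 := by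
  filter_upwards [h.ae_not_mem_of_volume_eq_zero (B := {0}) (measurableSet_singleton 0)
    (measure_singleton 0)] with ω hω i
  simpa using hω i

theorem volume_annulus_ne_top {R : ℝ} (hR : 0 < R) (m : ℕ) (k : Fin (m + 1)) :
    volume (annulus R (m + 1) k) ≠ ⊤ := by
  rw [volume_annulus hR (Nat.succ_pos m)]
  exact ENNReal.ofReal_ne_top

theorem hasLaw_ncount_annulus (h : IsHPPP P dens X) {R : ℝ} (hR : 0 < R) (m : ℕ)
    (k : Fin (m + 1)) :
    HasLaw (ncount X (annulus R (m + 1) k))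
      (poissonMeasure (Real.pi * dens * R ^ 2 / ((m + 1 : ℕ) : ℝ)).toNNReal) P := by
  have := h.hasLaw_ncount (measurableSet_annulus R (m + 1) k) (volume_annulus_ne_top hR m k)
  rw [volume_annulus hR (Nat.succ_pos m), ENNReal.toReal_ofReal (by positivity)] at this
  convert this using 3
  ring

/-- Two points at equal distance share an annulus in every partition. With `m + 1` cells of mean `μ
/ (m + 1)`, some cell holds two points with probability at most `μ² / (m + 1)`, which tends to `0`.
-/
theorem ae_regular [IsProbabilityMeasure P] (h : IsHPPP P dens X) {R : ℝ} (hR : 0 < R) :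
    ∀ᵐ ω ∂P, Regular R fun i => X i ω := by
  set bad : Set Ω := {ω | {i | ‖X i ω‖ ≤ R}.Finite ∧ (∀ i, X i ω ≠ 0) ∧
    ∃ i j, ‖X i ω‖ ≤ R ∧ ‖X j ω‖ ≤ R ∧ ‖X i ω‖ = ‖X j ω‖ ∧ i ≠ j} with hbad
  set μ : ℝ := Real.pi * dens * R ^ 2 with hμ
  have hle : ∀ m : ℕ, P bad ≤ ENNReal.ofReal (μ ^ 2 / ((m + 1 : ℕ) : ℝ)) := by
    intro m
    have hsub : bad ⊆ ⋃ k : Fin (m + 1), {ω | 2 ≤ ncount X (annulus R (m + 1) k) ω} := by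
      rintro ω ⟨hfin, hne, i, j, hi, hj, hij, hneq⟩
      refine Set.mem_iUnion.2 ⟨annulusIdx R m (X i ω), ?_⟩
      rw [Set.mem_ofPred_eq, ncount_annulus hR hfin hne]
      refine Finset.one_lt_card.2 ⟨i, ?_, j, ?_, hneq⟩
      · simp [mem_ballIdx hfin, hi]
      · have : annulusIdx R m (X j ω) = annulusIdx R m (X i ω) := by
          simp only [annulusIdx, relSq, hij]
        simp [mem_ballIdx hfin, hj, this]
    calc P bad ≤ ∑ k : Fin (m + 1), P {ω | 2 ≤ ncount X (annulus R (m + 1) k) ω} :=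
          (measure_mono hsub).trans (measure_iUnion_fintype_le _ _)
      _ ≤ ∑ _k : Fin (m + 1), ENNReal.ofReal ((μ / ((m + 1 : ℕ) : ℝ)) ^ 2) := by
          refine Finset.sum_le_sum fun k _ => ?_
          rw [(h.hasLaw_ncount_annulus hR m k).measure_eq (p := fun n => 2 ≤ n) (by measurability)]
          refine (poissonMeasure_two_le _).trans (ENNReal.ofReal_le_ofReal ?_)
          rw [Real.coe_toNNReal']
          rcases le_total 0 (μ / ((m + 1 : ℕ) : ℝ)) with h0 | h0
          · rw [max_eq_left h0]
          · rw [max_eq_right h0, zero_pow two_ne_zero]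
            positivity
      _ = ENNReal.ofReal (μ ^ 2 / ((m + 1 : ℕ) : ℝ)) := by
          rw [Finset.sum_const, Finset.card_univ, Fintype.card_fin, nsmul_eq_mul,
            ← ENNReal.ofReal_natCast, ← ENNReal.ofReal_mul (by positivity)]
          congr 1
          field_simp
  have hzero : P bad = 0 := by
    have hlim : Tendsto (fun m : ℕ => ENNReal.ofReal (μ ^ 2 / ((m + 1 : ℕ) : ℝ))) atTop (𝓝 0) := by
      rw [← ENNReal.ofReal_zero]
      refine ENNReal.tendsto_ofReal ?_
      exact (tendsto_natCast_atTop_atTop.comp (tendsto_add_atTop_nat 1)).const_div_atTop _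
    exact le_antisymm (ge_of_tendsto' hlim hle) zero_le
  have hnot : ∀ᵐ ω ∂P, ω ∉ bad := measure_eq_zero_iff_ae_notMem.1 hzero
  filter_upwards [h.ae_finite R, h.ae_ne_zero, hnot] with ω h1 h2 h3
  refine ⟨h1, h2, fun i j hi hj hij => ?_⟩
  by_contra hne
  exact h3 ⟨h1, h2, i, j, hi, hj, hij, hne⟩

/-- The sum over the points in the ball, at the relative squared distances `t`. -/
def pointSum (f : ℝ → ℝ) (v : ℝ → ℝ → ℝ) (A : Finset ℕ) (t : ℕ → ℝ) : ℝ :=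
  ∑ i ∈ A, f (t i) * ∏ j ∈ A.erase i, v (t i) (t j)

theorem abs_pointSum_le {f : ℝ → ℝ} {v : ℝ → ℝ → ℝ} {C : ℝ}
    (hf : ∀ t ∈ Set.Ioc (0 : ℝ) 1, |f t| ≤ C)
    (hv : ∀ s ∈ Set.Ioc (0 : ℝ) 1, ∀ t ∈ Set.Ioc (0 : ℝ) 1, v s t ∈ Set.Icc (0 : ℝ) 1)
    {A : Finset ℕ} {t : ℕ → ℝ} (ht : ∀ i ∈ A, t i ∈ Set.Ioc (0 : ℝ) 1) :
    |pointSum f v A t| ≤ A.card * C := by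
  refine (Finset.abs_sum_le_sum_abs _ _).trans ?_
  refine (Finset.sum_le_card_nsmul _ _ C fun i hi => ?_).trans (by rw [nsmul_eq_mul])
  rw [abs_mul, Finset.abs_prod]
  have h1 : ∏ j ∈ A.erase i, |v (t i) (t j)| ≤ 1 := by
    refine Finset.prod_le_one (fun _ _ => abs_nonneg _) fun j hj => ?_
    have := hv _ (ht i hi) _ (ht j (Finset.mem_of_mem_erase hj))
    rw [abs_of_nonneg this.1]
    exact this.2
  calc _ ≤ |f (t i)| * 1 := mul_le_mul_of_nonneg_left h1 (abs_nonneg _)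
    _ ≤ C := by rw [mul_one]; exact hf _ (ht i hi)

/-- Independence of the counts reduces the mean to Poisson generating functions; the distinguished
cell contributes its mean number of points as an extra factor. -/
theorem integral_prod_ncount (h : IsHPPP P dens X) [IsProbabilityMeasure P] (hd : 0 < dens)
    {R : ℝ} (hR : 0 < R) (m : ℕ) (w : Fin (m + 1) → ℝ) (k : Fin (m + 1)) :
    Integrable (fun ω => ∏ l, if l = k then (ncount X (annulus R (m + 1) l) ω : ℝ) *
      w l ^ (ncount X (annulus R (m + 1) l) ω - 1) else w l ^ ncount X (annulus R (m + 1) l) ω) P ∧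
    ∫ ω, (∏ l, if l = k then (ncount X (annulus R (m + 1) l) ω : ℝ) *
      w l ^ (ncount X (annulus R (m + 1) l) ω - 1) else w l ^ ncount X (annulus R (m + 1) l) ω) ∂P =
    Real.pi * dens * R ^ 2 / ((m + 1 : ℕ) : ℝ) *
      Real.exp (-(Real.pi * dens * R ^ 2 *
        ((∑ l, (1 - w l)) / ((m + 1 : ℕ) : ℝ)))) := by
  set r : ℝ≥0 := (Real.pi * dens * R ^ 2 / ((m + 1 : ℕ) : ℝ)).toNNReal with hr
  have hrc : (r : ℝ) = Real.pi * dens * R ^ 2 / ((m + 1 : ℕ) : ℝ) :=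
    Real.coe_toNNReal _ (by positivity)
  set F : Fin (m + 1) → ℕ → ℝ := fun l n => if l = k then (n : ℝ) * w l ^ (n - 1) else w l ^ n
    with hF
  have hind := h.iIndepFun_ncount (fun l : Fin (m + 1) => annulus R (m + 1) l)
    (fun l => measurableSet_annulus R (m + 1) l) (fun l => volume_annulus_ne_top hR m l)
    (fun k l hkl => disjoint_annulus (Nat.succ_pos m) (fun hh => hkl (Fin.ext hh)))
  have hlaw := fun l : Fin (m + 1) => h.hasLaw_ncount_annulus hR m l
  have hFi : ∀ l, Integrable (F l) (poissonMeasure r) := by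
    intro l
    simp only [hF]
    split_ifs
    · exact integrable_poisson_mul_pow r (w l)
    · exact integrable_poisson_pow r (w l)
  have hFv : ∀ l, ∫ n, F l n ∂poissonMeasure r =
      (if l = k then (r : ℝ) else 1) * Real.exp (-(r * (1 - w l))) := by
    intro l
    simp only [hF]
    split_ifs
    · exact integral_poisson_mul_pow r (w l)
    · rw [one_mul]
      exact integral_poisson_pow r (w l)
  have hmF : ∀ l, Measurable (F l) := fun l => measurable_of_countable _
  constructor
  · have hmap := hind.map_fun_eq_pi_map (fun l => (hlaw l).aemeasurable)
    have hpi : Integrable (fun n : Fin (m + 1) → ℕ => ∏ l, F l (n l))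
        (Measure.pi fun l => P.map (ncount X (annulus R (m + 1) l))) := by
      have : ∀ l : Fin (m + 1), IsProbabilityMeasure (P.map (ncount X (annulus R (m + 1) l))) := fun l =>
        Measure.isProbabilityMeasure_map (hlaw l).aemeasurable
      refine Integrable.fintype_prod fun l => ?_
      rw [(hlaw l).map_eq]
      exact hFi l
    rw [← hmap] at hpi
    exact hpi.comp_aemeasurable (aemeasurable_pi_lambda _ fun l => (hlaw l).aemeasurable)
  · have h1 := hind.integral_fun_prod_comp (f := F) (fun l => (hlaw l).aemeasurable)
      (fun l => (hmF l).aestronglyMeasurable)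
    have h2 : ∀ l, ∫ ω, F l (ncount X (annulus R (m + 1) l) ω) ∂P =
        (if l = k then (r : ℝ) else 1) * Real.exp (-(r * (1 - w l))) := by
      intro l
      rw [← hFv l]
      exact (hlaw l).integral_comp (hmF l).aestronglyMeasurable
    simp only [hF] at h1 h2
    rw [h1, Finset.prod_congr rfl fun l _ => h2 l, Finset.prod_mul_distrib, ← Real.exp_sum,
      Finset.prod_ite_eq' Finset.univ k, if_pos (Finset.mem_univ k), hrc]
    congr 2
    rw [Finset.sum_neg_distrib, ← Finset.mul_sum]
    ring

/-- Campbell–Mecke formula for a multiplicative functional of the other points, at radially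
symmetric functions. -/
theorem integral_pointSum (h : IsHPPP P dens X) [IsProbabilityMeasure P] (hd : 0 < dens)
    {R : ℝ} (hR : 0 < R) {f : ℝ → ℝ} {v : ℝ → ℝ → ℝ} {C : ℝ}
    (hf : ∀ t ∈ Set.Ioc (0 : ℝ) 1, |f t| ≤ C)
    (hv : ∀ s ∈ Set.Ioc (0 : ℝ) 1, ∀ t ∈ Set.Ioc (0 : ℝ) 1, v s t ∈ Set.Icc (0 : ℝ) 1)
    (hfc : ∀ t ∈ Set.Ioc (0 : ℝ) 1, ContinuousAt f t)
    (hvc : ∀ s ∈ Set.Ioc (0 : ℝ) 1, ∀ t ∈ Set.Ioc (0 : ℝ) 1, s ≠ t →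
      ContinuousAt (fun z : ℝ × ℝ => v z.1 z.2) (s, t)) :
    Integrable (fun ω => pointSum f v (ballIdx R fun i => X i ω) fun i => relSq R (X i ω)) P ∧
    ∫ ω, pointSum f v (ballIdx R fun i => X i ω) (fun i => relSq R (X i ω)) ∂P =
      ∫ t in (0 : ℝ)..1, Real.pi * dens * R ^ 2 * f t *
        Real.exp (-(Real.pi * dens * R ^ 2 * ∫ t' in (0 : ℝ)..1, (1 - v t t'))) := by
  set μ : ℝ := Real.pi * dens * R ^ 2 with hμ
  have hμ0 : 0 < μ := by positivity
  have hC : 0 ≤ C := (abs_nonneg _).trans (hf 1 ⟨one_pos, le_rfl⟩)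
  set tm : (m : ℕ) → Fin (m + 1) → ℝ := fun m k => (((k : ℕ) : ℝ) + 1) / ((m + 1 : ℕ) : ℝ) with htm
  have htm01 : ∀ m k, tm m k ∈ Set.Ioc (0 : ℝ) 1 := annulusIdx_mem_Ioc
  -- Each point is moved to the outer rim of its annulus, after which the sum depends on the
  -- locations only through the counts.
  set S : ℕ → Ω → ℝ := fun m ω => pointSum f v (ballIdx R fun i => X i ω)
    fun i => tm m (annulusIdx R m (X i ω)) with hS
  have hball : volume (Metric.closedBall (0 : Plane) R) ≠ ⊤ := measure_closedBall_lt_top.ne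
  have hcard : ∀ᵐ ω ∂P, ((ballIdx R fun i => X i ω).card : ℝ) =
      ncount X (Metric.closedBall 0 R) ω := by
    filter_upwards [h.ae_finite R] with ω hω
    rw [ncount, count]
    have : {i | X i ω ∈ Metric.closedBall 0 R} = ((ballIdx R fun i => X i ω : Finset ℕ) : Set ℕ) := by
      ext i
      simp [mem_ballIdx hω]
    rw [this, Set.encard_coe_eq_coe_finsetCard, ENat.toNat_natCast]
  have hbd_int : Integrable (fun ω => (ncount X (Metric.closedBall 0 R) ω : ℝ) * C) P :=
    (h.integrable_ncount Metric.isClosed_closedBall.measurableSet hball).mul_const C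
  have hSe : ∀ m, S m =ᵐ[P] fun ω => ∑ k, f (tm m k) * ∏ l,
      if l = k then (ncount X (annulus R (m + 1) l) ω : ℝ) *
        v (tm m k) (tm m l) ^ (ncount X (annulus R (m + 1) l) ω - 1)
      else v (tm m k) (tm m l) ^ ncount X (annulus R (m + 1) l) ω := by
    intro m
    filter_upwards [h.ae_finite R, h.ae_ne_zero] with ω h1 h2
    simp only [hS, pointSum, ncount_annulus hR h1 h2]
    exact sum_prod_erase_eq (ballIdx R fun i => X i ω) (fun i => annulusIdx R m (X i ω))
      (fun k => f (tm m k)) (fun k l => v (tm m k) (tm m l))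
  have hterm := fun m k => h.integral_prod_ncount hd hR m (fun l => v (tm m k) (tm m l)) k
  have hSint : ∀ m, Integrable (S m) P := by
    intro m
    refine Integrable.congr ?_ (hSe m).symm
    exact integrable_finsetSum _ fun k _ => ((hterm m k).1).const_mul _
  have hSval : ∀ m, ∫ ω, S m ω ∂P = (∑ k ∈ Finset.range (m + 1),
      μ * f ((k + 1) / ((m + 1 : ℕ) : ℝ)) * Real.exp (-(μ * ((∑ l ∈ Finset.range (m + 1),
        (1 - v ((k + 1) / ((m + 1 : ℕ) : ℝ)) ((l + 1) / ((m + 1 : ℕ) : ℝ)))) /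
          ((m + 1 : ℕ) : ℝ))))) / ((m + 1 : ℕ) : ℝ) := by
    intro m
    rw [integral_congr_ae (hSe m), integral_finsetSum _ fun k _ => ((hterm m k).1).const_mul _,
      Finset.sum_div, Finset.sum_range]
    refine Finset.sum_congr rfl fun k _ => ?_
    rw [integral_const_mul, (hterm m k).2, Finset.sum_range]
    simp only [htm]
    ring
  -- Almost surely all points of the ball have different distances, so `v` is needed only off the
  -- diagonal, exactly where it is assumed continuous.
  have hpt : ∀ᵐ ω ∂P, Tendsto (fun m => S m ω) atTop
      (𝓝 (pointSum f v (ballIdx R fun i => X i ω) fun i => relSq R (X i ω))) := by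
    filter_upwards [h.ae_regular hR] with ω hω
    have hmem : ∀ i ∈ ballIdx R (fun i => X i ω), relSq R (X i ω) ∈ Set.Ioc (0 : ℝ) 1 := fun i hi =>
      ⟨relSq_pos hR (hω.ne_zero i), (relSq_le_one_iff hR).2 ((mem_ballIdx hω.finite).1 hi)⟩
    have htend : ∀ i ∈ ballIdx R (fun i => X i ω), Tendsto
        (fun m => tm m (annulusIdx R m (X i ω))) atTop (𝓝 (relSq R (X i ω))) := fun i hi =>
      tendsto_annulusIdx (hmem i hi).1 (hmem i hi).2
    simp only [hS, pointSum]
    refine tendsto_finsetSum _ fun i hi => ?_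
    refine ((hfc _ (hmem i hi)).tendsto.comp (htend i hi)).mul (tendsto_finsetProd _ fun j hj => ?_)
    obtain ⟨hji, hjA⟩ := Finset.mem_erase.1 hj
    have hne : relSq R (X i ω) ≠ relSq R (X j ω) := by
      intro he
      have h1 : ‖X i ω‖ ^ 2 = ‖X j ω‖ ^ 2 := by
        unfold relSq at he
        exact (div_left_inj' (by positivity)).1 he
      have h2 : ‖X i ω‖ = ‖X j ω‖ := (sq_eq_sq₀ (norm_nonneg _) (norm_nonneg _)).1 h1
      exact hji (hω.inj i j ((mem_ballIdx hω.finite).1 hi) ((mem_ballIdx hω.finite).1 hjA) h2).symm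
    exact (hvc _ (hmem i hi) _ (hmem j hjA) hne).tendsto.comp
      ((htend i hi).prodMk_nhds (htend j hjA))
  have hbd : ∀ m, ∀ᵐ ω ∂P, ‖S m ω‖ ≤ ncount X (Metric.closedBall 0 R) ω * C := by
    intro m
    filter_upwards [hcard] with ω hω
    rw [← hω, Real.norm_eq_abs]
    exact abs_pointSum_le hf hv fun i _ => htm01 m _
  have hmeas := aestronglyMeasurable_of_tendsto_ae atTop (fun m => (hSint m).aestronglyMeasurable)
    hpt
  refine ⟨?_, ?_⟩
  · refine hbd_int.mono' hmeas ?_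
    filter_upwards [hcard, h.ae_regular hR] with ω hω hreg
    rw [← hω, Real.norm_eq_abs]
    exact abs_pointSum_le hf hv fun i hi =>
      ⟨relSq_pos hR (hreg.ne_zero i), (relSq_le_one_iff hR).2 ((mem_ballIdx hreg.finite).1 hi)⟩
  have hlim1 := tendsto_integral_of_dominated_convergence _
    (fun m => (hSint m).aestronglyMeasurable) hbd_int hbd hpt
  refine tendsto_nhds_unique hlim1 ?_
  simp only [hSval]
  -- A Riemann sum whose summands contain another one in the exponent. The tag is `θ = 1` because of
  -- the outer rims. The inner sum is taken along `atTop ×ˢ 𝓝 s`, so that it converges continuously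
  -- in the outer variable.
  refine tendsto_riemann_sum (u := fun m : ℕ => m + 1) (tendsto_add_atTop_nat 1) (θ := 1) one_pos
    le_rfl (h := fun m y => μ * f y * Real.exp (-(μ * ((∑ l ∈ Finset.range (m + 1),
        (1 - v y ((l + 1) / ((m + 1 : ℕ) : ℝ)))) / ((m + 1 : ℕ) : ℝ)))))
    (H := fun t => μ * f t * Real.exp (-(μ * ∫ t' in (0 : ℝ)..1, (1 - v t t')))) (C := μ * C) ?_ ?_
  · refine Eventually.of_forall fun m y hy => ?_
    have h1 : Real.exp (-(μ * ((∑ l ∈ Finset.range (m + 1),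
        (1 - v y ((l + 1) / ((m + 1 : ℕ) : ℝ)))) / ((m + 1 : ℕ) : ℝ)))) ≤ 1 := by
      refine Real.exp_le_one_iff.2 (neg_nonpos.2 ?_)
      refine mul_nonneg hμ0.le (div_nonneg (Finset.sum_nonneg fun l hl => ?_) (by positivity))
      have := hv y hy _ (htm01 m ⟨l, Finset.mem_range.1 hl⟩)
      simp only [htm] at this
      linarith [this.2]
    rw [abs_mul, abs_mul, abs_of_pos hμ0, abs_of_pos (Real.exp_pos _)]
    calc _ ≤ μ * C * 1 := mul_le_mul (mul_le_mul_of_nonneg_left (hf y hy) hμ0.le) h1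
          (Real.exp_pos _).le (by positivity)
      _ = _ := mul_one _
  · refine Eventually.of_forall fun s hs => ?_
    have hs' : s ∈ Set.Ioc (0 : ℝ) 1 := ⟨hs.1, hs.2.le⟩
    have hsnd : Tendsto (fun q : ℕ × ℝ => q.2) (atTop ×ˢ 𝓝 s) (𝓝 s) := tendsto_snd
    have hinner := tendsto_riemann_sum (l := atTop ×ˢ 𝓝 s) (u := fun q : ℕ × ℝ => q.1 + 1)
      ((tendsto_add_atTop_nat 1).comp tendsto_fst) (θ := 1) one_pos le_rfl
      (h := fun q y => 1 - v q.2 y) (H := fun y => 1 - v s y) (C := 1)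
      (by
        filter_upwards [hsnd.eventually (Ioo_mem_nhds hs.1 hs.2)] with q hq y hy
        have := hv q.2 ⟨hq.1, hq.2.le⟩ y hy
        rw [abs_of_nonneg (by linarith [this.2])]
        linarith [this.1])
      (by
        filter_upwards [volume.ae_ne s] with y hne hy
        have h1 : Tendsto (fun q : (ℕ × ℝ) × ℝ => (q.1.2, q.2)) ((atTop ×ˢ 𝓝 s) ×ˢ 𝓝 y)
            (𝓝 (s, y)) := (hsnd.comp tendsto_fst).prodMk_nhds tendsto_snd
        exact ((hvc s hs' y ⟨hy.1, hy.2.le⟩ hne.symm).tendsto.comp h1).const_sub 1)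
    exact ((((hfc s hs').tendsto.comp hsnd).const_mul μ).mul ((hinner.const_mul μ).neg.rexp))

end IsHPPP

end Pico
end

noncomputable section

namespace Pico

namespace Params

variable (T : Params)

/-! ### The mean contribution of an interfering base station -/

/-- Law of the argument of the array gain. -/
abbrev angleLaw : Measure ℝ := ProbabilityTheory.cond volume (Set.Icc (-(T.d / T.wl)) (T.d / T.wl))

theorem volume_angle : volume (Set.Icc (-(T.d / T.wl)) (T.d / T.wl)) =
    ENNReal.ofReal (2 * (T.d / T.wl)) := by
  rw [Real.volume_Icc]
  congr 1
  ring

instance isProbabilityMeasure_angleLaw : IsProbabilityMeasure T.angleLaw := by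
  have := T.d_pos
  have := T.wl_pos
  refine cond_isProbabilityMeasure_of_finite ?_ ?_
  · rw [volume_angle]
    exact (ENNReal.ofReal_pos.2 (by positivity)).ne'
  · rw [volume_angle]
    exact ENNReal.ofReal_ne_top

theorem integral_angleLaw (f : ℝ → ℝ) : ∫ θ, f θ ∂T.angleLaw =
    T.wl / (2 * T.d) * ∫ θ in (-(T.d / T.wl))..(T.d / T.wl), f θ := by
  have hd := T.d_pos
  have hw := T.wl_pos
  have h0 : 0 < T.d / T.wl := by positivity
  rw [angleLaw, ProbabilityTheory.cond, integral_smul_measure, volume_angle,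
    intervalIntegral.integral_of_le (by linarith), integral_Icc_eq_integral_Ioc,
    ENNReal.toReal_inv, ENNReal.toReal_ofReal (by positivity), smul_eq_mul]
  congr 1
  field_simp

/-- The mean of `kern` over the array gain. -/
def meanKern (n : ℕ) (τ r q : ℝ) : ℝ := ∫ θ, T.kern (T.scale n τ r θ) q ∂T.angleLaw

theorem measurable_scale (n : ℕ) (τ r : ℝ) : Measurable (T.scale n τ r) := by
  have := T.continuous_G.measurable
  unfold scale
  fun_prop

theorem measurable_kern_scale (n : ℕ) (τ r : ℝ) :
    Measurable fun z : ℝ × ℝ => T.kern (T.scale n τ r z.1) z.2 :=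
  T.measurable_kern.comp (((T.measurable_scale n τ r).comp measurable_fst).prodMk measurable_snd)

theorem integrable_kern_scale (n : ℕ) {τ r q : ℝ} (hτ : 0 ≤ τ) (hr : 0 ≤ r) (hq : 0 ≤ q) :
    Integrable (fun θ => T.kern (T.scale n τ r θ) q) T.angleLaw := by
  refine Integrable.of_bound (C := 1)
    ((T.measurable_kern_scale n τ r).comp measurable_prodMk_right).aestronglyMeasurable
    (Eventually.of_forall fun θ => ?_)
  have hX := T.scale_nonneg n hτ hr θ
  rw [Real.norm_eq_abs, abs_of_pos (T.kern_pos hX hq)]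
  exact T.kern_le_one hX hq

theorem meanKern_nonneg (n : ℕ) {τ r q : ℝ} (hτ : 0 ≤ τ) (hr : 0 ≤ r) (hq : 0 ≤ q) :
    0 ≤ T.meanKern n τ r q :=
  integral_nonneg fun θ => (T.kern_pos (T.scale_nonneg n hτ hr θ) hq).le

theorem meanKern_le_one (n : ℕ) {τ r q : ℝ} (hτ : 0 ≤ τ) (hr : 0 ≤ r) (hq : 0 ≤ q) :
    T.meanKern n τ r q ≤ 1 := by
  have := integral_mono (T.integrable_kern_scale n hτ hr hq) (integrable_const 1)
    fun θ => T.kern_le_one (T.scale_nonneg n hτ hr θ) hq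
  simpa [meanKern] using this

theorem tendsto_meanKern {ι : Type*} {l : Filter ι} [l.IsCountablyGenerated] {r Q : ι → ℝ}
    {r₀ q₀ : ℝ} (hr : Tendsto r l (𝓝 r₀)) (hQ : Tendsto Q l (𝓝 q₀)) (hr₀ : 0 < r₀) (hq₀ : 0 < q₀)
    (n : ℕ) {τ : ℝ} (hτ : 0 ≤ τ) :
    Tendsto (fun a => T.meanKern n τ (r a) (Q a)) l (𝓝 (T.meanKern n τ r₀ q₀)) := by
  refine tendsto_integral_filter_of_dominated_convergence (fun _ => 1) ?_ ?_
    (integrable_const 1) ?_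
  · exact Eventually.of_forall fun a =>
      ((T.measurable_kern_scale n τ (r a)).comp measurable_prodMk_right).aestronglyMeasurable
  · filter_upwards [hr.eventually (lt_mem_nhds hr₀), hQ.eventually (lt_mem_nhds hq₀)] with a h1 h2
    refine Eventually.of_forall fun θ => ?_
    have hX := T.scale_nonneg n hτ h1.le θ
    rw [Real.norm_eq_abs, abs_of_pos (T.kern_pos hX h2.le)]
    exact T.kern_le_one hX h2.le
  · refine Eventually.of_forall fun θ => ?_
    exact T.tendsto_kern (T.tendsto_scale hr tendsto_const_nhds n τ hr₀) hQ
      (T.scale_nonneg n hτ hr₀.le θ) hq₀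

/-- Mean factor of a base station at squared distance `q` when the serving one is at `r`. -/
def ret (n : ℕ) (τ r q : ℝ) : ℝ := T.thin r q * T.meanKern n τ r q

theorem ret_mem_Icc (n : ℕ) {τ r q : ℝ} (hτ : 0 ≤ τ) (hr : 0 ≤ r) (hq : 0 ≤ q) :
    T.ret n τ r q ∈ Set.Icc (0 : ℝ) 1 :=
  ⟨mul_nonneg (T.thin_nonneg r q) (T.meanKern_nonneg n hτ hr hq),
    mul_le_one₀ (T.thin_le_one r q) (T.meanKern_nonneg n hτ hr hq) (T.meanKern_le_one n hτ hr hq)⟩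

theorem integrable_thin_mul_kern {n : ℕ} {τ r : ℝ} (hτ : 0 ≤ τ) (hr : 0 < r) :
    Integrable (fun z : ℝ × ℝ => T.thin r z.1 * T.kern (T.scale n τ r z.2) z.1)
      ((volume.restrict (Set.Ioc 0 (T.RL ^ 2))).prod T.angleLaw) := by
  have hthin : Measurable fun z : ℝ × ℝ => T.thin r z.1 :=
    (T.measurable_thin r).comp measurable_fst
  have hkern : Measurable fun z : ℝ × ℝ => T.kern (T.scale n τ r z.2) z.1 :=
    T.measurable_kern.comp
      (((T.measurable_scale n τ r).comp measurable_snd).prodMk measurable_fst)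
  have hmeas := hthin.mul hkern
  refine Integrable.of_bound hmeas.aestronglyMeasurable 1 ?_
  have hfst : ∀ᵐ z : ℝ × ℝ ∂(volume.restrict (Set.Ioc 0 (T.RL ^ 2))).prod T.angleLaw,
      z.1 ∈ Set.Ioc 0 (T.RL ^ 2) :=
    Measure.quasiMeasurePreserving_fst.ae (ae_restrict_mem measurableSet_Ioc)
  filter_upwards [hfst] with z hz
  have hX := T.scale_nonneg n hτ hr.le z.2
  rw [Real.norm_eq_abs, abs_of_nonneg (T.thin_mul_kern_nonneg hX hz.1.le)]
  exact T.thin_mul_kern_le_one hX hz.1.le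

/-- Fubini: exchanging the mean over the angle with the integral over squared distances recovers the
angular average of `W` that occurs in `laplace`. -/
theorem integral_ret {n : ℕ} {τ r : ℝ} (hτ : 0 ≤ τ) (hr : 0 < r) (hrR : r ≤ T.RL) :
    ∫ q in (0 : ℝ)..(T.RL ^ 2), T.ret n τ r q =
      -(T.wl / (2 * T.d) * ∫ ω in (-(T.d / T.wl))..(T.d / T.wl),
        T.W r ω (n * T.η * r ^ T.α / G0) τ) := by
  have hR2 : 0 ≤ T.RL ^ 2 := by positivity
  have hW : ∀ θ, T.W r θ (n * T.η * r ^ T.α / G0) τ =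
      -∫ q in Set.Ioc 0 (T.RL ^ 2), T.thin r q * T.kern (T.scale n τ r θ) q := by
    intro θ
    rw [T.W_eq_integral_thin hτ hr hrR, intervalIntegral.integral_of_le hR2]
  have hret : ∀ q, T.ret n τ r q =
      ∫ θ, T.thin r q * T.kern (T.scale n τ r θ) q ∂T.angleLaw := fun q => by
    rw [integral_const_mul]
    rfl
  rw [← T.integral_angleLaw, ← integral_neg, intervalIntegral.integral_of_le hR2]
  simp only [hW, hret, neg_neg]
  exact integral_integral_swap (f := fun q θ => T.thin r q * T.kern (T.scale n τ r θ) q)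
    (T.integrable_thin_mul_kern hτ hr)

theorem intervalIntegrable_ret {n : ℕ} {τ r : ℝ} (hτ : 0 ≤ τ) (hr : 0 ≤ r) {b : ℝ} (hb : 0 ≤ b) :
    IntervalIntegrable (T.ret n τ r) volume 0 b := by
  have hmeas : StronglyMeasurable (T.meanKern n τ r) :=
    ((T.measurable_kern_scale n τ r).comp measurable_swap).stronglyMeasurable.integral_prod_right'
  refine (intervalIntegrable_const (c := (1 : ℝ))).mono_fun
    ((T.measurable_thin r).mul hmeas.measurable).aestronglyMeasurable ?_
  refine ae_restrict_of_forall_mem measurableSet_uIoc fun q hq => ?_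
  rw [Set.uIoc_of_le hb] at hq
  have := T.ret_mem_Icc n hτ hr hq.1.le
  simp only [Real.norm_eq_abs, abs_of_nonneg this.1, abs_one]
  exact this.2

/-- Noise factor. -/
def noiseFactor (n : ℕ) (τ r : ℝ) : ℝ :=
  Real.exp (-(n * T.η * r ^ T.α * τ * T.noise / (T.Pt * T.C * T.Nant * G0)))

/-- The substitution `t = r² / R²` leads from the area coordinate of the annuli back to distances.
-/
theorem integral_comp_sq {R : ℝ} (hR : 0 < R) (F : ℝ → ℝ) :
    ∫ t in (0 : ℝ)..1, F t = ∫ r in (0 : ℝ)..R, 2 * r / R ^ 2 * F (r ^ 2 / R ^ 2) := by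
  have himg : (fun r : ℝ => r ^ 2 / R ^ 2) '' Set.Ioc 0 R = Set.Ioc 0 1 := by
    ext t
    constructor
    · rintro ⟨r, hr, rfl⟩
      have := hr.1
      refine ⟨by positivity, ?_⟩
      simp only
      rw [div_le_one (by positivity)]
      exact pow_le_pow_left₀ hr.1.le hr.2 2
    · intro ht
      have h1 : √t ≤ 1 := Real.sqrt_le_one.2 ht.2
      refine ⟨R * √t, ⟨mul_pos hR (Real.sqrt_pos.2 ht.1), mul_le_of_le_one_right hR.le h1⟩, ?_⟩
      simp only [mul_pow, Real.sq_sqrt ht.1.le]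
      field_simp
  have hinj : Set.InjOn (fun r : ℝ => r ^ 2 / R ^ 2) (Set.Ioc 0 R) := by
    intro a ha b hb hab
    have : a ^ 2 = b ^ 2 := (div_left_inj' (by positivity)).1 hab
    exact (sq_eq_sq₀ ha.1.le hb.1.le).1 this
  have key := integral_image_eq_integral_abs_deriv_smul (s := Set.Ioc (0 : ℝ) R)
    (f := fun r : ℝ => r ^ 2 / R ^ 2) (f' := fun r => 2 * r / R ^ 2) measurableSet_Ioc
    (fun r _ => by
      have := ((hasDerivAt_pow 2 r).div_const (R ^ 2)).hasDerivWithinAt (s := Set.Ioc 0 R)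
      simpa using this) hinj F
  rw [himg] at key
  rw [intervalIntegral.integral_of_le zero_le_one, intervalIntegral.integral_of_le hR.le, key]
  refine setIntegral_congr_fun measurableSet_Ioc fun r hr => ?_
  have : 0 ≤ 2 * r / R ^ 2 := by
    have := hr.1
    positivity
  simp only [abs_of_nonneg this, smul_eq_mul]

/-- The Campbell–Mecke integral is the integral expression of the coverage probability. -/
theorem integral_laplace_eq {n : ℕ} {τ : ℝ} (hτ : 0 ≤ τ) :
    ∫ t in (0 : ℝ)..1, Real.pi * T.dens * T.RL ^ 2 * (T.p * T.noiseFactor n τ (T.RL * √t)) *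
      Real.exp (-(Real.pi * T.dens * T.RL ^ 2 *
        ∫ t' in (0 : ℝ)..1, (1 - T.ret n τ (T.RL * √t) (T.RL ^ 2 * t')))) =
    ∫ r in (0 : ℝ)..T.RL, T.laplace r (n * T.η * r ^ T.α / G0) τ * T.noiseDist n r τ := by
  have hR := T.RL_pos
  have hR2 : 0 < T.RL ^ 2 := by positivity
  rw [integral_comp_sq hR]
  refine intervalIntegral.integral_congr_ae (Eventually.of_forall fun r hr => ?_)
  rw [Set.uIoc_of_le hR.le] at hr
  have hsq : T.RL * √(r ^ 2 / T.RL ^ 2) = r := by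
    rw [Real.sqrt_div (by positivity), Real.sqrt_sq hr.1.le, Real.sqrt_sq hR.le]
    field_simp
  have hone : ∫ t' in (0 : ℝ)..1, (1 - T.ret n τ r (T.RL ^ 2 * t')) =
      1 - (T.RL ^ 2)⁻¹ * ∫ q in (0 : ℝ)..(T.RL ^ 2), T.ret n τ r q := by
    have hii : IntervalIntegrable (fun t' => T.ret n τ r (T.RL ^ 2 * t')) volume 0 1 := by
      have := (T.intervalIntegrable_ret (n := n) hτ hr.1.le hR2.le).comp_mul_left (c := T.RL ^ 2)
      simpa [hR2.ne'] using this
    rw [intervalIntegral.integral_sub intervalIntegrable_const hii,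
      intervalIntegral.integral_comp_mul_left _ hR2.ne']
    simp
  rw [hsq, hone, T.integral_ret hτ hr.1 hr.2]
  unfold laplace noiseDist distPDF noiseFactor
  set I := ∫ ω in (-(T.d / T.wl))..(T.d / T.wl), T.W r ω (n * T.η * r ^ T.α / G0) τ
  -- The void probability `exp(-π p λ r²)` is split off: it completes `distPDF`, and leaves `R_L² -
  -- p r²` in the exponent of `laplace`.
  have hexp : Real.exp (-(Real.pi * T.dens * T.RL ^ 2 *
      (1 - (T.RL ^ 2)⁻¹ * -(T.wl / (2 * T.d) * I)))) =
      Real.exp (-(Real.pi * T.dens * (T.RL ^ 2 - T.p * r ^ 2)) -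
        Real.pi * T.dens * T.wl / (2 * T.d) * I) *
      Real.exp (-(Real.pi * T.p * T.dens * r ^ 2)) := by
    rw [← Real.exp_add]
    congr 1
    field_simp
    ring
  rw [hexp]
  field_simp

/-- At `n = 0` noise and interference drop out and `1 - thin` integrates to `p t`, so an exponential
density remains. The value is the probability that a caching station lies in the ball. -/
theorem integral_laplace_zero (τ : ℝ) :
    ∫ t in (0 : ℝ)..1, Real.pi * T.dens * T.RL ^ 2 * (T.p * T.noiseFactor 0 τ (T.RL * √t)) *
      Real.exp (-(Real.pi * T.dens * T.RL ^ 2 *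
        ∫ t' in (0 : ℝ)..1, (1 - T.ret 0 τ (T.RL * √t) (T.RL ^ 2 * t')))) =
    1 - Real.exp (-(Real.pi * T.p * T.dens * T.RL ^ 2)) := by
  have hR := T.RL_pos
  have hR2 : 0 < T.RL ^ 2 := by positivity
  set a : ℝ := Real.pi * T.p * T.dens * T.RL ^ 2 with ha
  have hinner : ∀ t ∈ Set.Ioc (0 : ℝ) 1, ∫ t' in (0 : ℝ)..1,
      (1 - T.ret 0 τ (T.RL * √t) (T.RL ^ 2 * t')) = T.p * t := by
    intro t ht
    have hr : ∀ t', 1 - T.ret 0 τ (T.RL * √t) (T.RL ^ 2 * t') = if t' ≤ t then (T.p : ℝ) else 0 := by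
      intro t'
      have h1 : T.meanKern 0 τ (T.RL * √t) (T.RL ^ 2 * t') = 1 := by
        simp [meanKern, scale, kern_zero]
      simp only [ret, h1, mul_one, thin, mul_pow, Real.sq_sqrt ht.1.le,
        mul_le_mul_iff_right₀ hR2]
      split_ifs <;> ring
    simp only [hr]
    have e1 : Set.EqOn (fun _ : ℝ => (T.p : ℝ)) (fun t' => if t' ≤ t then (T.p : ℝ) else 0)
        (Set.uIoc 0 t) := by
      intro s hs
      rw [Set.uIoc_of_le ht.1.le] at hs
      simp [hs.2]
    have e2 : Set.EqOn (fun _ : ℝ => (0 : ℝ)) (fun t' => if t' ≤ t then (T.p : ℝ) else 0)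
        (Set.uIoc t 1) := by
      intro s hs
      rw [Set.uIoc_of_le ht.2] at hs
      simp [hs.1]
    rw [← intervalIntegral.integral_add_adjacent_intervals (intervalIntegrable_const.congr e1)
      (intervalIntegrable_const.congr e2), ← intervalIntegral.integral_congr_ae
      (Eventually.of_forall e1), ← intervalIntegral.integral_congr_ae (Eventually.of_forall e2)]
    simp
    ring
  have hcong : ∫ t in (0 : ℝ)..1, Real.pi * T.dens * T.RL ^ 2 *
      (T.p * T.noiseFactor 0 τ (T.RL * √t)) * Real.exp (-(Real.pi * T.dens * T.RL ^ 2 *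
        ∫ t' in (0 : ℝ)..1, (1 - T.ret 0 τ (T.RL * √t) (T.RL ^ 2 * t')))) =
      ∫ t in (0 : ℝ)..1, a * Real.exp (-(a * t)) := by
    refine intervalIntegral.integral_congr_ae (Eventually.of_forall fun t ht => ?_)
    rw [Set.uIoc_of_le zero_le_one] at ht
    rw [hinner t ht]
    have : T.noiseFactor 0 τ (T.RL * √t) = 1 := by simp [noiseFactor]
    rw [this, ha]
    ring_nf
  rw [hcong, intervalIntegral.integral_const_mul]
  have ha0 : 0 ≤ a := by
    have := T.p.2.1
    have := T.dens_pos
    positivity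
  rcases eq_or_lt_of_le ha0 with h | h
  · rw [← h]
    simp
  · rw [one_sub_exp_neg_div h]
    field_simp

end Params

end Pico
end

noncomputable section

namespace Pico

/-! ### The law of a single mark -/

/-- The mark of a base station: whether it caches the file, its fading power and the argument of
its array gain. -/
abbrev Mark := Bool × ℝ × ℝ

/-- Integration over two independent random elements, one after the other. -/
theorem integral_indepFun {Ω E F : Type*} [MeasurableSpace Ω] [MeasurableSpace E]
    [MeasurableSpace F] {P : Measure Ω} [IsProbabilityMeasure P] {U : Ω → E} {V : Ω → F}
    (h : IndepFun U V P) (hU : Measurable U) (hV : Measurable V) {Φ : E × F → ℝ}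
    (hΦ : Measurable Φ) {C : ℝ} (hC : ∀ z, |Φ z| ≤ C) :
    ∫ ω, Φ (U ω, V ω) ∂P = ∫ ω, ∫ ω', Φ (U ω, V ω') ∂P ∂P := by
  have hmap := (indepFun_iff_map_prod_eq_prod_map_map hU.aemeasurable hV.aemeasurable).1 h
  have := Measure.isProbabilityMeasure_map (μ := P) hU.aemeasurable
  have := Measure.isProbabilityMeasure_map (μ := P) hV.aemeasurable
  have hint : Integrable Φ ((P.map U).prod (P.map V)) :=
    Integrable.of_bound hΦ.aestronglyMeasurable C (Eventually.of_forall hC)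
  calc ∫ ω, Φ (U ω, V ω) ∂P = ∫ z, Φ z ∂P.map fun ω => (U ω, V ω) :=
        (integral_map (hU.prodMk hV).aemeasurable hΦ.aestronglyMeasurable).symm
    _ = ∫ u, ∫ v, Φ (u, v) ∂P.map V ∂P.map U := by rw [hmap, integral_prod _ hint]
    _ = ∫ ω, ∫ v, Φ (U ω, v) ∂P.map V ∂P :=
        integral_map hU.aemeasurable
          hΦ.stronglyMeasurable.integral_prod_right'.aestronglyMeasurable
    _ = ∫ ω, ∫ ω', Φ (U ω, V ω') ∂P ∂P := by
        refine integral_congr_ae (Eventually.of_forall fun ω => ?_)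
        exact integral_map hV.aemeasurable (hΦ.comp measurable_prodMk_left).aestronglyMeasurable

namespace Params

variable (T : Params)

theorem integral_gamma (f : ℝ → ℝ) : ∫ x, f x ∂gammaMeasure T.Np T.Np =
    ∫ x in Set.Ioi (0 : ℝ), (T.Np : ℝ) ^ (T.Np : ℝ) / Real.Gamma T.Np *
      (x ^ ((T.Np : ℝ) - 1) * Real.exp (-(T.Np * x))) * f x := by
  have hN := T.Np_pos'
  have hmeas : Measurable (gammaPDF T.Np T.Np) :=
    (measurable_gammaPDFReal T.Np T.Np).ennreal_ofReal
  rw [gammaMeasure, integral_withDensity_eq_integral_toReal_smul hmeas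
    (Eventually.of_forall fun _ => ENNReal.ofReal_lt_top), ← integral_indicator measurableSet_Ioi]
  refine integral_congr_ae ?_
  filter_upwards [volume.ae_ne (0 : ℝ)] with x hx
  rw [gammaPDF, ENNReal.toReal_ofReal (gammaPDFReal_nonneg hN hN x), gammaPDFReal, smul_eq_mul]
  rcases lt_or_gt_of_ne hx with h | h
  · simp [h.not_ge, h.le]
  · simp only [h.le, if_true, Set.indicator_of_mem (Set.mem_Ioi.2 h)]
    ring

/-- Laplace transform of the fading power. -/
theorem integral_exp_gamma {z : ℝ} (hz : 0 ≤ z) :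
    ∫ x, Real.exp (-(T.Np * z * x)) ∂gammaMeasure T.Np T.Np = ((1 + z) ^ T.Np)⁻¹ := by
  have hN := T.Np_pos'
  have hG := Real.Gamma_pos_of_pos hN
  have h := Real.integral_rpow_mul_exp_neg_mul_Ioi hN (r := T.Np * (1 + z)) (by positivity)
  rw [integral_gamma]
  have e : ∀ x : ℝ, (T.Np : ℝ) ^ (T.Np : ℝ) / Real.Gamma T.Np *
      (x ^ ((T.Np : ℝ) - 1) * Real.exp (-(T.Np * x))) * Real.exp (-(T.Np * z * x)) =
      (T.Np : ℝ) ^ (T.Np : ℝ) / Real.Gamma T.Np *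
        (x ^ ((T.Np : ℝ) - 1) * Real.exp (-(T.Np * (1 + z) * x))) := by
    intro x
    have : -(T.Np * (1 + z) * x) = -(T.Np * x) + -(T.Np * z * x) := by ring
    rw [this, Real.exp_add]
    ring
  simp only [e]
  rw [integral_const_mul, h, Real.div_rpow zero_le_one (by positivity), Real.one_rpow,
    Real.mul_rpow hN.le (by positivity), Real.rpow_natCast, Real.rpow_natCast]
  field_simp

theorem ae_gamma_nonneg : ∀ᵐ x ∂gammaMeasure T.Np T.Np, 0 ≤ x := by
  have h : T.fadingCDF 0 = 0 := by simpa using T.fadingCDF_eq_integral le_rfl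
  have := T.isProbabilityMeasure_fading
  rw [fadingCDF, measureReal_eq_zero_iff] at h
  rw [ae_iff]
  simp only [not_le]
  exact h

/-- Law of the mark of a base station. -/
abbrev markLaw : Measure Mark :=
  (bernoulliMeasure true false T.p).prod ((gammaMeasure T.Np T.Np).prod T.angleLaw)

theorem isProbabilityMeasure_markLaw : IsProbabilityMeasure T.markLaw := by
  have := T.isProbabilityMeasure_fading
  infer_instance

theorem integral_markLaw {f : Mark → ℝ} (hf : Measurable f) {C : ℝ}
    (hC : ∀ᵐ m ∂T.markLaw, |f m| ≤ C) :
    ∫ m, f m ∂T.markLaw =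
      T.p * (∫ y, f (true, y) ∂(gammaMeasure T.Np T.Np).prod T.angleLaw) +
      (1 - T.p) * ∫ y, f (false, y) ∂(gammaMeasure T.Np T.Np).prod T.angleLaw := by
  have := T.isProbabilityMeasure_fading
  have := T.isProbabilityMeasure_markLaw
  rw [integral_prod _ (Integrable.of_bound hf.aestronglyMeasurable C hC),
    integral_bernoulliMeasure]
  simp [smul_eq_mul]

/-- Probability that a base station caches the file and its fading power exceeds `γ`. -/
theorem integral_cached_fading (γ : ℝ) :
    ∫ m : Mark, (if m.1 = true ∧ γ < m.2.1 then (1 : ℝ) else 0) ∂T.markLaw =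
      T.p * (1 - T.fadingCDF γ) := by
  have := T.isProbabilityMeasure_fading
  have hms : MeasurableSet {m : Mark | m.1 = true ∧ γ < m.2.1} := by
    refine MeasurableSet.inter ?_ ?_
    · exact measurable_fst (measurableSet_singleton true)
    · exact measurableSet_lt measurable_const (measurable_fst.comp measurable_snd)
  rw [T.integral_markLaw (Measurable.ite hms measurable_const measurable_const) (C := 1)]
  · simp only [true_and, reduceCtorEq, false_and, if_false, integral_zero, mul_zero, add_zero]
    congr 1
    have h1 := integral_fun_fst (μ := gammaMeasure T.Np T.Np) (ν := T.angleLaw)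
      (f := fun g : ℝ => if γ < g then (1 : ℝ) else 0)
    rw [h1, probReal_univ, one_smul]
    have h2 : (fun g : ℝ => if γ < g then (1 : ℝ) else 0) = (Set.Ioi γ).indicator 1 := by
      ext g
      simp [Set.indicator_apply]
    rw [h2, integral_indicator_one measurableSet_Ioi, fadingCDF,
      ← probReal_compl_eq_one_sub measurableSet_Iio, Set.compl_Iio]
    exact measureReal_congr (Ioi_ae_eq_Ici' (T.fading_singleton γ))
  · refine Eventually.of_forall fun m => ?_
    split_ifs <;> simp

theorem integral_cached :
    ∫ m : Mark, (if m.1 = true then (1 : ℝ) else 0) ∂T.markLaw = T.p := by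
  have := T.isProbabilityMeasure_fading
  have hms : MeasurableSet {m : Mark | m.1 = true} := measurable_fst (measurableSet_singleton true)
  rw [T.integral_markLaw (Measurable.ite hms measurable_const measurable_const) (C := 1)]
  · simp
  · refine Eventually.of_forall fun m => ?_
    split_ifs <;> simp

/-- Contribution of a base station with mark `m` at distance `ρ` when the serving one is at `r`. -/
def factor (n : ℕ) (τ r ρ : ℝ) (m : Mark) : ℝ :=
  (if m.1 = true ∧ ρ ^ 2 ≤ r ^ 2 then 0 else 1) *
    Real.exp (-(T.Np * (T.scale n τ r m.2.2 / (ρ ^ 2) ^ (T.α / 2)) * m.2.1))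

theorem measurable_factor (n : ℕ) (τ r ρ : ℝ) : Measurable (T.factor n τ r ρ) := by
  have hms : MeasurableSet {m : Mark | m.1 = true ∧ ρ ^ 2 ≤ r ^ 2} :=
    (measurable_fst (measurableSet_singleton true)).inter (MeasurableSet.const _)
  have hs := T.measurable_scale n τ r
  unfold factor
  refine (Measurable.ite hms measurable_const measurable_const).mul ?_
  fun_prop

theorem ae_factor_mem_Icc (n : ℕ) {τ r : ℝ} (ρ : ℝ) (hτ : 0 ≤ τ) (hr : 0 ≤ r) :
    ∀ᵐ m ∂T.markLaw, |T.factor n τ r ρ m| ≤ 1 := by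
  have := T.isProbabilityMeasure_fading
  have h : ∀ᵐ m ∂T.markLaw, 0 ≤ m.2.1 :=
    Measure.quasiMeasurePreserving_snd.ae (Measure.quasiMeasurePreserving_fst.ae T.ae_gamma_nonneg)
  filter_upwards [h] with m hm
  have h1 := T.scale_nonneg n hτ hr m.2.2
  have h2 : Real.exp (-(T.Np * (T.scale n τ r m.2.2 / (ρ ^ 2) ^ (T.α / 2)) * m.2.1)) ≤ 1 :=
    Real.exp_le_one_iff.2 (neg_nonpos.2 (by positivity))
  unfold factor
  split_ifs
  · simp
  · rwa [one_mul, Real.abs_exp]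

/-- At a fixed angle the fading power integrates to `kern`, and the angle then gives `meanKern`. A
caching station within the serving distance would itself serve, so only the probability `1 - p`
survives there; this is `thin`. -/
theorem integral_factor (n : ℕ) {τ r : ℝ} (ρ : ℝ) (hτ : 0 ≤ τ) (hr : 0 ≤ r) :
    ∫ m, T.factor n τ r ρ m ∂T.markLaw = T.ret n τ r (ρ ^ 2) := by
  have := T.isProbabilityMeasure_fading
  set E : ℝ × ℝ → ℝ := fun y =>
    Real.exp (-(T.Np * (T.scale n τ r y.2 / (ρ ^ 2) ^ (T.α / 2)) * y.1)) with hE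
  have hmeas : Measurable E := by
    have hs := T.measurable_scale n τ r
    fun_prop
  have hbd : ∀ᵐ y ∂(gammaMeasure T.Np T.Np).prod T.angleLaw, ‖E y‖ ≤ 1 := by
    filter_upwards [Measure.quasiMeasurePreserving_fst.ae T.ae_gamma_nonneg] with y hy
    have h1 := T.scale_nonneg n hτ hr y.2
    rw [Real.norm_eq_abs, Real.abs_exp]
    exact Real.exp_le_one_iff.2 (neg_nonpos.2 (by positivity))
  have hmean : ∫ y, E y ∂(gammaMeasure T.Np T.Np).prod T.angleLaw = T.meanKern n τ r (ρ ^ 2) := by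
    rw [integral_prod_symm _ (Integrable.of_bound hmeas.aestronglyMeasurable 1 hbd)]
    refine integral_congr_ae (Eventually.of_forall fun θ => ?_)
    have h1 := T.scale_nonneg n hτ hr θ
    exact T.integral_exp_gamma (z := T.scale n τ r θ / (ρ ^ 2) ^ (T.α / 2)) (by positivity)
  rw [T.integral_markLaw (T.measurable_factor n τ r ρ) (T.ae_factor_mem_Icc n ρ hτ hr)]
  have e1 : ∀ y, T.factor n τ r ρ (false, y) = E y := fun y => by simp [factor, hE]
  have e2 : ∀ y, T.factor n τ r ρ (true, y) = (if ρ ^ 2 ≤ r ^ 2 then 0 else 1) * E y :=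
    fun y => by simp [factor, hE]
  simp only [e1, e2, integral_const_mul, hmean, ret, thin]
  split_ifs <;> ring

end Params

end Pico

end

noncomputable section

namespace Pico

/-- Locations and marks of all base stations. -/
abbrev Config := (ℕ → Plane) × (ℕ → Mark)

namespace Params

variable (T : Params)

/-! ### Deterministic configurations -/

theorem L_of_le {r : ℝ} (h : r ≤ T.RL) : T.L r = T.C * r ^ (-T.α) := by
  simp [L, unitStep, h]

theorem L_of_lt {r : ℝ} (h : T.RL < r) : T.L r = 0 := by
  simp [L, unitStep, h.not_ge]

theorem L_nonneg {r : ℝ} (hr : 0 ≤ r) : 0 ≤ T.L r := by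
  have := T.C_pos
  rcases le_or_gt r T.RL with h | h
  · rw [T.L_of_le h]
    positivity
  · rw [T.L_of_lt h]

theorem measurable_L : Measurable T.L := by
  have hs : Measurable unitStep := Measurable.ite measurableSet_Ici measurable_const measurable_const
  unfold L
  fun_prop

/-- Power received from a base station at `y` with mark `m`. -/
def rx (y : Plane) (m : Mark) : ℝ := T.Pt * T.L ‖y‖ * (T.Nant * m.2.1 * T.G m.2.2)

theorem measurable_rx {β : Type*} [MeasurableSpace β] {y : β → Plane} {m : β → Mark}
    (hy : Measurable y) (hm : Measurable m) : Measurable fun b => T.rx (y b) (m b) := by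
  have h1 := T.measurable_L
  have h2 := T.continuous_G.measurable
  unfold rx
  fun_prop

theorem rx_nonneg (y : Plane) {m : Mark} (hm : 0 ≤ m.2.1) : 0 ≤ T.rx y m := by
  have h1 := T.L_nonneg (norm_nonneg y)
  have h2 := T.G_nonneg m.2.2
  have h3 := T.Pt_pos
  unfold rx
  positivity

theorem rx_of_lt {y : Plane} (h : T.RL < ‖y‖) (m : Mark) : T.rx y m = 0 := by
  simp [rx, T.L_of_lt h]

/-- Power received from all base stations other than `i`. -/
def totalRx (i : ℕ) (q : Config) : ℝ :=
  (∑' j, if j = i then 0 else ENNReal.ofReal (T.rx (q.1 j) (q.2 j))).toReal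

/-- The sum in `totalRx` is taken in extended nonnegative reals, so measurability needs no
summability; on regular configurations with nonnegative fading it agrees with the finite real sum.
-/
theorem measurable_totalRx (i : ℕ) : Measurable (T.totalRx i) := by
  refine (Measurable.tsum fun j => ?_).ennreal_toReal
  by_cases h : j = i
  · simp [h]
  · simp only [h, if_false]
    exact (T.measurable_rx (by fun_prop) (by fun_prop)).ennreal_ofReal

theorem totalRx_eq (i : ℕ) {x : ℕ → Plane} (hx : Regular T.RL x) {m : ℕ → Mark}
    (hm : ∀ j, 0 ≤ (m j).2.1) :
    T.totalRx i (x, m) = ∑ j ∈ (ballIdx T.RL x).erase i, T.rx (x j) (m j) := by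
  unfold totalRx
  rw [tsum_eq_sum (s := (ballIdx T.RL x).erase i), ENNReal.toReal_sum]
  · refine Finset.sum_congr rfl fun j hj => ?_
    rw [if_neg (Finset.ne_of_mem_erase hj), ENNReal.toReal_ofReal (T.rx_nonneg _ (hm j))]
  · intro j hj
    rw [if_neg (Finset.ne_of_mem_erase hj)]
    exact ENNReal.ofReal_ne_top
  · intro j hj
    split_ifs with h
    · rfl
    · have : T.RL < ‖x j‖ := by
        by_contra hle
        exact hj (Finset.mem_erase.2 ⟨h, (mem_ballIdx hx.finite).2 (not_lt.1 hle)⟩)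
      simp [T.rx_of_lt this]

/-- The fading power that base station `i` needs. -/
def level (τ : ℝ) (i : ℕ) (q : Config) : ℝ :=
  τ * (T.noise + T.totalRx i q) / (T.Pt * T.L ‖q.1 i‖ * G0 * T.Nant)

theorem measurable_level (τ : ℝ) (i : ℕ) : Measurable (T.level τ i) := by
  have h1 := T.measurable_totalRx i
  have h2 := T.measurable_L
  unfold level
  fun_prop

theorem level_nonneg {τ : ℝ} (hτ : 0 ≤ τ) (i : ℕ) (q : Config) : 0 ≤ T.level τ i q := by
  have h1 := T.L_nonneg (norm_nonneg (q.1 i))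
  have h2 := T.Pt_pos
  have h3 := T.noise_pos
  have h4 : 0 ≤ T.totalRx i q := ENNReal.toReal_nonneg
  unfold level G0
  positivity

/-- The configurations in which base station `i` serves and is in the line-of-sight ball. -/
def servedBy (i : ℕ) : Set Config :=
  {q | (q.2 i).1 = true ∧ ‖q.1 i‖ ≤ T.RL ∧ ∀ j, (q.2 j).1 = true → ‖q.1 i‖ ≤ ‖q.1 j‖}

theorem measurableSet_servedBy (i : ℕ) : MeasurableSet (T.servedBy i) := by
  have hc : ∀ j, MeasurableSet {q : Config | (q.2 j).1 = true} := fun j =>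
    (measurable_fst.comp ((measurable_pi_apply j).comp measurable_snd))
      (measurableSet_singleton true)
  have hx : ∀ j, Measurable fun q : Config => ‖q.1 j‖ := fun j => by fun_prop
  have : {q : Config | ∀ j, (q.2 j).1 = true → ‖q.1 i‖ ≤ ‖q.1 j‖} =
      ⋂ j, ({q : Config | (q.2 j).1 = true}ᶜ ∪ {q : Config | ‖q.1 i‖ ≤ ‖q.1 j‖}) := by
    ext q
    simp [imp_iff_not_or]
  have h3 : MeasurableSet {q : Config | ∀ j, (q.2 j).1 = true → ‖q.1 i‖ ≤ ‖q.1 j‖} :=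
    this ▸ MeasurableSet.iInter fun j => (hc j).compl.union (measurableSet_le (hx i) (hx j))
  exact (hc i).inter ((measurableSet_le (hx i) measurable_const).inter h3)

theorem eq_of_mem_servedBy {x : ℕ → Plane} (hx : Regular T.RL x) {m : ℕ → Mark} {i k : ℕ}
    (hi : (x, m) ∈ T.servedBy i) (hk : (x, m) ∈ T.servedBy k) : i = k :=
  hx.inj i k hi.2.1 hk.2.1 (le_antisymm (hi.2.2 k hk.1) (hk.2.2 i hi.1))

/-- Because distances in the ball are distinct, being nearest means that no other caching station is
at most as far; stations beyond the ball are farther anyway. The event thus becomes a conjunction of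
conditions on single marks. -/
theorem mem_servedBy_iff {x : ℕ → Plane} (hx : Regular T.RL x) {m : ℕ → Mark} {i : ℕ}
    (hi : ‖x i‖ ≤ T.RL) : (x, m) ∈ T.servedBy i ↔ (m i).1 = true ∧
      ∀ j ∈ (ballIdx T.RL x).erase i, ¬((m j).1 = true ∧ ‖x j‖ ^ 2 ≤ ‖x i‖ ^ 2) := by
  have hsq : ∀ j, ‖x j‖ ^ 2 ≤ ‖x i‖ ^ 2 ↔ ‖x j‖ ≤ ‖x i‖ := fun j =>
    sq_le_sq₀ (norm_nonneg _) (norm_nonneg _)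
  simp only [servedBy, Set.mem_ofPred_eq, hi, true_and, hsq]
  refine and_congr_right fun _ => ⟨fun h j hj hc => ?_, fun h j hc => ?_⟩
  · have hjR := (mem_ballIdx hx.finite).1 (Finset.mem_of_mem_erase hj)
    exact Finset.ne_of_mem_erase hj (hx.inj j i hjR hi (le_antisymm hc.2 (h j hc.1)))
  · by_contra hlt
    have hlt' := not_le.1 hlt
    refine h j (Finset.mem_erase.2 ⟨?_, (mem_ballIdx hx.finite).2 (hlt'.le.trans hi)⟩) ⟨hc, hlt'.le⟩
    rintro rfl
    exact lt_irrefl _ hlt'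

/-- The value of `ψ` at the required fading power if base station `i` serves, else `0`. -/
def payoff (τ : ℝ) (i : ℕ) (ψ : ℝ → ℝ) (q : Config) : ℝ :=
  (T.servedBy i).indicator (fun q => ψ (T.level τ i q)) q

theorem measurable_payoff (τ : ℝ) (i : ℕ) {ψ : ℝ → ℝ} (hψ : Measurable ψ) :
    Measurable (T.payoff τ i ψ) :=
  (hψ.comp (T.measurable_level τ i)).indicator (T.measurableSet_servedBy i)

theorem abs_payoff_le {τ : ℝ} (hτ : 0 ≤ τ) (i : ℕ) {ψ : ℝ → ℝ}
    (hψ : ∀ γ, 0 ≤ γ → ψ γ ∈ Set.Icc (0 : ℝ) 1) (q : Config) :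
    |T.payoff τ i ψ q| ≤ 1 := by
  have h := hψ _ (T.level_nonneg hτ i q)
  unfold payoff
  by_cases hq : q ∈ T.servedBy i
  · rw [Set.indicator_of_mem hq, abs_of_nonneg h.1]
    exact h.2
  · simp [Set.indicator_of_notMem hq]

/-- The level is affine in the interference, so its exponential splits into the noise factor and one
factor per interferer. The `1 / N` inside `scale` is compensated by the factor `N` in the exponents,
as suits the Gamma rate `N`. -/
theorem exp_level_eq (n : ℕ) (τ : ℝ) {i : ℕ} {x : ℕ → Plane} (hx : Regular T.RL x) {m : ℕ → Mark}
    (hm : ∀ j, 0 ≤ (m j).2.1) (hi : ‖x i‖ ≤ T.RL) :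
    Real.exp (-(n * T.η * T.level τ i (x, m))) = T.noiseFactor n τ ‖x i‖ *
      ∏ j ∈ (ballIdx T.RL x).erase i, Real.exp (-(T.Np *
        (T.scale n τ ‖x i‖ (m j).2.2 / (‖x j‖ ^ 2) ^ (T.α / 2)) * (m j).2.1)) := by
  have hpos : ∀ j, 0 < ‖x j‖ := fun j => norm_pos_iff.2 (hx.ne_zero j)
  have hC := T.C_pos
  have hP := T.Pt_pos
  have hN : (0 : ℝ) < T.Nant := Nat.cast_pos.2 T.Nant_pos
  have hNp := T.Np_pos'
  have hri : 0 < ‖x i‖ ^ T.α := Real.rpow_pos_of_pos (hpos i) _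
  rw [noiseFactor, ← Real.exp_sum, ← Real.exp_add]
  congr 1
  have hterm : ∀ j ∈ (ballIdx T.RL x).erase i,
      -(T.Np * (T.scale n τ ‖x i‖ (m j).2.2 / (‖x j‖ ^ 2) ^ (T.α / 2)) * (m j).2.1) =
      -(n * T.η * τ * ‖x i‖ ^ T.α / (T.Pt * T.C * T.Nant)) * T.rx (x j) (m j) := by
    intro j hj
    have hjR := (mem_ballIdx hx.finite).1 (Finset.mem_of_mem_erase hj)
    have hrj : 0 < ‖x j‖ ^ T.α := Real.rpow_pos_of_pos (hpos j) _
    rw [T.rpow_α (norm_nonneg _), rx, T.L_of_le hjR, Real.rpow_neg (norm_nonneg _), scale, G0]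
    field_simp
  rw [Finset.sum_congr rfl hterm, ← Finset.mul_sum, ← T.totalRx_eq i hx hm, level, T.L_of_le hi,
    Real.rpow_neg (norm_nonneg _), G0]
  field_simp
  ring

/-- Both the service event and the exponential weight are products over stations, so with the
locations fixed each remaining factor involves just one mark. -/
theorem payoff_exp_eq (n : ℕ) (τ : ℝ) {i : ℕ} {x : ℕ → Plane} (hx : Regular T.RL x)
    {m : ℕ → Mark} (hm : ∀ j, 0 ≤ (m j).2.1) (hi : ‖x i‖ ≤ T.RL) :
    T.payoff τ i (fun γ => Real.exp (-(n * T.η * γ))) (x, m) =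
      T.noiseFactor n τ ‖x i‖ * ((if (m i).1 = true then 1 else 0) *
      ∏ j ∈ (ballIdx T.RL x).erase i, T.factor n τ ‖x i‖ ‖x j‖ (m j)) := by
  simp only [factor, Finset.prod_mul_distrib]
  by_cases h : (x, m) ∈ T.servedBy i
  · have h' := (T.mem_servedBy_iff hx hi).1 h
    have h1 : ∏ j ∈ (ballIdx T.RL x).erase i,
        (if (m j).1 = true ∧ ‖x j‖ ^ 2 ≤ ‖x i‖ ^ 2 then (0 : ℝ) else 1) = 1 :=
      Finset.prod_eq_one fun j hj => if_neg (h'.2 j hj)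
    rw [payoff, Set.indicator_of_mem h, h1, if_pos h'.1, one_mul, one_mul,
      T.exp_level_eq n τ hx hm hi]
  · have h' := (T.mem_servedBy_iff hx hi).not.1 h
    rw [payoff, Set.indicator_of_notMem h]
    by_cases hc : (m i).1 = true
    · simp only [hc, true_and, not_forall, not_not] at h'
      obtain ⟨j, hj, hjc⟩ := h'
      have h1 : ∏ j ∈ (ballIdx T.RL x).erase i,
          (if (m j).1 = true ∧ ‖x j‖ ^ 2 ≤ ‖x i‖ ^ 2 then (0 : ℝ) else 1) = 0 :=
        Finset.prod_eq_zero hj (if_pos hjc)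
      rw [h1]
      ring
    · rw [if_neg hc]
      ring

end Params

end Pico

end

noncomputable section

namespace Pico

namespace Params

variable (T : Params) {Ω : Type*} [MeasurableSpace Ω] {P : Measure Ω} {M : ℕ → Ω → Mark}

/-! ### Averaging over the marks -/

theorem ae_fading_nonneg (hlaw : ∀ i, HasLaw (M i) T.markLaw P) :
    ∀ᵐ ω ∂P, ∀ j, 0 ≤ (M j ω).2.1 := by
  have := T.isProbabilityMeasure_fading
  have h : ∀ᵐ m ∂T.markLaw, 0 ≤ m.2.1 :=
    Measure.quasiMeasurePreserving_snd.ae (Measure.quasiMeasurePreserving_fst.ae T.ae_gamma_nonneg)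
  refine ae_all_iff.2 fun j => ?_
  rw [← (hlaw j).map_eq] at h
  exact ae_of_ae_map (hlaw j).aemeasurable h

/-- Independent marks turn the mean of the product into a product of means: station `i` contributes
its caching probability, every other station in the ball its `ret`. -/
theorem integral_payoff_exp (hlaw : ∀ i, HasLaw (M i) T.markLaw P) (hind : iIndepFun M P)
    (n : ℕ) {τ : ℝ} (hτ : 0 ≤ τ) {i : ℕ} {x : ℕ → Plane} (hx : Regular T.RL x)
    (hi : ‖x i‖ ≤ T.RL) :
    ∫ ω, T.payoff τ i (fun γ => Real.exp (-(n * T.η * γ))) (x, fun j => M j ω) ∂P =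
      T.p * T.noiseFactor n τ ‖x i‖ *
        ∏ j ∈ (ballIdx T.RL x).erase i, T.ret n τ ‖x i‖ (‖x j‖ ^ 2) := by
  set A := ballIdx T.RL x with hA
  have hiA : i ∈ A := (mem_ballIdx hx.finite).2 hi
  set φ : ℕ → Mark → ℝ := fun j m =>
    if j = i then (if m.1 = true then 1 else 0) else T.factor n τ ‖x i‖ ‖x j‖ m with hφ
  have hφm : ∀ j, Measurable (φ j) := by
    intro j
    by_cases h : j = i
    · simp only [hφ, h, if_true]
      have hms : MeasurableSet {m : Mark | m.1 = true} :=
        measurable_fst (measurableSet_singleton true)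
      exact Measurable.ite hms measurable_const measurable_const
    · simp only [hφ, h, if_false]
      exact T.measurable_factor n τ ‖x i‖ ‖x j‖
  have hprod : ∀ ω, (if (M i ω).1 = true then (1 : ℝ) else 0) *
      ∏ j ∈ A.erase i, T.factor n τ ‖x i‖ ‖x j‖ (M j ω) = ∏ j : A, φ j (M j ω) := by
    intro ω
    rw [Finset.prod_coe_sort A fun j => φ j (M j ω), ← Finset.mul_prod_erase A _ hiA]
    congr 1
    · simp [hφ]
    · refine Finset.prod_congr rfl fun j hj => ?_
      simp [hφ, Finset.ne_of_mem_erase hj]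
  have hone : ∀ j, ∫ ω, φ j (M j ω) ∂P = ∫ m, φ j m ∂T.markLaw := fun j =>
    (hlaw j).integral_comp (hφm j).aestronglyMeasurable
  have hsub : iIndepFun (fun j : A => M j) P := hind.precomp Subtype.val_injective
  have hmain := hsub.integral_fun_prod_comp (f := fun j : A => φ j)
    (fun j => (hlaw j).aemeasurable) (fun j => (hφm j).aestronglyMeasurable)
  calc ∫ ω, T.payoff τ i (fun γ => Real.exp (-(n * T.η * γ))) (x, fun j => M j ω) ∂P
      = ∫ ω, T.noiseFactor n τ ‖x i‖ * ∏ j : A, φ j (M j ω) ∂P := by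
        refine integral_congr_ae ?_
        filter_upwards [T.ae_fading_nonneg hlaw] with ω hω
        rw [T.payoff_exp_eq n τ hx hω hi, ← hprod]
    _ = T.noiseFactor n τ ‖x i‖ * ∏ j : A, ∫ m, φ j m ∂T.markLaw := by
        rw [integral_const_mul, hmain]
        simp only [hone]
    _ = _ := by
        rw [Finset.prod_coe_sort A fun j => ∫ m, φ j m ∂T.markLaw,
          ← Finset.mul_prod_erase A _ hiA]
        have h1 : ∫ m, φ i m ∂T.markLaw = T.p := by
          simp only [hφ, if_true]
          exact T.integral_cached
        have h2 : ∀ j ∈ A.erase i, ∫ m, φ j m ∂T.markLaw = T.ret n τ ‖x i‖ (‖x j‖ ^ 2) := by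
          intro j hj
          simp only [hφ, Finset.ne_of_mem_erase hj, if_false]
          exact T.integral_factor n ‖x j‖ hτ (norm_nonneg _)
        rw [h1, Finset.prod_congr rfl h2]
        ring

theorem measurable_fadingCDF : Measurable T.fadingCDF := T.monotone_fadingCDF.measurable

/-- Given everything else, the fading power of the serving base station exceeds the required level
with the probability given by the Gamma law. -/
theorem integral_fading_gt_level [IsProbabilityMeasure P] (hM : ∀ i, Measurable (M i))
    (hlaw : ∀ i, HasLaw (M i) T.markLaw P) (hind : iIndepFun M P) (τ : ℝ) {i : ℕ} {x : ℕ → Plane}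
    (hx : Regular T.RL x) (hi : ‖x i‖ ≤ T.RL) :
    ∫ ω, (T.servedBy i).indicator (fun q => if T.level τ i q < (q.2 i).2.1 then (1 : ℝ) else 0)
      (x, fun j => M j ω) ∂P =
    ∫ ω, T.payoff τ i (fun γ => 1 - T.fadingCDF γ) (x, fun j => M j ω) ∂P := by
  classical
  set B := (ballIdx T.RL x).erase i with hB
  set V : Ω → (B → Mark) := fun ω j => M j ω with hV
  have hVm : Measurable V := measurable_pi_lambda _ fun j => hM j
  -- Both the required level and the absence of a nearer caching station depend only on the marks of
  -- the other stations in the ball, which are independent of the mark of `i`.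
  have hVi : IndepFun V (M i) P := by
    have h := hind.indepFun_finset {i} B (Finset.disjoint_singleton_left.2
      (Finset.notMem_erase i _)) hM
    exact (h.comp (measurable_pi_apply (⟨i, Finset.mem_singleton_self i⟩ : ({i} : Finset ℕ)))
      measurable_id).symm
  set lev : (B → Mark) → ℝ := fun v =>
    τ * (T.noise + ∑ j : B, T.rx (x j) (v j)) / (T.Pt * T.L ‖x i‖ * G0 * T.Nant) with hlev
  have hlevm : Measurable lev := by
    have : Measurable fun v : B → Mark => ∑ j : B, T.rx (x j) (v j) :=
      Finset.measurable_fun_sum _ fun j _ =>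
        T.measurable_rx measurable_const (measurable_pi_apply j)
    fun_prop
  set free : Set (B → Mark) := {v | ∀ j : B, ¬((v j).1 = true ∧ ‖x j‖ ^ 2 ≤ ‖x i‖ ^ 2)} with hfree
  have hfreem : MeasurableSet free := by
    have : free = ⋂ j : B, {v : B → Mark | (v j).1 = true ∧ ‖x j‖ ^ 2 ≤ ‖x i‖ ^ 2}ᶜ := by
      ext v
      simp [hfree]
    rw [this]
    refine MeasurableSet.iInter fun j => MeasurableSet.compl ?_
    have h1 : MeasurableSet {v : B → Mark | (v j).1 = true} :=
      (measurable_fst.comp (measurable_pi_apply j)) (measurableSet_singleton true)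
    exact h1.inter (MeasurableSet.const _)
  have hcached : MeasurableSet {z : (B → Mark) × Mark | z.2.1 = true} :=
    (measurable_fst.comp measurable_snd) (measurableSet_singleton true)
  have hlt : MeasurableSet {z : (B → Mark) × Mark | lev z.1 < z.2.2.1} :=
    measurableSet_lt (by fun_prop) (by fun_prop)
  have hfm : MeasurableSet {z : (B → Mark) × Mark | z.1 ∈ free} := measurable_fst hfreem
  set Φ : (B → Mark) × Mark → ℝ := fun z =>
    if z.1 ∈ free ∧ z.2.1 = true ∧ lev z.1 < z.2.2.1 then 1 else 0 with hΦ
  set Ψ : (B → Mark) × Mark → ℝ := fun z =>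
    if z.1 ∈ free ∧ z.2.1 = true then 1 - T.fadingCDF (lev z.1) else 0 with hΨ
  have hΦm : Measurable Φ :=
    Measurable.ite (hfm.inter (hcached.inter hlt)) measurable_const measurable_const
  have hΨm : Measurable Ψ :=
    Measurable.ite (hfm.inter hcached) (measurable_const.sub
      (T.measurable_fadingCDF.comp (hlevm.comp measurable_fst))) measurable_const
  have hΦ1 : ∀ z, |Φ z| ≤ 1 := by
    intro z
    simp only [hΦ]
    split_ifs <;> simp
  have hΨ1 : ∀ z, |Ψ z| ≤ 1 := by
    intro z
    have h1 := T.fadingCDF_nonneg (lev z.1)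
    have h2 := T.fadingCDF_le_one (lev z.1)
    simp only [hΨ]
    split_ifs
    · rw [abs_le]
      constructor <;> linarith
    · simp
  have hmem : ∀ ω, (x, fun j => M j ω) ∈ T.servedBy i ↔ V ω ∈ free ∧ (M i ω).1 = true := by
    intro ω
    rw [T.mem_servedBy_iff hx hi, and_comm]
    simp only [hfree, hV, Set.mem_ofPred_eq, Subtype.forall, hB]
  have hleveq : ∀ ω, (∀ j, 0 ≤ (M j ω).2.1) → T.level τ i (x, fun j => M j ω) = lev (V ω) := by
    intro ω hω
    rw [level, T.totalRx_eq i hx hω, hlev]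
    simp only [hV]
    rw [Finset.sum_coe_sort B fun j => T.rx (x j) (M j ω)]
  have e1 : ∫ ω, (T.servedBy i).indicator
      (fun q => if T.level τ i q < (q.2 i).2.1 then (1 : ℝ) else 0) (x, fun j => M j ω) ∂P =
      ∫ ω, Φ (V ω, M i ω) ∂P := by
    refine integral_congr_ae ?_
    filter_upwards [T.ae_fading_nonneg hlaw] with ω hω
    by_cases h : (x, fun j => M j ω) ∈ T.servedBy i
    · have h' := (hmem ω).1 h
      simp only [Set.indicator_of_mem h, hΦ, h'.1, h'.2, true_and, hleveq ω hω]
    · have h' := (hmem ω).not.1 h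
      rw [Set.indicator_of_notMem h]
      exact (if_neg fun hc => h' ⟨hc.1, hc.2.1⟩).symm
  have e2 : ∫ ω, T.payoff τ i (fun γ => 1 - T.fadingCDF γ) (x, fun j => M j ω) ∂P =
      ∫ ω, Ψ (V ω, M i ω) ∂P := by
    refine integral_congr_ae ?_
    filter_upwards [T.ae_fading_nonneg hlaw] with ω hω
    by_cases h : (x, fun j => M j ω) ∈ T.servedBy i
    · have h' := (hmem ω).1 h
      simp only [payoff, Set.indicator_of_mem h, hΨ, h'.1, h'.2, true_and, hleveq ω hω, if_true]
    · have h' := (hmem ω).not.1 h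
      rw [payoff, Set.indicator_of_notMem h]
      exact (if_neg h').symm
  -- Integrating out the mark of `i` with the others frozen gives the same function of `v` for `Φ`
  -- and for `Ψ`; this is the whole point of the comparison.
  have f1 : ∀ v, ∫ ω, Φ (v, M i ω) ∂P = if v ∈ free then T.p * (1 - T.fadingCDF (lev v)) else 0 := by
    intro v
    have := (hlaw i).integral_comp (f := fun m => Φ (v, m))
      (hΦm.comp measurable_prodMk_left).aestronglyMeasurable
    refine this.trans ?_
    by_cases hv : v ∈ free
    · simp only [hΦ, hv, true_and, if_true]
      exact T.integral_cached_fading (lev v)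
    · simp [hΦ, hv]
  have f2 : ∀ v, ∫ ω, Ψ (v, M i ω) ∂P = if v ∈ free then T.p * (1 - T.fadingCDF (lev v)) else 0 := by
    intro v
    have := (hlaw i).integral_comp (f := fun m => Ψ (v, m))
      (hΨm.comp measurable_prodMk_left).aestronglyMeasurable
    refine this.trans ?_
    by_cases hv : v ∈ free
    · simp only [hΨ, hv, true_and, if_true]
      have hmul : ∀ m : Mark, (if m.1 = true then 1 - T.fadingCDF (lev v) else 0) =
          (if m.1 = true then (1 : ℝ) else 0) * (1 - T.fadingCDF (lev v)) := by
        intro m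
        split_ifs <;> simp
      simp only [hmul]
      rw [integral_mul_const, T.integral_cached]
    · simp [hΨ, hv]
  rw [e1, e2, integral_indepFun hVi hVm (hM i) hΦm hΦ1, integral_indepFun hVi hVm (hM i) hΨm hΨ1]
  simp only [f1, f2]

end Params

end Pico

end

noncomputable section

namespace Pico

/-! ### Expectations over the random network -/

theorem mul_sqrt_relSq {R : ℝ} (hR : 0 < R) (y : Plane) : R * √(relSq R y) = ‖y‖ := by
  rw [relSq, Real.sqrt_div (by positivity), Real.sqrt_sq (norm_nonneg y), Real.sqrt_sq hR.le]
  field_simp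

theorem sq_mul_relSq {R : ℝ} (hR : 0 < R) (y : Plane) : R ^ 2 * relSq R y = ‖y‖ ^ 2 := by
  unfold relSq
  field_simp

variable {Ω : Type*} [MeasurableSpace Ω] {P : Measure Ω}

/-- The random configuration. -/
def conf (X : ℕ → Ω → Plane) (c : ℕ → Ω → Bool) (g θ : ℕ → Ω → ℝ) (ω : Ω) : Config :=
  (fun i => X i ω, fun i => (c i ω, g i ω, θ i ω))

namespace IsNetwork

variable {T : Params} {X : ℕ → Ω → Plane} {c : ℕ → Ω → Bool} {g θ : ℕ → Ω → ℝ}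

theorem measurable_locations (h : IsNetwork T P X c g θ) : Measurable fun ω i => X i ω :=
  measurable_pi_lambda _ h.hppp.measurable

theorem measurable_mark (h : IsNetwork T P X c g θ) (i : ℕ) :
    Measurable fun ω => ((c i ω, g i ω, θ i ω) : Mark) :=
  (h.meas_c i).prodMk ((h.meas_g i).prodMk (h.meas_θ i))

theorem measurable_marks (h : IsNetwork T P X c g θ) :
    Measurable fun ω i => ((c i ω, g i ω, θ i ω) : Mark) :=
  measurable_pi_lambda _ h.measurable_mark

theorem measurable_conf (h : IsNetwork T P X c g θ) : Measurable (conf X c g θ) :=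
  h.measurable_locations.prodMk h.measurable_marks

theorem ae_fading_nonneg (h : IsNetwork T P X c g θ) : ∀ᵐ ω ∂P, ∀ j, 0 ≤ g j ω :=
  T.ae_fading_nonneg h.law

variable [IsProbabilityMeasure P]

theorem ae_regular (h : IsNetwork T P X c g θ) : ∀ᵐ ω ∂P, Regular T.RL fun i => X i ω :=
  h.hppp.ae_regular T.RL_pos

/-- Averaging first over the marks, then over the locations. -/
theorem integral_conf (h : IsNetwork T P X c g θ) {F : Config → ℝ} (hF : Measurable F)
    (hF1 : ∀ q, |F q| ≤ 1) : ∫ ω, F (conf X c g θ ω) ∂P =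
      ∫ ω, ∫ ω', F (fun i => X i ω, fun i => (c i ω', g i ω', θ i ω')) ∂P ∂P :=
  integral_indepFun h.indep h.measurable_locations h.measurable_marks hF hF1

/-- The mean number of serving base stations in the line-of-sight ball, weighted by
`exp(-n η γ)` at the required fading power `γ`. -/
theorem hasSum_integral_payoff_exp (h : IsNetwork T P X c g θ) (n : ℕ) {τ : ℝ} (hτ : 0 ≤ τ) :
    HasSum (fun i => ∫ ω, T.payoff τ i (fun γ => Real.exp (-(n * T.η * γ))) (conf X c g θ ω) ∂P)
      (∫ t in (0 : ℝ)..1, Real.pi * T.dens * T.RL ^ 2 * (T.p * T.noiseFactor n τ (T.RL * √t)) *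
        Real.exp (-(Real.pi * T.dens * T.RL ^ 2 *
          ∫ t' in (0 : ℝ)..1, (1 - T.ret n τ (T.RL * √t) (T.RL ^ 2 * t'))))) := by
  have hR := T.RL_pos
  have hR2 : 0 < T.RL ^ 2 := by positivity
  have hη := T.η_pos
  set ψ : ℝ → ℝ := fun γ => Real.exp (-(n * T.η * γ)) with hψ
  have hψm : Measurable ψ := by fun_prop
  have hψ1 : ∀ γ, 0 ≤ γ → ψ γ ∈ Set.Icc (0 : ℝ) 1 := fun γ hγ =>
    ⟨(Real.exp_pos _).le, Real.exp_le_one_iff.2 (neg_nonpos.2 (by positivity))⟩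
  -- These are the mark averages of `integral_payoff_exp` rewritten in the coordinate `‖x‖² / R_L²`,
  -- so that Campbell–Mecke applies to them.
  set f : ℝ → ℝ := fun t => T.p * T.noiseFactor n τ (T.RL * √t) with hf
  set v : ℝ → ℝ → ℝ := fun s t => T.ret n τ (T.RL * √s) (T.RL ^ 2 * t) with hv
  have hpt := h.hppp.integral_pointSum T.dens_pos hR (f := f) (v := v) (C := 1) (by
      intro t _
      have h1 := T.p.2
      have h2 : T.noiseFactor n τ (T.RL * √t) ≤ 1 := Real.exp_le_one_iff.2
        (neg_nonpos.2 (T.noise_arg_nonneg n hτ (by positivity)))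
      have h3 : 0 ≤ T.noiseFactor n τ (T.RL * √t) := (Real.exp_pos _).le
      rw [abs_of_nonneg (mul_nonneg h1.1 h3)]
      exact mul_le_one₀ h1.2 h3 h2)
    (fun s _ t ht => T.ret_mem_Icc n hτ (by positivity) (mul_nonneg hR2.le ht.1.le)) (by
      intro t ht
      have : 0 < T.RL * √t := mul_pos hR (Real.sqrt_pos.2 ht.1)
      have h1 : ContinuousAt (fun t => (T.RL * √t) ^ T.α) t :=
        ContinuousAt.rpow_const (by fun_prop) (Or.inl this.ne')
      simp only [hf, Params.noiseFactor]
      fun_prop) (by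
      intro s hs t ht hst
      have hr : Tendsto (fun z : ℝ × ℝ => T.RL * √z.1) (𝓝 (s, t)) (𝓝 (T.RL * √s)) :=
        (show Continuous fun z : ℝ × ℝ => T.RL * √z.1 by fun_prop).tendsto (s, t)
      have hq : Tendsto (fun z : ℝ × ℝ => T.RL ^ 2 * z.2) (𝓝 (s, t)) (𝓝 (T.RL ^ 2 * t)) :=
        (show Continuous fun z : ℝ × ℝ => T.RL ^ 2 * z.2 by fun_prop).tendsto (s, t)
      refine (T.tendsto_thin hr hq ?_).mul
        (T.tendsto_meanKern hr hq (mul_pos hR (Real.sqrt_pos.2 hs.1)) (mul_pos hR2 ht.1) n hτ)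
      rw [mul_pow, Real.sq_sqrt hs.1.le]
      exact fun hc => hst (mul_left_cancel₀ hR2.ne' hc).symm)
  set S : Ω → ℝ := fun ω => IsHPPP.pointSum f v (ballIdx T.RL fun i => X i ω)
    fun i => relSq T.RL (X i ω) with hS
  set q : ℕ → Ω → ℝ := fun i ω =>
    ∫ ω', T.payoff τ i ψ (fun i => X i ω, fun i => (c i ω', g i ω', θ i ω')) ∂P with hq
  have hpm := fun i => T.measurable_payoff τ i hψm
  have hqm : ∀ i, AEStronglyMeasurable (q i) P := by
    intro i
    have : Measurable fun z : Ω × Ω => T.payoff τ i ψ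
        (fun i => X i z.1, fun i => (c i z.2, g i z.2, θ i z.2)) :=
      (hpm i).comp ((h.measurable_locations.comp measurable_fst).prodMk
        (h.measurable_marks.comp measurable_snd))
    exact this.stronglyMeasurable.integral_prod_right'.aestronglyMeasurable
  have hq0 : ∀ i ω, 0 ≤ q i ω := fun i ω => integral_nonneg fun ω' =>
    Set.indicator_nonneg (fun _ _ => (Real.exp_pos _).le) _
  have hsum : ∀ᵐ ω ∂P, HasSum (fun i => q i ω) (S ω) := by
    filter_upwards [h.ae_regular] with ω hω
    have hin : ∀ i ∈ ballIdx T.RL fun i => X i ω, f (relSq T.RL (X i ω)) *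
        ∏ j ∈ (ballIdx T.RL fun i => X i ω).erase i,
          v (relSq T.RL (X i ω)) (relSq T.RL (X j ω)) = q i ω := by
      intro i hi
      simp only [hf, hv, mul_sqrt_relSq hR, sq_mul_relSq hR]
      exact (T.integral_payoff_exp h.law h.marks_indep n hτ hω
        ((mem_ballIdx hω.finite).1 hi)).symm
    have hout : ∀ i ∉ ballIdx T.RL fun i => X i ω, q i ω = 0 := by
      intro i hi
      refine (integral_congr_ae (Eventually.of_forall fun ω' => ?_)).trans (integral_zero Ω ℝ)
      exact Set.indicator_of_notMem (fun hc => hi ((mem_ballIdx hω.finite).2 hc.2.1)) _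
    have hfin : HasSum (fun i => q i ω) (∑ i ∈ ballIdx T.RL fun i => X i ω, q i ω) :=
      hasSum_sum_of_ne_finset_zero hout
    rwa [← Finset.sum_congr rfl hin] at hfin
  -- The terms are nonnegative and so dominate themselves; their sum is integrable by the
  -- Campbell–Mecke formula.
  have hmain := hasSum_integral_of_dominated_convergence (F := q) (f := S) q hqm
    (fun i => Eventually.of_forall fun ω => by rw [Real.norm_eq_abs, abs_of_nonneg (hq0 i ω)])
    (hsum.mono fun ω hω => hω.summable)
    (hpt.1.congr (hsum.mono fun ω hω => hω.tsum_eq.symm)) hsum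
  rw [← hpt.2]
  refine hmain.congr_fun fun i => ?_
  exact h.integral_conf (hpm i) (T.abs_payoff_le hτ i hψ1)

/-- The case `n = 0`, where the weight is constant. It dominates every bounded payoff in the
summability argument below and gives the factor of `gammaGap` in the error bound. -/
theorem hasSum_integral_payoff_one (h : IsNetwork T P X c g θ) {τ : ℝ} (hτ : 0 ≤ τ) :
    HasSum (fun i => ∫ ω, T.payoff τ i (fun _ => 1) (conf X c g θ ω) ∂P)
      (1 - Real.exp (-(Real.pi * T.p * T.dens * T.RL ^ 2))) := by
  have := h.hasSum_integral_payoff_exp 0 hτ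
  rw [T.integral_laplace_zero τ] at this
  simpa only [Nat.cast_zero, zero_mul, neg_zero, Real.exp_zero] using this

/-- Functions of the configuration that vanish unless the base station serves can be summed over
the base stations under the expectation. -/
theorem hasSum_integral_of_servedBy (h : IsNetwork T P X c g θ) {Z : ℕ → Config → ℝ}
    (hZm : ∀ i, Measurable (Z i)) (hZ1 : ∀ i q, |Z i q| ≤ 1)
    (hZ0 : ∀ i, ∀ q ∉ T.servedBy i, Z i q = 0) :
    Integrable (fun ω => ∑' i, Z i (conf X c g θ ω)) P ∧
    HasSum (fun i => ∫ ω, Z i (conf X c g θ ω) ∂P) (∫ ω, ∑' i, Z i (conf X c g θ ω) ∂P) := by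
  have hZc : ∀ i, Measurable fun ω => Z i (conf X c g θ ω) := fun i => (hZm i).comp h.measurable_conf
  have hZi : ∀ i, Integrable (fun ω => Z i (conf X c g θ ω)) P := fun i =>
    Integrable.of_bound (hZc i).aestronglyMeasurable 1 (Eventually.of_forall fun ω => hZ1 i _)
  constructor
  · refine Integrable.of_bound (Measurable.tsum hZc).aestronglyMeasurable 1 ?_
    filter_upwards [h.ae_regular] with ω hω
    by_cases hk : ∃ k, conf X c g θ ω ∈ T.servedBy k
    · obtain ⟨k, hk⟩ := hk
      have hne : ∀ i, i ≠ k → Z i (conf X c g θ ω) = 0 := fun i hi =>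
        hZ0 i _ fun hc => hi (T.eq_of_mem_servedBy hω hc hk)
      rw [tsum_eq_single k hne]
      exact hZ1 k _
    · have : ∀ i, Z i (conf X c g θ ω) = 0 := fun i => hZ0 i _ fun hc => hk ⟨i, hc⟩
      simp [this]
  · refine hasSum_integral_of_summable_integral_norm hZi ?_
    refine (h.hasSum_integral_payoff_one le_rfl).summable.of_nonneg_of_le
      (fun i => integral_nonneg fun _ => norm_nonneg _) fun i => ?_
    have hp : Measurable fun ω => T.payoff 0 i (fun _ => 1) (conf X c g θ ω) :=
      (T.measurable_payoff 0 i measurable_const).comp h.measurable_conf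
    refine integral_mono (hZi i).norm (Integrable.of_bound hp.aestronglyMeasurable 1
      (Eventually.of_forall fun ω => T.abs_payoff_le le_rfl i (by simp) _)) fun ω => ?_
    by_cases hq : conf X c g θ ω ∈ T.servedBy i
    · simpa [Params.payoff, Set.indicator_of_mem hq] using hZ1 i (conf X c g θ ω)
    · simp [Params.payoff, Set.indicator_of_notMem hq, hZ0 i _ hq]

end IsNetwork

end Pico

end

noncomputable section

namespace Pico

/-! ### Coverage probability, its replacement and the error bound -/

namespace Params

variable (T : Params)

theorem replacement_eq_sum (γ : ℝ) : 1 - (1 - Real.exp (-(T.η * γ))) ^ T.Np =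
    ∑ n ∈ Finset.Icc 1 T.Np, (-1) ^ (n + 1) * (T.Np.choose n : ℝ) *
      Real.exp (-(n * T.η * γ)) := by
  have hb : (1 - Real.exp (-(T.η * γ))) ^ T.Np = ∑ n ∈ Finset.range (T.Np + 1),
      (-1) ^ n * (T.Np.choose n : ℝ) * Real.exp (-(n * T.η * γ)) := by
    have h := add_pow (-Real.exp (-(T.η * γ))) 1 T.Np
    rw [neg_add_eq_sub] at h
    rw [h]
    refine Finset.sum_congr rfl fun n _ => ?_
    have : -(n * T.η * γ) = n * -(T.η * γ) := by ring
    rw [this, Real.exp_nat_mul, neg_pow, one_pow]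
    ring
  rw [hb, Finset.range_eq_Ico, Finset.sum_eq_sum_Ico_succ_bot (Nat.succ_pos _)]
  have hI : Finset.Ico (0 + 1) (T.Np + 1) = Finset.Icc 1 T.Np := by
    ext n
    simp
  rw [hI]
  simp only [pow_zero, Nat.choose_zero_right, Nat.cast_one, mul_one, Nat.cast_zero, zero_mul,
    neg_zero, Real.exp_zero, sub_add_cancel_left, ← Finset.sum_neg_distrib]
  refine Finset.sum_congr rfl fun n _ => ?_
  ring

end Params

variable {Ω : Type*} {T : Params} {X : ℕ → Ω → Plane} {c : ℕ → Ω → Bool} {g θ : ℕ → Ω → ℝ}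

theorem isServing_and_norm_le_iff {i : ℕ} {ω : Ω} :
    IsServing X c i ω ∧ ‖X i ω‖ ≤ T.RL ↔ conf X c g θ ω ∈ T.servedBy i := by
  simp only [IsServing, conf, Params.servedBy, Set.mem_ofPred_eq]
  tauto

/-- Both interference sums are finite because the path loss vanishes beyond `R_L`. Since `i` caches
the file it is absent from the second one, so together they run over all stations except `i`. -/
theorem interf_eq_totalRx {ω : Ω} (hω : Regular T.RL fun i => X i ω) (hg : ∀ j, 0 ≤ g j ω) {i : ℕ}
    (hi : c i ω = true) : interfCached T X c g θ i ω + interfUncached T X c g θ ω =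
      T.totalRx i (conf X c g θ ω) := by
  have hout : ∀ j ∉ ballIdx T.RL fun i => X i ω, rxPower T X g θ j ω = 0 := by
    intro j hj
    have : T.RL < ‖X j ω‖ := by
      by_contra hle
      exact hj ((mem_ballIdx hω.finite).2 (not_lt.1 hle))
    simp [rxPower, T.L_of_lt this]
  rw [conf, T.totalRx_eq i hω hg, interfCached, interfUncached,
    tsum_eq_sum (s := ballIdx T.RL fun i => X i ω) (fun j hj => by simp [hout j hj]),
    tsum_eq_sum (s := ballIdx T.RL fun i => X i ω) (fun j hj => by simp [hout j hj]),
    ← Finset.sum_add_distrib, ← Finset.sum_erase (a := i) _ (by simp [hi])]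
  refine Finset.sum_congr rfl fun j hj => ?_
  have hji := Finset.ne_of_mem_erase hj
  have hrx : T.rx (X j ω) (c j ω, g j ω, θ j ω) = rxPower T X g θ j ω := rfl
  rw [hrx]
  cases hc : c j ω <;> simp [hji]

theorem fadingLevel_eq_level {ω : Ω} (hω : Regular T.RL fun i => X i ω) (hg : ∀ j, 0 ≤ g j ω)
    (τ : ℝ) {i : ℕ} (hi : c i ω = true) :
    fadingLevel T X c g θ τ i ω = T.level τ i (conf X c g θ ω) := by
  rw [fadingLevel, add_assoc, interf_eq_totalRx hω hg hi]
  rfl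

/-- Beyond the ball the ratio is `0` and cannot exceed `τ ≥ 0`, so the line-of-sight restriction
costs nothing. Inside, both denominators are positive and the inequality can be solved for the
fading power. -/
theorem isServing_and_lt_sinr_iff {ω : Ω} (hω : Regular T.RL fun i => X i ω)
    (hg : ∀ j, 0 ≤ g j ω) {τ : ℝ} (hτ : 0 ≤ τ) {i : ℕ} :
    IsServing X c i ω ∧ τ < sinr T X c g θ i ω ↔
      conf X c g θ ω ∈ T.servedBy i ∧ T.level τ i (conf X c g θ ω) < g i ω := by
  rw [← isServing_and_norm_le_iff, and_assoc]
  refine and_congr_right fun hs => ?_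
  have htot : 0 ≤ T.totalRx i (conf X c g θ ω) := ENNReal.toReal_nonneg
  have hD : 0 < T.noise + T.totalRx i (conf X c g θ ω) := add_pos_of_pos_of_nonneg T.noise_pos htot
  rw [sinr, add_assoc, interf_eq_totalRx hω hg hs.1]
  rcases le_or_gt ‖X i ω‖ T.RL with h | h
  · have hL : 0 < T.L ‖X i ω‖ := by
      rw [T.L_of_le h]
      exact mul_pos T.C_pos (Real.rpow_pos_of_pos (norm_pos_iff.2 (hω.ne_zero i)) _)
    have hN : (0 : ℝ) < T.Nant := Nat.cast_pos.2 T.Nant_pos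
    have hden : 0 < T.Pt * T.L ‖X i ω‖ * G0 * T.Nant := by
      have := T.Pt_pos
      unfold G0
      positivity
    have hlev : T.level τ i (conf X c g θ ω) = τ * (T.noise + T.totalRx i (conf X c g θ ω)) /
      (T.Pt * T.L ‖X i ω‖ * G0 * T.Nant) := rfl
    rw [hlev, lt_div_iff₀ hD, div_lt_iff₀ hden, mul_comm (g i ω)]
    simp [h]
  · simp [T.L_of_lt h, h.not_ge, hτ]

namespace IsNetwork

variable [MeasurableSpace Ω] {P : Measure Ω} [IsProbabilityMeasure P]

/-- The binomial expansion writes the payoff as a finite combination of exponential weights, whose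
sums over the stations are already known. -/
theorem hasSum_integral_payoff_replacement (h : IsNetwork T P X c g θ) {τ : ℝ} (hτ : 0 ≤ τ) :
    HasSum (fun i => ∫ ω, T.payoff τ i (fun γ => 1 - (1 - Real.exp (-(T.η * γ))) ^ T.Np)
      (conf X c g θ ω) ∂P) (T.coverageInt τ) := by
  have hη := T.η_pos
  have hs := hasSum_sum (s := Finset.Icc 1 T.Np) fun n _ =>
    (h.hasSum_integral_payoff_exp n hτ).mul_left ((-1) ^ (n + 1) * (T.Np.choose n : ℝ))
  simp only [T.integral_laplace_eq hτ] at hs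
  refine hs.congr_fun fun i => ?_
  simp only [← integral_const_mul]
  rw [← integral_finsetSum]
  · refine integral_congr_ae (Eventually.of_forall fun ω => ?_)
    by_cases hq : conf X c g θ ω ∈ T.servedBy i
    · simp only [Params.payoff, Set.indicator_of_mem hq, T.replacement_eq_sum]
    · simp [Params.payoff, Set.indicator_of_notMem hq]
  · intro n _
    have hm : Measurable fun γ : ℝ => Real.exp (-(n * T.η * γ)) := by fun_prop
    refine Integrable.const_mul (Integrable.of_bound
      ((T.measurable_payoff τ i hm).comp h.measurable_conf).aestronglyMeasurable 1
      (Eventually.of_forall fun ω => T.abs_payoff_le hτ i (fun γ hγ => ?_) _)) _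
    exact ⟨(Real.exp_pos _).le, Real.exp_le_one_iff.2 (neg_nonpos.2 (by positivity))⟩

/-- The integral expression is the expectation of the replaced conditional coverage probability. -/
theorem integral_replacedCoverage (h : IsNetwork T P X c g θ) {τ : ℝ} (hτ : 0 ≤ τ) :
    Integrable (replacedCoverage T X c g θ τ) P ∧
      T.coverageInt τ = ∫ ω, replacedCoverage T X c g θ τ ω ∂P := by
  set ψ : ℝ → ℝ := fun γ => 1 - (1 - Real.exp (-(T.η * γ))) ^ T.Np with hψ
  have hψ1 : ∀ γ, 0 ≤ γ → ψ γ ∈ Set.Icc (0 : ℝ) 1 := fun γ hγ =>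
    ⟨sub_nonneg.2 (T.replacement_mem_Icc hγ).2, sub_le_self _ (T.replacement_mem_Icc hγ).1⟩
  have hψm : Measurable ψ := by fun_prop
  have hZ := h.hasSum_integral_of_servedBy (fun i => T.measurable_payoff τ i hψm)
    (fun i => T.abs_payoff_le hτ i hψ1) (fun i q hq => Set.indicator_of_notMem hq _)
  have hae : (fun ω => ∑' i, T.payoff τ i ψ (conf X c g θ ω)) =ᵐ[P]
      replacedCoverage T X c g θ τ := by
    filter_upwards [h.ae_regular, h.ae_fading_nonneg] with ω hω hg
    refine tsum_congr fun i => ?_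
    by_cases hq : conf X c g θ ω ∈ T.servedBy i
    · rw [if_pos (isServing_and_norm_le_iff.2 hq), fadingLevel_eq_level hω hg τ hq.1,
        Params.payoff, Set.indicator_of_mem hq]
    · rw [if_neg (isServing_and_norm_le_iff.not.2 hq), Params.payoff, Set.indicator_of_notMem hq]
  refine ⟨hZ.1.congr hae, ?_⟩
  rw [← integral_congr_ae hae]
  exact (h.hasSum_integral_payoff_replacement hτ).unique hZ.2

/-- Almost surely coverage is the union, over stations in the ball, of disjoint events: the station
serves and its fading exceeds the level. With the locations fixed, `integral_fading_gt_level`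
replaces the indicator of the fading event by its conditional probability. -/
theorem hasSum_integral_payoff_coverage (h : IsNetwork T P X c g θ) {τ : ℝ} (hτ : 0 ≤ τ) :
    HasSum (fun i => ∫ ω, T.payoff τ i (fun γ => 1 - T.fadingCDF γ) (conf X c g θ ω) ∂P)
      (coverage T P X c g θ τ) := by
  set Z : ℕ → Config → ℝ := fun i =>
    (T.servedBy i).indicator fun q => if T.level τ i q < (q.2 i).2.1 then (1 : ℝ) else 0 with hZdef
  have hlt : ∀ i, MeasurableSet {q : Config | T.level τ i q < (q.2 i).2.1} := fun i =>
    measurableSet_lt (T.measurable_level τ i) (by fun_prop)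
  have hZm : ∀ i, Measurable (Z i) := fun i =>
    (Measurable.ite (hlt i) measurable_const measurable_const).indicator (T.measurableSet_servedBy i)
  have hZ1 : ∀ i q, |Z i q| ≤ 1 := by
    intro i q
    by_cases hq : q ∈ T.servedBy i
    · simp only [hZdef, Set.indicator_of_mem hq]
      split_ifs <;> simp
    · simp [hZdef, Set.indicator_of_notMem hq]
  have hZ := h.hasSum_integral_of_servedBy hZm hZ1 fun i q hq => Set.indicator_of_notMem hq _
  have hFm : Measurable fun γ => 1 - T.fadingCDF γ := measurable_const.sub T.measurable_fadingCDF
  have hterm : ∀ i, ∫ ω, T.payoff τ i (fun γ => 1 - T.fadingCDF γ) (conf X c g θ ω) ∂P =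
      ∫ ω, Z i (conf X c g θ ω) ∂P := by
    intro i
    rw [h.integral_conf (hZm i) (hZ1 i), h.integral_conf (T.measurable_payoff τ i hFm)
      (T.abs_payoff_le hτ i fun γ _ =>
        ⟨sub_nonneg.2 (T.fadingCDF_le_one γ), sub_le_self _ (T.fadingCDF_nonneg γ)⟩)]
    refine integral_congr_ae ?_
    filter_upwards [h.ae_regular] with ω hω
    rcases le_or_gt ‖X i ω‖ T.RL with hi | hi
    · exact (T.integral_fading_gt_level h.measurable_mark h.law h.marks_indep τ hω hi).symm
    · refine integral_congr_ae (Eventually.of_forall fun ω' => ?_)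
      have hn : ((fun i => X i ω, fun i => (c i ω', g i ω', θ i ω')) : Config) ∉ T.servedBy i :=
        fun hc => hi.not_ge hc.2.1
      exact (Set.indicator_of_notMem hn _).trans (Set.indicator_of_notMem hn _).symm
  set S : Set Ω := ⋃ i, conf X c g θ ⁻¹' (T.servedBy i ∩ {q | T.level τ i q < (q.2 i).2.1}) with hS
  have hSm : MeasurableSet S := MeasurableSet.iUnion fun i =>
    h.measurable_conf ((T.measurableSet_servedBy i).inter (hlt i))
  have hcov : coverage T P X c g θ τ = P.real S := by
    refine measureReal_congr ?_
    filter_upwards [h.ae_regular, h.ae_fading_nonneg] with ω hω hg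
    refine propext ?_
    change (∃ i, IsServing X c i ω ∧ τ < sinr T X c g θ i ω) ↔ ω ∈ S
    simp only [isServing_and_lt_sinr_iff hω hg hτ, hS, Set.mem_iUnion]
    rfl
  have hsumZ : (fun ω => ∑' i, Z i (conf X c g θ ω)) =ᵐ[P] S.indicator 1 := by
    filter_upwards [h.ae_regular] with ω hω
    by_cases hk : ω ∈ S
    · obtain ⟨k, hk1, hk2⟩ := Set.mem_iUnion.1 hk
      have hne : ∀ i, i ≠ k → Z i (conf X c g θ ω) = 0 := fun i hi =>
        Set.indicator_of_notMem (fun hc => hi (T.eq_of_mem_servedBy hω hc hk1)) _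
      rw [tsum_eq_single k hne, Set.indicator_of_mem hk]
      exact (Set.indicator_of_mem hk1 _).trans (if_pos hk2)
    · rw [Set.indicator_of_notMem hk]
      have : ∀ i, Z i (conf X c g θ ω) = 0 := by
        intro i
        by_cases hq : conf X c g θ ω ∈ T.servedBy i
        · refine (Set.indicator_of_mem hq _).trans (if_neg fun hc => hk ?_)
          exact Set.mem_iUnion.2 ⟨i, hq, hc⟩
        · exact Set.indicator_of_notMem hq _
      simp [this]
  rw [hcov, ← integral_indicator_one hSm, ← integral_congr_ae hsumZ]
  exact hZ.2.congr_fun hterm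

theorem integral_payoff_mono (h : IsNetwork T P X c g θ) {τ : ℝ} (hτ : 0 ≤ τ) (i : ℕ)
    {φ ψ : ℝ → ℝ} {C : ℝ} (hφm : Measurable φ) (hψm : Measurable ψ)
    (hφ : ∀ γ, 0 ≤ γ → |φ γ| ≤ C) (hψ : ∀ γ, 0 ≤ γ → |ψ γ| ≤ C)
    (hle : ∀ γ, 0 ≤ γ → φ γ ≤ ψ γ) :
    ∫ ω, T.payoff τ i φ (conf X c g θ ω) ∂P ≤ ∫ ω, T.payoff τ i ψ (conf X c g θ ω) ∂P := by
  have hint : ∀ {χ : ℝ → ℝ}, Measurable χ → (∀ γ, 0 ≤ γ → |χ γ| ≤ C) →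
      Integrable (fun ω => T.payoff τ i χ (conf X c g θ ω)) P := by
    intro χ hχm hχ
    refine Integrable.of_bound
      ((T.measurable_payoff τ i hχm).comp h.measurable_conf).aestronglyMeasurable C
      (Eventually.of_forall fun ω => ?_)
    rw [Real.norm_eq_abs, Params.payoff]
    by_cases hq : conf X c g θ ω ∈ T.servedBy i
    · rw [Set.indicator_of_mem hq]
      exact hχ _ (T.level_nonneg hτ i _)
    · rw [Set.indicator_of_notMem hq, abs_zero]
      exact (abs_nonneg _).trans (hχ 0 le_rfl)
  refine integral_mono (hint hφm hφ) (hint hψm hψ) fun ω => ?_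
  exact Set.indicator_le_indicator (hle _ (T.level_nonneg hτ i _))

/-- Station by station this is Alzer's inequality at the required level. -/
theorem coverage_le (h : IsNetwork T P X c g θ) {τ : ℝ} (hτ : 0 ≤ τ) :
    coverage T P X c g θ τ ≤ T.coverageInt τ := by
  refine hasSum_le (fun i => ?_) (h.hasSum_integral_payoff_coverage hτ)
    (h.hasSum_integral_payoff_replacement hτ)
  refine h.integral_payoff_mono hτ i (C := 1) (measurable_const.sub T.measurable_fadingCDF)
    (by fun_prop) (fun γ _ => ?_) (fun γ hγ => ?_) (fun γ hγ => ?_)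
  · have h1 := T.fadingCDF_nonneg γ
    have h2 := T.fadingCDF_le_one γ
    rw [abs_le]
    constructor <;> linarith
  · have h1 := T.replacement_mem_Icc hγ
    rw [abs_le]
    constructor <;> linarith [h1.1, h1.2]
  · exact sub_le_sub_left (T.replacement_le_fadingCDF hγ) 1

/-- The replacement costs at most `gammaGap` whenever a station of the ball serves, and the total
weight of these events is given by `hasSum_integral_payoff_one`. -/
theorem le_coverage_add (h : IsNetwork T P X c g θ) {τ : ℝ} (hτ : 0 ≤ τ) :
    T.coverageInt τ ≤ coverage T P X c g θ τ +
      T.gammaGap * (1 - Real.exp (-(Real.pi * T.p * T.dens * T.RL ^ 2))) := by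
  have hgap : 0 ≤ T.gammaGap := Real.iSup_nonneg fun _ => abs_nonneg _
  refine hasSum_le (fun i => ?_) (h.hasSum_integral_payoff_replacement hτ)
    ((h.hasSum_integral_payoff_coverage hτ).add
      ((h.hasSum_integral_payoff_one hτ).mul_left T.gammaGap))
  have hFm : Measurable fun γ => 1 - T.fadingCDF γ := measurable_const.sub T.measurable_fadingCDF
  have hF : ∀ γ, |1 - T.fadingCDF γ| ≤ 1 := by
    intro γ
    have h1 := T.fadingCDF_nonneg γ
    have h2 := T.fadingCDF_le_one γ
    rw [abs_le]
    constructor <;> linarith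
  have hsplit : ∫ ω, T.payoff τ i (fun γ => 1 - T.fadingCDF γ) (conf X c g θ ω) ∂P +
      T.gammaGap * ∫ ω, T.payoff τ i (fun _ => 1) (conf X c g θ ω) ∂P =
      ∫ ω, T.payoff τ i (fun γ => 1 - T.fadingCDF γ + T.gammaGap) (conf X c g θ ω) ∂P := by
    rw [← integral_const_mul, ← integral_add]
    · refine integral_congr_ae (Eventually.of_forall fun ω => ?_)
      by_cases hq : conf X c g θ ω ∈ T.servedBy i
      · simp [Params.payoff, Set.indicator_of_mem hq]
      · simp [Params.payoff, Set.indicator_of_notMem hq]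
    · exact Integrable.of_bound
        ((T.measurable_payoff τ i hFm).comp h.measurable_conf).aestronglyMeasurable 1
        (Eventually.of_forall fun ω => T.abs_payoff_le hτ i (fun γ _ =>
          ⟨sub_nonneg.2 (T.fadingCDF_le_one γ), sub_le_self _ (T.fadingCDF_nonneg γ)⟩) _)
    · exact (Integrable.of_bound
        ((T.measurable_payoff τ i measurable_const).comp h.measurable_conf).aestronglyMeasurable 1
        (Eventually.of_forall fun ω => T.abs_payoff_le hτ i (by simp) _)).const_mul _
  rw [hsplit]
  refine h.integral_payoff_mono hτ i (C := 1 + T.gammaGap) (by fun_prop) (hFm.add_const _)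
    (fun γ hγ => ?_) (fun γ _ => ?_) (fun γ hγ => ?_)
  · have h1 := T.replacement_mem_Icc hγ
    rw [abs_le]
    constructor <;> linarith [h1.1, h1.2]
  · exact (abs_add_le _ _).trans (add_le_add (hF γ) (abs_of_nonneg hgap).le)
  · linarith [T.fadingCDF_sub_le_gammaGap hγ]

end IsNetwork

end Pico

end

theorem theorem1 {Ω : Type*} [MeasurableSpace Ω] (P : Measure Ω) [IsProbabilityMeasure P]
    (T : Pico.Params) (X : ℕ → Ω → Pico.Plane) (c : ℕ → Ω → Bool) (g θ : ℕ → Ω → ℝ)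
    (hnet : Pico.IsNetwork T P X c g θ) (τ : ℝ) (hτ : 0 ≤ τ) :
    Tendsto (fun u : ℕ × ℕ => T.coverageGC u.1 u.2 τ) (atTop ×ˢ atTop) (𝓝 (T.coverageInt τ)) ∧
    (Integrable (Pico.replacedCoverage T X c g θ τ) P ∧
      T.coverageInt τ = ∫ ω, Pico.replacedCoverage T X c g θ τ ω ∂P) ∧
    Pico.coverage T P X c g θ τ ≤ T.coverageInt τ ∧
    T.coverageInt τ ≤ Pico.coverage T P X c g θ τ +
      T.gammaGap * (1 - Real.exp (-(Real.pi * T.p * T.dens * T.RL ^ 2))) ∧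
    (T.Np = 1 → Pico.coverage T P X c g θ τ = T.coverageInt τ) := by
  refine ⟨T.tendsto_coverageGC hτ, hnet.integral_replacedCoverage hτ, hnet.coverage_le hτ,
    hnet.le_coverage_add hτ, fun hN => ?_⟩
  have h := hnet.le_coverage_add hτ
  rw [T.gammaGap_of_Np_eq_one hN, zero_mul, add_zero] at h
  exact le_antisymm (hnet.coverage_le hτ) h
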